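/- **Setting.** Let $1<p<2$, $\kappa>0$ and let $h\in C^3((0,\infty))$ be strictly convex with $h(t)\to+\infty$ as $t\to0^+$ and $h(t)/t\to+\infty$ as $t\to+\infty$, such that the stored energy density $W(A)=\kappa|A|^p+h(\det A)$ ($|\cdot|$ the Frobenius norm) is positive on the real $2\times2$ matrices with positive determinant. Let $0<\varepsilon<\gamma\le1$, $\Lambda=(0,2\pi)$, $I=(-1,1)$, $\Omega'=I\times\Lambda$, $r=\frac{\gamma+\varepsilon}2+\frac{\gamma-\varepsilon}2\rho$, $\rho_r=\frac{2}{\gamma-\varepsilon}$. For functions $P,Q$ of $(\rho,\phi)$ put $$D(P,Q)=\frac{\rho_r}{r}P\,[P_\rho(Q_\phi+1)-P_\phi Q_\rho],\qquad F(P,Q)=\frac{\rho_r^2}{2}(P_\rho^2+P^2Q_\rho^2)+\frac1{2r^2}[P_\phi^2+P^2(Q_\phi+1)^2],$$ $$E(P,Q)=\int_{\Omega'}\big[g(F(P,Q))+h(D(P,Q))\big]\frac{r}{\rho_r}\,d\rho\,d\phi,\qquad g(t)=\kappa(\sqrt{2t})^p .$$ All functions of $\phi$ are $2\pi$-periodic.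 For given boundary data $P_0,Q_0$ let $\mathcal B_+$ be the set of pairs $(P,Q)$ that are $2\pi$-periodic in $\phi$, $C^1$ on $[-1,1]\times\mathbb R$, satisfy $P(1,\phi)=P_0(\phi)$, $Q(1,\phi)=Q_0(\phi)$ and have $D(P,Q)>0$ on $\overline{\Omega'}$. For an integer $l\ge 0$ let $H^l(\Lambda;H^l_\omega(I))$ be the space of functions, $2\pi$-periodic in $\phi$, whose weak derivatives $\partial_\phi^k\partial_\rho^j$ ($0\le k,j\le l$) on $I\times\mathbb R$ exist and are square integrable over $\Omega'$ with weight $\omega(\rho)=(1-\rho^2)^{-1/2}$. For $M\ge1$ and even $N\ge2$, $I^{NM}v$ denotes the unique function in the span of the products of $T_j(\rho)=\cos(j\arccos\rho)$ ($0\le j\le M$) with $\cos k\phi$ ($0\le k\le N/2$) and $\sin k\phi$ ($1\le k\le N/2-1$) that agrees with $v$ at the nodes $(\cos\frac{m\pi}{M},\frac{2\pi n}{N})$, $0\le m\le M$, $0\le n\le N-1$. **Theorem 4.5.** Let $(P,Q)$ be a cavitation solution satisfying * (H1) $(P,Q)\in\mathcal B_+$, $P,Q\in H^l(\Lambda;H^l_\omega(I))$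 for an integer $l>6$, and $(P,Q)$ minimizes $E$ over $\mathcal B_+$; * (H2) there are constants $c_F,c_D>1$ with $c_F^{-1}\le 2r^2F(P,Q)\le c_F$ and $c_D^{-1}\le D(P,Q)\le c_D$ on $\overline{\Omega'}$. Then $E(P,Q)>0$, and there are $C>0$, $M_0$ and $N_0$ such that for all $M\ge M_0$ and all even $N\ge N_0$ one has $D(I^{NM}P,I^{NM}Q)>0$ on $\overline{\Omega'}$ (so that $E(I^{NM}P,I^{NM}Q)$ is well defined and finite) and $$\frac{|E(I^{NM}P,I^{NM}Q)-E(P,Q)|}{E(P,Q)}\le C\,(M^{2-l}+N^{1-l}),\qquad |E(I^{NM}P,I^{NM}Q)-E(P,Q)|\le C\,(M^{2-l}+N^{1-l}).$$ -/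

import Mathlib

noncomputable section

namespace Cavitation

open Set MeasureTheory Filter Topology
open scoped ContDiff

/-! ### The stored energy, the computational domain and the elastic energy

Points of the computational domain are pairs `z = (ρ, φ)`, so `z.1 = ρ` and `z.2 = φ`.
Functions of `φ` are taken to be `2π`-periodic functions on the whole line. -/

/-- The stored energy density `W(A) = κ |A|^p + h(det A)`, with `|A|` the Frobenius norm. -/
def storedEnergy (κ p : ℝ) (h : ℝ → ℝ) (A : Matrix (Fin 2) (Fin 2) ℝ) : ℝ :=
  κ * Real.sqrt (∑ i, ∑ j, A i j ^ 2) ^ p + h A.det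

/-- The open computational domain `Ω' = (-1, 1) × (0, 2π)`. -/
def domain : Set (ℝ × ℝ) := Ioo (-1) 1 ×ˢ Ioo 0 (2 * Real.pi)

/-- The closed computational domain `[-1, 1] × [0, 2π]`. -/
def closedDomain : Set (ℝ × ℝ) := Icc (-1) 1 ×ˢ Icc 0 (2 * Real.pi)

/-- `v` is `2π`-periodic in `φ`. -/
def PeriodicPhi (v : ℝ × ℝ → ℝ) : Prop :=
  ∀ ρ ∈ Icc (-1 : ℝ) 1, ∀ φ : ℝ, v (ρ, φ + 2 * Real.pi) = v (ρ, φ)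

/-- The radius `r = (γ + ε)/2 + (γ - ε)/2 * ρ`. -/
def radius (ε γ ρ : ℝ) : ℝ := (γ + ε) / 2 + (γ - ε) / 2 * ρ

/-- The constant `ρ_r = 2/(γ - ε)`. -/
def rhoR (ε γ : ℝ) : ℝ := 2 / (γ - ε)

/-- The partial derivative in `ρ` (one-sided at `ρ = ±1`). -/
def dRho (v : ℝ × ℝ → ℝ) (z : ℝ × ℝ) : ℝ :=
  derivWithin (fun s => v (s, z.2)) (Icc (-1) 1) z.1

/-- The partial derivative in `φ`. -/
def dPhi (v : ℝ × ℝ → ℝ) (z : ℝ × ℝ) : ℝ := deriv (fun t => v (z.1, t)) z.2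

/-- `D(P, Q)`: the Jacobian determinant in the coordinates `(ρ, φ)`. -/
def detD (ε γ : ℝ) (P Q : ℝ × ℝ → ℝ) (z : ℝ × ℝ) : ℝ :=
  rhoR ε γ / radius ε γ z.1 * P z * (dRho P z * (dPhi Q z + 1) - dPhi P z * dRho Q z)

/-- `F(P, Q)`: half the squared Frobenius norm of the gradient in the coordinates `(ρ, φ)`. -/
def normF (ε γ : ℝ) (P Q : ℝ × ℝ → ℝ) (z : ℝ × ℝ) : ℝ :=
  rhoR ε γ ^ 2 / 2 * (dRho P z ^ 2 + P z ^ 2 * dRho Q z ^ 2)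
    + 1 / (2 * radius ε γ z.1 ^ 2) * (dPhi P z ^ 2 + P z ^ 2 * (dPhi Q z + 1) ^ 2)

/-- The integrand `[g(F) + h(D)] r / ρ_r` of the elastic energy, where `g(t) = κ (√(2t))^p`. -/
def energyIntegrand (κ p ε γ : ℝ) (h : ℝ → ℝ) (P Q : ℝ × ℝ → ℝ) (z : ℝ × ℝ) : ℝ :=
  (κ * Real.sqrt (2 * normF ε γ P Q z) ^ p + h (detD ε γ P Q z))
    * (radius ε γ z.1 / rhoR ε γ)

/-- The elastic energy `E(P, Q)`. -/
def energy (κ p ε γ : ℝ) (h : ℝ → ℝ) (P Q : ℝ × ℝ → ℝ) : ℝ :=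
  ∫ z in domain, energyIntegrand κ p ε γ h P Q z

/-- Membership in the admissible class `𝓑₊`: `P` and `Q` are `2π`-periodic in `φ`, of class `C¹` up
to the boundary, have boundary values `P₀`, `Q₀` at `ρ = 1`, and satisfy `D(P, Q) > 0`. -/
structure MemBPlus (ε γ : ℝ) (P₀ Q₀ : ℝ → ℝ) (P Q : ℝ × ℝ → ℝ) : Prop where
  periodic_P : PeriodicPhi P
  periodic_Q : PeriodicPhi Q
  contDiff_P : ContDiffOn ℝ 1 P (Icc (-1) 1 ×ˢ univ)
  contDiff_Q : ContDiffOn ℝ 1 Q (Icc (-1) 1 ×ˢ univ)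
  boundary_P : ∀ φ, P (1, φ) = P₀ φ
  boundary_Q : ∀ φ, Q (1, φ) = Q₀ φ
  det_pos : ∀ z ∈ closedDomain, 0 < detD ε γ P Q z

/-! ### The weighted Sobolev space `H^μ(Λ; H^σ_ω(I))` -/

/-- The measure `ω(ρ) dρ dφ` on `Ω'`, with the Chebyshev weight `ω(ρ) = (1 - ρ²)^(-1/2)`. -/
def weightedMeasure : Measure (ℝ × ℝ) :=
  (volume.restrict domain).withDensity
    (fun z => ENNReal.ofReal ((1 - z.1 ^ 2) ^ (-(1 / 2) : ℝ)))

/-- `w` is the weak derivative of `u` in the direction `e` on the strip `(-1, 1) × ℝ`. -/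
def IsWeakDeriv (e : ℝ × ℝ) (u w : ℝ × ℝ → ℝ) : Prop :=
  ∀ ψ : ℝ × ℝ → ℝ, ContDiff ℝ ∞ ψ → HasCompactSupport ψ →
    tsupport ψ ⊆ Ioo (-1) 1 ×ˢ univ →
    ∫ z in Ioo (-1) 1 ×ˢ univ, u z * fderiv ℝ ψ z e = -∫ z in Ioo (-1) 1 ×ˢ univ, w z * ψ z

/-- `v`, `2π`-periodic in `φ`, belongs to `H^μ(Λ; H^σ_ω(I))`: all mixed weak derivatives
`w k j = ∂_φ^k ∂_ρ^j v` with `k ≤ μ`, `j ≤ σ` exist on the strip (hence, since the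
functions are periodic, across `φ = 0, 2π`) and are square integrable over `Ω'` with the
weight `ω`. -/
def MemSobolev (μ σ : ℕ) (v : ℝ × ℝ → ℝ) : Prop :=
  ∃ w : ℕ → ℕ → ℝ × ℝ → ℝ, w 0 0 = v ∧
    (∀ k ≤ μ, ∀ j ≤ σ, PeriodicPhi (w k j) ∧ MemLp (w k j) 2 weightedMeasure) ∧
    (∀ k < μ, ∀ j ≤ σ, IsWeakDeriv (0, 1) (w k j) (w (k + 1) j)) ∧
    (∀ k ≤ μ, ∀ j < σ, IsWeakDeriv (1, 0) (w k j) (w k (j + 1)))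

/-! ### Fourier-Chebyshev interpolation -/

/-- The trigonometric polynomial
`∑_{k=0}^{N/2} a_k cos(kφ) + ∑_{k=1}^{N/2-1} b_k sin(kφ)`. -/
def trigPoly (N : ℕ) (a b : ℕ → ℝ) (φ : ℝ) : ℝ :=
  ∑ k ∈ Finset.range (N / 2 + 1), a k * Real.cos (k * φ)
    + ∑ k ∈ Finset.Ico 1 (N / 2), b k * Real.sin (k * φ)

/-- `w` is a finite Fourier-Chebyshev polynomial: a linear combination of the products of
`T_j(ρ)`, `0 ≤ j ≤ M`, with `cos(kφ)`, `0 ≤ k ≤ N/2`, and `sin(kφ)`, `1 ≤ k ≤ N/2 - 1`. -/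
def IsFourierChebyshev (M N : ℕ) (w : ℝ × ℝ → ℝ) : Prop :=
  ∃ α β : ℕ → ℕ → ℝ, ∀ z : ℝ × ℝ,
    w z = ∑ j ∈ Finset.range (M + 1),
      trigPoly N (fun k => α k j) (fun k => β k j) z.2
        * (Polynomial.Chebyshev.T ℝ j).eval z.1

/-- The Chebyshev-Gauss-Lobatto node `ρ_m = cos(mπ/M)`. -/
def rhoNode (M m : ℕ) : ℝ := Real.cos (m * Real.pi / M)

/-- The Fourier node `φ_n = 2nπ/N`. -/
def phiNode (N n : ℕ) : ℝ := 2 * n * Real.pi / N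

/-- `w` is a Fourier-Chebyshev polynomial that agrees with `v` at all nodes `(ρ_m, φ_n)`. -/
def IsInterpolant (M N : ℕ) (v w : ℝ × ℝ → ℝ) : Prop :=
  IsFourierChebyshev M N w ∧
    ∀ m ≤ M, ∀ n < N, w (rhoNode M m, phiNode N n) = v (rhoNode M m, phiNode N n)

theorem rhoNode_injOn {M : ℕ} (hM : 0 < M) :
    InjOn (rhoNode M) (Finset.range (M + 1) : Set ℕ) := by
  intro a ha b hb hab
  have hM' : (0 : ℝ) < M := by exact_mod_cast hM
  simp only [Finset.coe_range, mem_Iio] at ha hb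
  have key : ∀ c < M + 1, (c : ℝ) * Real.pi / M ∈ Icc 0 Real.pi := by
    intro c hc
    have hc' : (c : ℝ) ≤ M := by exact_mod_cast Nat.lt_succ_iff.mp hc
    refine ⟨by positivity, ?_⟩
    rw [div_le_iff₀ hM', mul_comm]
    exact mul_le_mul_of_nonneg_left hc' Real.pi_pos.le
  have h := Real.injOn_cos (key a ha) (key b hb) hab
  have hpi := Real.pi_pos.ne'
  field_simp at h
  exact_mod_cast h

theorem degree_chebyshevSum_lt (M : ℕ) (a : ℕ → ℝ) :
    (∑ j ∈ Finset.range (M + 1), Polynomial.C (a j) * Polynomial.Chebyshev.T ℝ j).degree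
      < (M + 1 : ℕ) := by
  refine (Polynomial.degree_sum_le _ _).trans_lt ?_
  rw [Finset.sup_lt_iff (by exact WithBot.bot_lt_coe _)]
  intro j hj
  rw [← Polynomial.smul_eq_C_mul]
  refine (Polynomial.degree_smul_le _ _).trans_lt ?_
  rw [Polynomial.Chebyshev.degree_T]
  exact_mod_cast Finset.mem_range.mp hj

/-- A Chebyshev sum of degree `≤ M` vanishing at all nodes vanishes identically. -/
theorem chebyshev_unique {M : ℕ} (hM : 0 < M) (a : ℕ → ℝ)
    (h : ∀ m ≤ M, ∑ j ∈ Finset.range (M + 1),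
      a j * (Polynomial.Chebyshev.T ℝ j).eval (rhoNode M m) = 0) :
    ∑ j ∈ Finset.range (M + 1), Polynomial.C (a j) * Polynomial.Chebyshev.T ℝ j = 0 := by
  refine Polynomial.eq_zero_of_degree_lt_of_eval_index_eq_zero (Finset.range (M + 1))
    (rhoNode_injOn hM) ?_ ?_
  · simpa using degree_chebyshevSum_lt M a
  · intro m hm
    simpa [Polynomial.eval_finsetSum] using h m (Nat.lt_succ_iff.mp (Finset.mem_range.mp hm))

/-- The Chebyshev polynomials as a polynomial sequence. -/
def chebyshevSequence : Polynomial.Sequence ℝ where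
  elems' := fun j => Polynomial.Chebyshev.T ℝ j
  degree_eq' := fun i => by simp [Polynomial.Chebyshev.degree_T]

theorem chebyshev_exists {M : ℕ} (hM : 0 < M) (f : ℕ → ℝ) :
    ∃ a : ℕ → ℝ, ∀ m ≤ M, ∑ j ∈ Finset.range (M + 1),
      a j * (Polynomial.Chebyshev.T ℝ j).eval (rhoNode M m) = f m := by
  let L : (Fin (M + 1) → ℝ) →ₗ[ℝ] (Fin (M + 1) → ℝ) :=
    Matrix.toLin' (Matrix.of fun m j : Fin (M + 1) =>
      (Polynomial.Chebyshev.T ℝ ((j : ℕ) : ℤ)).eval (rhoNode M m))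
  have hL : ∀ a m, L a m = ∑ j : Fin (M + 1),
      a j * (Polynomial.Chebyshev.T ℝ ((j : ℕ) : ℤ)).eval (rhoNode M m) := by
    intro a m
    simp [L, Matrix.mulVec, dotProduct, mul_comm]
  have ext : ∀ (a : Fin (M + 1) → ℝ) (x : ℝ), ∑ j ∈ Finset.range (M + 1),
      (if hj : j < M + 1 then a ⟨j, hj⟩ else 0) * (Polynomial.Chebyshev.T ℝ (j : ℤ)).eval x
      = ∑ j : Fin (M + 1), a j * (Polynomial.Chebyshev.T ℝ ((j : ℕ) : ℤ)).eval x := by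
    intro a x
    rw [Finset.sum_range]
    exact Finset.sum_congr rfl fun j _ => by rw [dif_pos j.2]
  have inj : Function.Injective L := by
    rw [injective_iff_map_eq_zero]
    intro a ha
    have h0 := chebyshev_unique hM (fun j => if hj : j < M + 1 then a ⟨j, hj⟩ else 0) (by
      intro m hm
      rw [ext, ← hL a ⟨m, Nat.lt_succ_iff.mpr hm⟩, ha]
      rfl)
    have hli := chebyshevSequence.linearIndependent
    rw [linearIndependent_iff'] at hli
    ext j
    have := hli (Finset.range (M + 1)) (fun j => if hj : j < M + 1 then a ⟨j, hj⟩ else 0)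
      (by rw [← h0]; exact Finset.sum_congr rfl (fun j _ => by rw [Polynomial.smul_eq_C_mul]; rfl))
      j (Finset.mem_range.mpr j.2)
    rwa [dif_pos j.2] at this
  obtain ⟨a, ha⟩ := (LinearMap.injective_iff_surjective.mp inj) (fun m => f m)
  refine ⟨fun j => if hj : j < M + 1 then a ⟨j, hj⟩ else 0, fun m hm => ?_⟩
  rw [ext, ← hL a ⟨m, Nat.lt_succ_iff.mpr hm⟩, ha]

theorem sum_cos_eq_zero {N : ℕ} (d : ℤ) (hd : ¬ (N : ℤ) ∣ d) (hN : 0 < N) :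
    ∑ k ∈ Finset.range N, Real.cos (k * (2 * d * Real.pi / N)) = 0 := by
  have hprim := Complex.isPrimitiveRoot_exp N hN.ne'
  set ζ := Complex.exp (2 * Real.pi * Complex.I / N) with hζ
  have h1 : ζ ^ d ≠ 1 := fun h => hd ((hprim.zpow_eq_one_iff_dvd d).mp h)
  have hs : ∑ k ∈ Finset.range N, (ζ ^ d) ^ k = 0 := by
    have h2 : (ζ ^ d) ^ N = 1 := by
      rw [← zpow_natCast, ← zpow_mul, mul_comm, zpow_mul, zpow_natCast, hprim.pow_eq_one, one_zpow]
    have h3 := geom_sum_mul (ζ ^ d) N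
    rw [h2, sub_self] at h3
    exact (mul_eq_zero.mp h3).resolve_right (sub_ne_zero.mpr h1)
  have h4 : ∀ k : ℕ, ((ζ ^ d) ^ k).re = Real.cos (k * (2 * d * Real.pi / N)) := by
    intro k
    rw [hζ, ← Complex.exp_int_mul, ← Complex.exp_nat_mul, ← Complex.exp_ofReal_mul_I_re]
    congr 2
    push_cast
    ring
  rw [← Finset.sum_congr rfl (fun k _ => h4 k), ← Complex.re_sum, hs, Complex.zero_re]

theorem cos_phiNode_reflect {N k j : ℕ} (hN : 0 < N) (hk : k ≤ N) :
    Real.cos ((N - k : ℕ) * phiNode N j) = Real.cos (k * phiNode N j) := by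
  have hN' : (N : ℝ) ≠ 0 := by exact_mod_cast hN.ne'
  have : ((N - k : ℕ) : ℝ) * phiNode N j = j * (2 * Real.pi) - k * phiNode N j := by
    rw [Nat.cast_sub hk, phiNode]; field_simp
  rw [this, Real.cos_nat_mul_two_pi_sub]

theorem sin_phiNode_reflect {N k j : ℕ} (hN : 0 < N) (hk : k ≤ N) :
    Real.sin ((N - k : ℕ) * phiNode N j) = -Real.sin (k * phiNode N j) := by
  have hN' : (N : ℝ) ≠ 0 := by exact_mod_cast hN.ne'
  have : ((N - k : ℕ) : ℝ) * phiNode N j = j * (2 * Real.pi) - k * phiNode N j := by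
    rw [Nat.cast_sub hk, phiNode]; field_simp
  rw [this, Real.sin_nat_mul_two_pi_sub]

/-- The values at the nodes of trigonometric polynomials, as a linear map of the
coefficients. -/
def trigEval (N : ℕ) :
    ((Fin (N / 2 + 1) → ℝ) × (Fin (N / 2 - 1) → ℝ)) →ₗ[ℝ] (Fin N → ℝ) where
  toFun c := fun n => ∑ k : Fin (N / 2 + 1), c.1 k * Real.cos ((k : ℕ) * phiNode N n)
    + ∑ k : Fin (N / 2 - 1), c.2 k * Real.sin (((k : ℕ) + 1 : ℕ) * phiNode N n)
  map_add' c d := by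
    funext n
    simp only [Prod.fst_add, Prod.snd_add, Pi.add_apply, add_mul, Finset.sum_add_distrib]
    ring
  map_smul' t c := by
    funext n
    simp only [Prod.smul_fst, Prod.smul_snd, Pi.smul_apply, smul_eq_mul, RingHom.id_apply,
      mul_add, Finset.mul_sum, mul_assoc]

theorem cos_mem_range {N : ℕ} (hN : 0 < N) {k : ℕ} (hk : k < N) :
    (fun n : Fin N => Real.cos (k * phiNode N n)) ∈ LinearMap.range (trigEval N) := by
  have base : ∀ k, k ≤ N / 2 →
      (fun n : Fin N => Real.cos (k * phiNode N n)) ∈ LinearMap.range (trigEval N) := by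
    intro k hk
    refine ⟨(Pi.single ⟨k, Nat.lt_succ_iff.mpr hk⟩ 1, 0), ?_⟩
    funext n
    simp [trigEval, Pi.single_apply]
  by_cases h : k ≤ N / 2
  · exact base k h
  · have := base (N - k) (by omega)
    simpa only [cos_phiNode_reflect hN hk.le] using this

theorem sin_mem_range {N : ℕ} (hN : 0 < N) (hE : Even N) {k : ℕ} (hk : k < N) :
    (fun n : Fin N => Real.sin (k * phiNode N n)) ∈ LinearMap.range (trigEval N) := by
  have base : ∀ k, k ≤ N / 2 →
      (fun n : Fin N => Real.sin (k * phiNode N n)) ∈ LinearMap.range (trigEval N) := by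
    intro k hk
    by_cases h0 : k = 0
    · subst h0
      refine ⟨0, ?_⟩
      rw [map_zero]
      funext n
      simp
    by_cases h1 : k = N / 2
    · have hz : (fun n : Fin N => Real.sin (k * phiNode N n)) = 0 := by
        funext n
        obtain ⟨q, hq⟩ := hE
        have hkq : k = q := by omega
        have hq0 : (q : ℝ) ≠ 0 := by
          have : q ≠ 0 := by omega
          exact_mod_cast this
        have : (k : ℝ) * phiNode N n = (n : ℕ) * Real.pi := by
          have hNq : (N : ℝ) = 2 * q := by
            have : N = 2 * q := by omega
            exact_mod_cast this
          rw [phiNode, hkq, hNq]; field_simp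
        rw [this, Real.sin_nat_mul_pi]; rfl
      rw [hz]
      exact (LinearMap.range (trigEval N)).zero_mem
    · refine ⟨(0, Pi.single ⟨k - 1, by omega⟩ 1), ?_⟩
      funext n
      have : ((k - 1 : ℕ) : ℝ) + 1 = k := by
        rw [Nat.cast_sub (by omega)]; simp
      simp [trigEval, Pi.single_apply, this]
  by_cases h : k ≤ N / 2
  · exact base k h
  · have := (LinearMap.range (trigEval N)).neg_mem (base (N - k) (by omega))
    convert this using 1
    funext n
    simp only [Pi.neg_apply, sin_phiNode_reflect hN hk.le, neg_neg]

theorem trigEval_surjective {N : ℕ} (hN : 0 < N) (hE : Even N) :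
    Function.Surjective (trigEval N) := by
  have hN' : (N : ℝ) ≠ 0 := by exact_mod_cast hN.ne'
  rw [← LinearMap.range_eq_top, eq_top_iff]
  have delta : ∀ i : Fin N, (Pi.single i 1 : Fin N → ℝ) ∈ LinearMap.range (trigEval N) := by
    intro i
    have hform : (Pi.single i 1 : Fin N → ℝ) = (1 / (N : ℝ)) • ∑ k ∈ Finset.range N,
        (Real.cos (k * phiNode N i) • (fun n : Fin N => Real.cos (k * phiNode N n))
          + Real.sin (k * phiNode N i) • (fun n : Fin N => Real.sin (k * phiNode N n))) := by
      funext n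
      have hc : ∀ k : ℕ, Real.cos (k * phiNode N i) * Real.cos (k * phiNode N n)
          + Real.sin (k * phiNode N i) * Real.sin (k * phiNode N n)
          = Real.cos (k * (2 * (((i : ℕ) : ℤ) - ((n : ℕ) : ℤ) : ℤ) * Real.pi / N)) := by
        intro k
        rw [← Real.cos_sub]
        congr 1
        simp only [phiNode]; push_cast; ring
      simp only [Pi.smul_apply, Finset.sum_apply, Pi.add_apply, smul_eq_mul, hc]
      by_cases hin : n = i
      · subst hin
        simp [hN']
      · rw [sum_cos_eq_zero _ _ hN, mul_zero, Pi.single_eq_of_ne hin]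
        intro hdvd
        have h1 := i.2
        have h2 := n.2
        have h3 : ((i : ℕ) : ℤ) - ((n : ℕ) : ℤ) = 0 :=
          Int.eq_zero_of_abs_lt_dvd hdvd (by rw [abs_lt]; omega)
        exact hin (Fin.ext (by omega))
    rw [hform]
    refine Submodule.smul_mem _ _ (Submodule.sum_mem _ fun k hk => Submodule.add_mem _ ?_ ?_)
    · exact Submodule.smul_mem _ _ (cos_mem_range hN (Finset.mem_range.mp hk))
    · exact Submodule.smul_mem _ _ (sin_mem_range hN hE (Finset.mem_range.mp hk))
  intro f _
  have hf : f = ∑ i, f i • (Pi.single i 1 : Fin N → ℝ) := by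
    funext n
    simp [Pi.single_apply]
  rw [hf]
  exact Submodule.sum_mem _ fun i _ => Submodule.smul_mem _ _ (delta i)

theorem trigEval_injective {N : ℕ} (hN : 0 < N) (hE : Even N) :
    Function.Injective (trigEval N) := by
  refine (LinearMap.injective_iff_surjective_of_finrank_eq_finrank ?_).mpr
    (trigEval_surjective hN hE)
  obtain ⟨q, hq⟩ := hE
  simp
  omega

theorem trigPoly_eq {N : ℕ} (a b : ℕ → ℝ) (φ : ℝ) :
    trigPoly N a b φ = ∑ k : Fin (N / 2 + 1), a k * Real.cos ((k : ℕ) * φ)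
      + ∑ k : Fin (N / 2 - 1), b (k + 1) * Real.sin (((k : ℕ) + 1 : ℕ) * φ) := by
  rw [trigPoly, Finset.sum_range, Finset.sum_Ico_eq_sum_range, Finset.sum_range]
  simp only [add_comm 1]

theorem trig_exists {N : ℕ} (hN : 0 < N) (hE : Even N) (f : ℕ → ℝ) :
    ∃ a b : ℕ → ℝ, ∀ n < N, trigPoly N a b (phiNode N n) = f n := by
  obtain ⟨c, hc⟩ := trigEval_surjective hN hE (fun n => f n)
  refine ⟨fun k => if hk : k < N / 2 + 1 then c.1 ⟨k, hk⟩ else 0,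
    fun k => if hk : k - 1 < N / 2 - 1 then c.2 ⟨k - 1, hk⟩ else 0, fun n hn => ?_⟩
  rw [trigPoly_eq, ← congrFun hc ⟨n, hn⟩]
  simp only [trigEval, LinearMap.coe_mk, AddHom.coe_mk, Nat.add_sub_cancel]
  exact congrArg₂ _ (Finset.sum_congr rfl fun k _ => by rw [dif_pos k.2])
    (Finset.sum_congr rfl fun k _ => by rw [dif_pos k.2])

/-- A trigonometric polynomial vanishing at all nodes vanishes identically. -/
theorem trig_unique {N : ℕ} (hN : 0 < N) (hE : Even N) (a b : ℕ → ℝ)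
    (h : ∀ n < N, trigPoly N a b (phiNode N n) = 0) (φ : ℝ) : trigPoly N a b φ = 0 := by
  have h0 : trigEval N (fun k => a k, fun k => b (k + 1)) = 0 := by
    funext n
    have := h n n.2
    rw [trigPoly_eq] at this
    exact this
  have h1 := (injective_iff_map_eq_zero (trigEval N)).mp (trigEval_injective hN hE) _ h0
  have ha : ∀ k : Fin (N / 2 + 1), a k = 0 := fun k => congrFun (congrArg Prod.fst h1) k
  have hb : ∀ k : Fin (N / 2 - 1), b (k + 1) = 0 := fun k => congrFun (congrArg Prod.snd h1) k
  rw [trigPoly_eq]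
  simp [ha, hb]

theorem sum_mul_trigPoly (M N : ℕ) (α β : ℕ → ℕ → ℝ) (t : ℕ → ℝ) (φ : ℝ) :
    ∑ j ∈ Finset.range (M + 1), trigPoly N (fun k => α k j) (fun k => β k j) φ * t j
      = trigPoly N (fun k => ∑ j ∈ Finset.range (M + 1), α k j * t j)
          (fun k => ∑ j ∈ Finset.range (M + 1), β k j * t j) φ := by
  simp only [trigPoly, add_mul, Finset.sum_add_distrib, Finset.sum_mul]
  rw [Finset.sum_comm]
  congr 1
  · exact Finset.sum_congr rfl fun k _ => Finset.sum_congr rfl fun j _ => by ring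
  · rw [Finset.sum_comm]
    exact Finset.sum_congr rfl fun k _ => Finset.sum_congr rfl fun j _ => by ring

/-- Existence and uniqueness of the Fourier-Chebyshev interpolant. -/
theorem existsUnique_interpolant {M N : ℕ} (hM : 0 < M) (hN : 0 < N) (hE : Even N)
    (v : ℝ × ℝ → ℝ) : ∃! w, IsInterpolant M N v w := by
  refine existsUnique_of_exists_of_unique ?_ ?_
  · choose a ha using fun n : ℕ =>
      chebyshev_exists hM (fun m => v (rhoNode M m, phiNode N n))
    choose α β hαβ using fun j : ℕ => trig_exists hN hE (fun n => a n j)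
    refine ⟨fun z => ∑ j ∈ Finset.range (M + 1), trigPoly N (α j) (β j) z.2
      * (Polynomial.Chebyshev.T ℝ j).eval z.1,
      ⟨fun k j => α j k, fun k j => β j k, fun z => rfl⟩, ?_⟩
    intro m hm n hn
    simp only [hαβ _ n hn]
    exact ha n m hm
  · rintro w₁ w₂ ⟨⟨α₁, β₁, h₁⟩, e₁⟩ ⟨⟨α₂, β₂, h₂⟩, e₂⟩
    have hsub : ∀ z, w₁ z - w₂ z = ∑ j ∈ Finset.range (M + 1),
        trigPoly N (fun k => α₁ k j - α₂ k j) (fun k => β₁ k j - β₂ k j) z.2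
          * (Polynomial.Chebyshev.T ℝ j).eval z.1 := by
      intro z
      rw [h₁, h₂, ← Finset.sum_sub_distrib]
      refine Finset.sum_congr rfl fun j _ => ?_
      simp only [trigPoly, sub_mul, Finset.sum_sub_distrib]
      ring
    have hcol : ∀ n < N, ∀ ρ, w₁ (ρ, phiNode N n) - w₂ (ρ, phiNode N n) = 0 := by
      intro n hn ρ
      have := congrArg (Polynomial.eval ρ) (chebyshev_unique hM
        (fun j => trigPoly N (fun k => α₁ k j - α₂ k j) (fun k => β₁ k j - β₂ k j)
          (phiNode N n)) (by
          intro m hm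
          have := hsub (rhoNode M m, phiNode N n)
          rw [e₁ m hm n hn, e₂ m hm n hn, sub_self] at this
          exact this.symm))
      rw [hsub]
      simpa [Polynomial.eval_finsetSum] using this
    funext ⟨ρ, φ⟩
    refine sub_eq_zero.mp ?_
    rw [hsub, sum_mul_trigPoly M N (fun k j => α₁ k j - α₂ k j) (fun k j => β₁ k j - β₂ k j)]
    refine trig_unique hN hE _ _ (fun n hn => ?_) φ
    have := hcol n hn ρ
    rw [hsub, sum_mul_trigPoly M N (fun k j => α₁ k j - α₂ k j)
      (fun k j => β₁ k j - β₂ k j)] at this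
    exact this

/-- The interpolant `I^{NM} v`: for `M ≥ 1` and `N ≥ 2` even it is the unique
Fourier-Chebyshev polynomial that agrees with `v` at all nodes `(ρ_m, φ_n)`. -/
def interp (M N : ℕ) (v : ℝ × ℝ → ℝ) : ℝ × ℝ → ℝ :=
  Classical.epsilon (IsInterpolant M N v)

theorem isInterpolant_interp {M N : ℕ} (hM : 0 < M) (hN : 0 < N) (hE : Even N)
    (v : ℝ × ℝ → ℝ) : IsInterpolant M N v (interp M N v) :=
  Classical.epsilon_spec (existsUnique_interpolant hM hN hE v).exists

theorem eq_interp {M N : ℕ} (hM : 0 < M) (hN : 0 < N) (hE : Even N) {v w : ℝ × ℝ → ℝ}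
    (hw : IsInterpolant M N v w) : w = interp M N v :=
  (existsUnique_interpolant hM hN hE v).unique hw (isInterpolant_interp hM hN hE v)

end Cavitation

end

noncomputable section

namespace Cavitation

open Set MeasureTheory Filter Topology
open scoped ContDiff

/-! ### The angular variable -/

/-! The energy sees a pair only through its values and first derivatives. Under the hypotheses the
jets `(1/r, P, P_ρ, P_φ, Q_ρ, Q_φ)` of the solution fill a compact set on which `D > 0` and `F > 0`,
so the density is Lipschitz near that set. By `exists_energy_stability` two estimates of the
interpolation error then suffice: a `C¹` bound that tends to zero, which keeps `D` positive, and an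
`L¹` bound of order `M^(2-l) + N^(1-l)` for the values and first derivatives, which controls the
energy.

The substitution `ρ = cos θ` removes the Chebyshev weight, and functions become even in `θ` and
periodic in both variables. They are expanded in the modes `cos(jθ) cas(kφ)`. Weak derivatives
become recursions for the coefficients, and Bessel's inequality in `k` for each fixed `j` shows that
`(1+|j|)^l (1+|k|)^l c(j,k)` is square summable in `k`, uniformly in `j`
(`MemSobolev.exists_decay`). Interpolation replaces each mode by its alias, the mode of the
interpolation space with the same values at the nodes (`interp_eq_tsum`). The error is thus an
explicit series that can be differentiated term by term.

Aliasing in `ρ` is bounded term by term. One derivative costs a power of `j` and summation over `|j|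
≥ M` costs another, which leaves `M^(2-l)` (`CoefDecay.abs_tsum_rho_le`). In `φ` the second loss is
avoided: the frequencies are grouped into blocks of length `N`, and within a block both the modes
and their aliases are orthogonal families. Square summability then gives an `L²` bound of order
`N^(1-l)` for each block, summable over the blocks (`CoefDecay.integral_block_le`).

The change of variables is singular at `ρ = ±1`. In `L¹` this is harmless, because the Jacobian `sin
θ` turns `|∂_ρ|` into `|∂_θ|`. In the supremum norm it is absorbed by `|sin jθ| ≤ |j| |sin θ|`, at
the price of one more power of `j` (`CoefDecay.errBound`). -/

/-- The rectangle `(0, π) × (0, 2π)` of the variables `(θ, φ)`, where `ρ = cos θ`. -/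
def angleDomain : Set (ℝ × ℝ) := Ioo 0 Real.pi ×ˢ Ioo 0 (2 * Real.pi)

theorem measurableSet_angleDomain : MeasurableSet angleDomain :=
  measurableSet_Ioo.prod measurableSet_Ioo

theorem measurableSet_domain : MeasurableSet domain :=
  measurableSet_Ioo.prod measurableSet_Ioo

theorem volume_angleDomain_lt_top : volume angleDomain < ⊤ := by
  rw [angleDomain, Measure.volume_eq_prod, Measure.prod_prod, Real.volume_Ioo, Real.volume_Ioo]
  exact ENNReal.mul_lt_top ENNReal.ofReal_lt_top ENNReal.ofReal_lt_top

instance : IsFiniteMeasure (volume.restrict angleDomain) :=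
  ⟨by simpa using volume_angleDomain_lt_top⟩

theorem cos_mem_Ioo {θ : ℝ} (h : θ ∈ Ioo 0 Real.pi) : Real.cos θ ∈ Ioo (-1 : ℝ) 1 := by
  have hs := Real.sin_pos_of_mem_Ioo h
  have h1 := Real.sin_sq_add_cos_sq θ
  constructor <;> nlinarith

theorem cos_image_Ioo : Real.cos '' Ioo 0 Real.pi = Ioo (-1) 1 := by
  ext x
  constructor
  · rintro ⟨θ, hθ, rfl⟩
    exact cos_mem_Ioo hθ
  · intro hx
    refine ⟨Real.arccos x, ⟨Real.arccos_pos.2 hx.2, ?_⟩, Real.cos_arccos hx.1.le hx.2.le⟩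
    refine lt_of_le_of_ne (Real.arccos_le_pi x) fun h => ?_
    exact absurd (Real.arccos_eq_pi.1 h) (not_le.2 hx.1)

theorem image_angleDomain :
    (Prod.map Real.cos id : ℝ × ℝ → ℝ × ℝ) '' angleDomain = domain := by
  rw [angleDomain, domain, prodMap_image_prod, cos_image_Ioo, image_id]

theorem injOn_angleDomain : InjOn (Prod.map Real.cos id : ℝ × ℝ → ℝ × ℝ) angleDomain := by
  rintro ⟨a, b⟩ h₁ ⟨c, d⟩ h₂ h
  simp only [Prod.map_apply, id_eq, Prod.mk.injEq] at h
  exact Prod.ext (Real.injOn_cos (Ioo_subset_Icc_self h₁.1) (Ioo_subset_Icc_self h₂.1) h.1) h.2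

theorem hasFDerivAt_prodMap_cos (z : ℝ × ℝ) :
    HasFDerivAt (Prod.map Real.cos id : ℝ × ℝ → ℝ × ℝ)
      ((ContinuousLinearMap.toSpanSingleton ℝ (-Real.sin z.1)).prodMap
        (ContinuousLinearMap.id ℝ ℝ)) z := by
  refine HasFDerivAt.prodMap z (f := Real.cos) (f₂ := id) ?_ (hasFDerivAt_id _)
  exact (Real.hasDerivAt_cos z.1).hasFDerivAt

theorem abs_det_prodMap_cos {z : ℝ × ℝ} (hz : z ∈ angleDomain) :
    |((ContinuousLinearMap.toSpanSingleton ℝ (-Real.sin z.1)).prodMap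
        (ContinuousLinearMap.id ℝ ℝ)).det| = Real.sin z.1 := by
  have hs := Real.sin_pos_of_mem_Ioo hz.1
  rw [ContinuousLinearMap.det]
  have : ((ContinuousLinearMap.toSpanSingleton ℝ (-Real.sin z.1)).prodMap
        (ContinuousLinearMap.id ℝ ℝ) : ℝ × ℝ →ₗ[ℝ] ℝ × ℝ)
      = LinearMap.prodMap ((-Real.sin z.1) • LinearMap.id) LinearMap.id := by
    ext <;> simp
  rw [this, LinearMap.det_prodMap]
  simp [abs_of_pos hs]

theorem integral_domain (g : ℝ × ℝ → ℝ) :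
    ∫ z in domain, g z = ∫ z in angleDomain, Real.sin z.1 * g (Real.cos z.1, z.2) := by
  rw [← image_angleDomain, integral_image_eq_integral_abs_det_fderiv_smul volume
    measurableSet_angleDomain (fun z _ => (hasFDerivAt_prodMap_cos z).hasFDerivWithinAt)
    injOn_angleDomain]
  refine setIntegral_congr_fun measurableSet_angleDomain fun z hz => ?_
  simp only [abs_det_prodMap_cos hz, smul_eq_mul]
  rfl

theorem integrableOn_domain_iff (g : ℝ × ℝ → ℝ) :
    IntegrableOn g domain ↔
      IntegrableOn (fun z => Real.sin z.1 * g (Real.cos z.1, z.2)) angleDomain := by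
  rw [← image_angleDomain, integrableOn_image_iff_integrableOn_abs_det_fderiv_smul volume
    measurableSet_angleDomain (fun z _ => (hasFDerivAt_prodMap_cos z).hasFDerivWithinAt)
    injOn_angleDomain]
  refine integrableOn_congr_fun (fun z hz => ?_) measurableSet_angleDomain
  simp only [abs_det_prodMap_cos hz, smul_eq_mul]
  rfl

/-- In the angle the weight is `1 / sin θ` and cancels the Jacobian, so the weighted space is the
unweighted one on the rectangle. -/
theorem integrable_weightedMeasure_iff (g : ℝ × ℝ → ℝ) :
    Integrable g weightedMeasure ↔
      IntegrableOn (fun z => g (Real.cos z.1, z.2)) angleDomain := by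
  rw [weightedMeasure, integrable_withDensity_iff_integrable_smul' (by fun_prop) (by simp)]
  change IntegrableOn _ domain ↔ _
  rw [integrableOn_domain_iff]
  refine integrableOn_congr_fun (fun z hz => ?_) measurableSet_angleDomain
  have hs := Real.sin_pos_of_mem_Ioo hz.1
  have h1 : 1 - Real.cos z.1 ^ 2 = Real.sin z.1 ^ 2 := by
    have := Real.sin_sq_add_cos_sq z.1
    linarith
  have h2 : (Real.sin z.1 ^ 2) ^ (-(1 / 2) : ℝ) = (Real.sin z.1)⁻¹ := by
    rw [← Real.rpow_natCast, ← Real.rpow_mul hs.le]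
    norm_num
    rw [Real.rpow_neg_one]
  simp only [h1, h2, smul_eq_mul]
  rw [ENNReal.toReal_ofReal (by positivity), ← mul_assoc, mul_inv_cancel₀ hs.ne', one_mul]

instance : IsFiniteMeasure weightedMeasure := by
  have h : Integrable (fun _ : ℝ × ℝ => (1 : ℝ)) weightedMeasure := by
    rw [integrable_weightedMeasure_iff]
    exact integrable_const _
  exact (integrable_const_iff_isFiniteMeasure one_ne_zero).1 h

theorem integrableOn_of_memLp {w : ℝ × ℝ → ℝ} (hw : MemLp w 2 weightedMeasure) :
    IntegrableOn (fun z => w (Real.cos z.1, z.2)) angleDomain := by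
  rw [← integrable_weightedMeasure_iff]
  exact hw.integrable (by norm_num)

theorem memLp_angle_of_memLp {w : ℝ × ℝ → ℝ} (hw : MemLp w 2 weightedMeasure) :
    MemLp (fun z => w (Real.cos z.1, z.2)) 2 (volume.restrict angleDomain) := by
  rw [memLp_two_iff_integrable_sq (integrableOn_of_memLp hw).aestronglyMeasurable]
  have := hw.integrable_sq
  rwa [integrable_weightedMeasure_iff] at this

theorem integrableOn_domain_of_memLp {w : ℝ × ℝ → ℝ} (hw : MemLp w 2 weightedMeasure) :
    IntegrableOn w domain := by
  rw [integrableOn_domain_iff]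
  refine (integrableOn_of_memLp hw).bdd_mul (c := 1) (by fun_prop) ?_
  exact Eventually.of_forall fun z => Real.abs_sin_le_one _

/-! ### Periodic test functions -/

/-- Up to a null set the support of `b` covers two periods. The second is translated back onto the
first, where the periodic factor `G` is unchanged. -/
theorem integral_strip_eq {G : ℝ × ℝ → ℝ} (hG : PeriodicPhi G) (hint : IntegrableOn G domain)
    {b : ℝ → ℝ} (hb : Continuous b) (hb₀ : ∀ x, x ∉ Ioo 0 (4 * Real.pi) → b x = 0) :
    ∫ z in Ioo (-1) 1 ×ˢ univ, G z * b z.2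
      = ∫ z in domain, G z * (b z.2 + b (z.2 + 2 * Real.pi)) := by
  have hpi := Real.pi_pos
  obtain ⟨C, hC⟩ : ∃ C, ∀ x, ‖b x‖ ≤ C := by
    obtain ⟨C, hC⟩ := (isCompact_Icc (a := (0 : ℝ)) (b := 4 * Real.pi)).exists_bound_of_continuousOn
      hb.continuousOn
    refine ⟨max C 0, fun x => ?_⟩
    by_cases hx : x ∈ Icc 0 (4 * Real.pi)
    · exact (hC x hx).trans (le_max_left _ _)
    · rw [hb₀ x fun h => hx (Ioo_subset_Icc_self h)]
      simp
  set S : Set (ℝ × ℝ) := Ioo (-1) 1 ×ˢ Ioo (2 * Real.pi) (4 * Real.pi) with hS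
  have hpre : (fun z : ℝ × ℝ => z + (0, 2 * Real.pi)) ⁻¹' S = domain := by
    ext ⟨x, y⟩
    simp only [hS, domain, mem_preimage, mem_prod, Prod.mk_add_mk, add_zero, mem_Ioo]
    constructor
    · rintro ⟨h, h1, h2⟩
      exact ⟨h, by linarith, by linarith⟩
    · rintro ⟨h, h1, h2⟩
      exact ⟨h, by linarith, by linarith⟩
  have hmp := measurePreserving_add_right (volume : Measure (ℝ × ℝ)) (0, 2 * Real.pi)
  have hme := measurableEmbedding_addRight ((0, 2 * Real.pi) : ℝ × ℝ)
  have hper : ∀ z ∈ domain, G (z + (0, 2 * Real.pi)) = G z := by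
    rintro ⟨x, y⟩ hz
    simpa using hG x (Ioo_subset_Icc_self hz.1) y
  have hGS : IntegrableOn G S := by
    rw [← hmp.integrableOn_comp_preimage hme, hpre]
    exact hint.congr_fun (fun z hz => (hper z hz).symm) measurableSet_domain
  have hmul : ∀ {T : Set (ℝ × ℝ)} (c : ℝ → ℝ) (_ : Continuous c) (_ : ∀ x, ‖c x‖ ≤ C),
      IntegrableOn G T → IntegrableOn (fun z => G z * c z.2) T := by
    intro T c hc hcC hGT
    refine Integrable.mul_bdd (c := C) hGT (hc.comp continuous_snd).aestronglyMeasurable ?_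
    exact Eventually.of_forall fun z => hcC _
  have h1 : ∫ z in Ioo (-1) 1 ×ˢ univ, G z * b z.2
      = ∫ z in Ioo (-1) 1 ×ˢ Ioo 0 (4 * Real.pi), G z * b z.2 := by
    refine (setIntegral_eq_of_subset_of_forall_sdiff_eq_zero
      (measurableSet_Ioo.prod MeasurableSet.univ) (prod_mono_right (subset_univ _)) ?_)
    rintro ⟨x, y⟩ ⟨hz, hz'⟩
    simp only [hb₀ y fun h => hz' ⟨hz.1, h⟩, mul_zero]
  have h2 : (Ioo (-1) 1 ×ˢ Ioo 0 (4 * Real.pi) : Set (ℝ × ℝ)) =ᵐ[volume]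
      (domain ∪ S : Set (ℝ × ℝ)) := by
    have : domain ∪ S = Ioo (-1) 1 ×ˢ (Ioo 0 (2 * Real.pi) ∪ Ioo (2 * Real.pi) (4 * Real.pi)) := by
      rw [prod_union]; rfl
    rw [this, Measure.volume_eq_prod]
    refine Measure.set_prod_ae_eq (ae_eq_refl _) ?_
    have h3 : Ioo 0 (2 * Real.pi) ∪ Ico (2 * Real.pi) (4 * Real.pi) = Ioo 0 (4 * Real.pi) :=
      Ioo_union_Ico_eq_Ioo (by linarith) (by linarith)
    rw [← h3]
    exact (ae_eq_refl _).union Ioo_ae_eq_Ico.symm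
  have hdisj : Disjoint domain S := by
    rw [Set.disjoint_left]
    rintro ⟨x, y⟩ h1 h2
    exact absurd h1.2.2 (not_lt.2 h2.2.1.le)
  rw [h1, setIntegral_congr_set h2, setIntegral_union hdisj
    (measurableSet_Ioo.prod measurableSet_Ioo) (hmul b hb hC hint) (hmul b hb hC hGS),
    ← hmp.setIntegral_preimage_emb hme _ S, hpre]
  have hshift : ∫ z in domain, G (z + (0, 2 * Real.pi)) * b (z + (0, 2 * Real.pi)).2
      = ∫ z in domain, G z * b (z.2 + 2 * Real.pi) :=
    setIntegral_congr_fun measurableSet_domain fun z hz => by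
      simp only [hper z hz, Prod.snd_add]
  rw [hshift, ← integral_add (hmul b hb hC hint)]
  · simp only [mul_add]
  · exact hmul (fun x => b (x + 2 * Real.pi)) (by fun_prop) (fun x => hC _) hint

/-- A smooth function supported in `[0, 4π]` whose `2π`-translates sum up to one. -/
def unitBump (x : ℝ) : ℝ :=
  Real.smoothTransition (x / (2 * Real.pi)) - Real.smoothTransition (x / (2 * Real.pi) - 1)

theorem contDiff_unitBump : ContDiff ℝ ∞ unitBump := by
  unfold unitBump
  refine ContDiff.sub ?_ ?_
  · exact Real.smoothTransition.contDiff.comp (contDiff_id.div_const _)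
  · exact Real.smoothTransition.contDiff.comp ((contDiff_id.div_const _).sub contDiff_const)

theorem unitBump_eq_zero {x : ℝ} (hx : x ∉ Ioo 0 (4 * Real.pi)) : unitBump x = 0 := by
  have hpi := Real.pi_pos
  unfold unitBump
  by_cases h0 : x ≤ 0
  · have : x / (2 * Real.pi) ≤ 0 := div_nonpos_of_nonpos_of_nonneg h0 (by positivity)
    rw [Real.smoothTransition.zero_of_nonpos this,
      Real.smoothTransition.zero_of_nonpos (by linarith), sub_zero]
  · have h4 : 4 * Real.pi ≤ x := by
      by_contra h
      exact hx ⟨not_le.1 h0, not_le.1 h⟩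
    have : 2 ≤ x / (2 * Real.pi) := by
      rw [le_div_iff₀ (by positivity)]
      linarith
    rw [Real.smoothTransition.one_of_one_le (by linarith),
      Real.smoothTransition.one_of_one_le (by linarith), sub_self]

theorem unitBump_add {x : ℝ} (hx : x ∈ Ioo 0 (2 * Real.pi)) :
    unitBump x + unitBump (x + 2 * Real.pi) = 1 := by
  have hpi := Real.pi_pos
  have h1 : 0 < x / (2 * Real.pi) := div_pos hx.1 (by positivity)
  have h2 : x / (2 * Real.pi) < 1 := by
    rw [div_lt_one (by positivity)]
    exact hx.2
  have h3 : (x + 2 * Real.pi) / (2 * Real.pi) = x / (2 * Real.pi) + 1 := by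
    field_simp
  unfold unitBump
  rw [h3, add_sub_cancel_right, Real.smoothTransition.one_of_one_le (x := _ + 1) (by linarith),
    Real.smoothTransition.zero_of_nonpos (x := _ - 1) (by linarith)]
  ring

/-- The axial part of a test function in `(-1, 1)`. -/
structure IsRadialTest (a : ℝ → ℝ) : Prop where
  smooth : ContDiff ℝ ∞ a
  tsupport_subset : tsupport a ⊆ Ioo (-1) 1

theorem IsRadialTest.hasCompactSupport {a : ℝ → ℝ} (ha : IsRadialTest a) :
    HasCompactSupport a :=
  HasCompactSupport.of_support_subset_isCompact (isCompact_Icc (a := (-1 : ℝ)) (b := 1))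
    ((subset_tsupport a).trans (ha.tsupport_subset.trans Ioo_subset_Icc_self))

theorem fderiv_mul_prod {a b : ℝ → ℝ} (ha : Differentiable ℝ a) (hb : Differentiable ℝ b)
    (z : ℝ × ℝ) (e : ℝ × ℝ) : fderiv ℝ (fun z : ℝ × ℝ => a z.1 * b z.2) z e
      = e.1 * deriv a z.1 * b z.2 + e.2 * a z.1 * deriv b z.2 := by
  have h1 : HasFDerivAt (fun z : ℝ × ℝ => a z.1) _ z :=
    (ha z.1).hasDerivAt.hasFDerivAt.comp z hasFDerivAt_fst
  have h2 : HasFDerivAt (fun z : ℝ × ℝ => b z.2) _ z :=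
    (hb z.2).hasDerivAt.hasFDerivAt.comp z hasFDerivAt_snd
  rw [(h1.fun_mul h2).fderiv]
  simp
  ring

theorem contDiff_bump_mul {c : ℝ → ℝ} (hc : ContDiff ℝ ∞ c) :
    ContDiff ℝ ∞ fun x => unitBump x * c x := contDiff_unitBump.mul hc

theorem isTest_bump {a c : ℝ → ℝ} (ha : IsRadialTest a) (hc : ContDiff ℝ ∞ c) :
    ContDiff ℝ ∞ (fun z : ℝ × ℝ => a z.1 * (unitBump z.2 * c z.2)) ∧
    HasCompactSupport (fun z : ℝ × ℝ => a z.1 * (unitBump z.2 * c z.2)) ∧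
    tsupport (fun z : ℝ × ℝ => a z.1 * (unitBump z.2 * c z.2)) ⊆ Ioo (-1) 1 ×ˢ univ := by
  have hsub : Function.support (fun z : ℝ × ℝ => a z.1 * (unitBump z.2 * c z.2))
      ⊆ tsupport a ×ˢ Icc 0 (4 * Real.pi) := by
    rintro ⟨x, y⟩ h
    simp only [Function.mem_support, ne_eq, mul_eq_zero, not_or] at h
    refine ⟨subset_tsupport a h.1, ?_⟩
    by_contra hy
    exact h.2.1 (unitBump_eq_zero fun h' => hy (Ioo_subset_Icc_self h'))
  have hcpt : IsCompact (tsupport a ×ˢ Icc 0 (4 * Real.pi)) :=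
    ha.hasCompactSupport.isCompact.prod isCompact_Icc
  refine ⟨?_, HasCompactSupport.of_support_subset_isCompact hcpt hsub, ?_⟩
  · exact (ha.smooth.comp contDiff_fst).mul ((contDiff_bump_mul hc).comp contDiff_snd)
  · refine (closure_minimal hsub hcpt.isClosed).trans ?_
    exact prod_mono ha.tsupport_subset (subset_univ _)

theorem PeriodicPhi.mul_fst {u : ℝ × ℝ → ℝ} (hu : PeriodicPhi u) (a : ℝ → ℝ) :
    PeriodicPhi fun z => u z * a z.1 := fun ρ hρ φ => by
  simp only [hu ρ hρ φ]

theorem integrableOn_mul_fst {u : ℝ × ℝ → ℝ} (hu : IntegrableOn u domain) {a : ℝ → ℝ}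
    (ha : Continuous a) (hc : HasCompactSupport a) :
    IntegrableOn (fun z => u z * a z.1) domain := by
  obtain ⟨C, hC⟩ := hc.exists_bound_of_continuous ha
  refine Integrable.mul_bdd (c := C) hu (ha.comp continuous_fst).aestronglyMeasurable ?_
  exact Eventually.of_forall fun z => hC _

/-- A periodic `c` is not compactly supported in `φ`, so `unitBump * c` is used in the test
function. Folding the strip onto one period sums the translates of the bump to one and restores `c`.
-/
theorem IsWeakDeriv.integral_rho {u w : ℝ × ℝ → ℝ} (h : IsWeakDeriv (1, 0) u w)
    (hu : PeriodicPhi u) (hw : PeriodicPhi w) (hui : IntegrableOn u domain)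
    (hwi : IntegrableOn w domain) {a c : ℝ → ℝ} (ha : IsRadialTest a)
    (hc : ContDiff ℝ ∞ c) (hper : ∀ x, c (x + 2 * Real.pi) = c x) :
    ∫ z in domain, u z * deriv a z.1 * c z.2 = -∫ z in domain, w z * a z.1 * c z.2 := by
  have htest := isTest_bump ha hc
  have hb := contDiff_bump_mul hc
  have h0 : ∀ x, x ∉ Ioo 0 (4 * Real.pi) → unitBump x * c x = 0 := fun x hx => by
    rw [unitBump_eq_zero hx, zero_mul]
  have h1 := h _ htest.1 htest.2.1 htest.2.2
  have hfd : ∀ z e : ℝ × ℝ, fderiv ℝ (fun z : ℝ × ℝ => a z.1 * (unitBump z.2 * c z.2)) z e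
      = e.1 * deriv a z.1 * (unitBump z.2 * c z.2)
        + e.2 * a z.1 * deriv (fun x => unitBump x * c x) z.2 :=
    fderiv_mul_prod (ha.smooth.differentiable (by simp)) (hb.differentiable (by simp))
  simp only [hfd] at h1
  simp only [one_mul, zero_mul, add_zero, ← mul_assoc] at h1
  simp only [mul_assoc _ (unitBump _) _] at h1
  have ha' : Continuous (deriv a) := ha.smooth.continuous_deriv (by simp)
  rw [integral_strip_eq (hu.mul_fst (deriv a))
      (integrableOn_mul_fst hui ha' ha.hasCompactSupport.deriv) hb.continuous h0,
    integral_strip_eq (hw.mul_fst a)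
      (integrableOn_mul_fst hwi ha.smooth.continuous ha.hasCompactSupport) hb.continuous h0] at h1
  have hsum : ∀ z ∈ domain, unitBump z.2 * c z.2
      + unitBump (z.2 + 2 * Real.pi) * c (z.2 + 2 * Real.pi) = c z.2 := fun z hz => by
    rw [hper, ← add_mul, unitBump_add hz.2, one_mul]
  refine ((setIntegral_congr_fun measurableSet_domain fun z hz => ?_).trans h1).trans
    (congrArg Neg.neg (setIntegral_congr_fun measurableSet_domain fun z hz => ?_)) <;>
  simp only [hsum z hz]

/-- The folding argument of `IsWeakDeriv.integral_rho`, except that the derivative falls on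
`unitBump * c`; the identity for the sum of translates is differentiated on the open period. -/
theorem IsWeakDeriv.integral_phi {u w : ℝ × ℝ → ℝ} (h : IsWeakDeriv (0, 1) u w)
    (hu : PeriodicPhi u) (hw : PeriodicPhi w) (hui : IntegrableOn u domain)
    (hwi : IntegrableOn w domain) {a c : ℝ → ℝ} (ha : IsRadialTest a)
    (hc : ContDiff ℝ ∞ c) (hper : ∀ x, c (x + 2 * Real.pi) = c x) :
    ∫ z in domain, u z * a z.1 * deriv c z.2 = -∫ z in domain, w z * a z.1 * c z.2 := by
  have htest := isTest_bump ha hc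
  have hb := contDiff_bump_mul hc
  have h0 : ∀ x, x ∉ Ioo 0 (4 * Real.pi) → unitBump x * c x = 0 := fun x hx => by
    rw [unitBump_eq_zero hx, zero_mul]
  -- Local constancy gives this only off the closed interval; the two endpoints follow by continuity
  -- of the derivative.
  have h0' : ∀ x, x ∉ Ioo 0 (4 * Real.pi) → deriv (fun x => unitBump x * c x) x = 0 := by
    have hz : EqOn (deriv fun x => unitBump x * c x) 0 (Icc 0 (4 * Real.pi))ᶜ := fun x hx => by
      have : (fun x => unitBump x * c x) =ᶠ[𝓝 x] fun _ => 0 := by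
        filter_upwards [isClosed_Icc.isOpen_compl.mem_nhds hx] with y hy
        exact h0 y fun h => hy (Ioo_subset_Icc_self h)
      rw [this.deriv_eq]
      simp
    have hcl := hz.closure (hb.continuous_deriv (by simp)) continuous_const
    rw [closure_compl, interior_Icc] at hcl
    exact hcl
  have h1 := h _ htest.1 htest.2.1 htest.2.2
  have hfd : ∀ z e : ℝ × ℝ, fderiv ℝ (fun z : ℝ × ℝ => a z.1 * (unitBump z.2 * c z.2)) z e
      = e.1 * deriv a z.1 * (unitBump z.2 * c z.2)
        + e.2 * a z.1 * deriv (fun x => unitBump x * c x) z.2 :=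
    fderiv_mul_prod (ha.smooth.differentiable (by simp)) (hb.differentiable (by simp))
  simp only [hfd] at h1
  simp only [one_mul, zero_mul, zero_add, ← mul_assoc] at h1
  simp only [mul_assoc _ (unitBump _) _] at h1
  rw [integral_strip_eq (hu.mul_fst a)
      (integrableOn_mul_fst hui ha.smooth.continuous ha.hasCompactSupport)
      (hb.continuous_deriv (by simp)) h0',
    integral_strip_eq (hw.mul_fst a)
      (integrableOn_mul_fst hwi ha.smooth.continuous ha.hasCompactSupport) hb.continuous h0] at h1
  have hsum : ∀ x ∈ Ioo 0 (2 * Real.pi), unitBump x * c x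
      + unitBump (x + 2 * Real.pi) * c (x + 2 * Real.pi) = c x := fun x hx => by
    rw [hper, ← add_mul, unitBump_add hx, one_mul]
  have hsum' : ∀ x ∈ Ioo 0 (2 * Real.pi), deriv (fun x => unitBump x * c x) x
      + deriv (fun x => unitBump x * c x) (x + 2 * Real.pi) = deriv c x := fun x hx => by
    have hd : Differentiable ℝ fun x => unitBump x * c x := hb.differentiable (by simp)
    have hd' : Differentiable ℝ fun x => unitBump (x + 2 * Real.pi) * c (x + 2 * Real.pi) :=
      hd.comp (differentiable_id.add_const (2 * Real.pi))
    rw [← deriv_comp_add_const, ← deriv_fun_add (hd x) (hd' x)]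
    refine Filter.EventuallyEq.deriv_eq ?_
    filter_upwards [isOpen_Ioo.mem_nhds hx] with y hy using hsum y hy
  refine ((setIntegral_congr_fun measurableSet_domain fun z hz => ?_).trans h1).trans
    (congrArg Neg.neg (setIntegral_congr_fun measurableSet_domain fun z hz => ?_))
  · simp only [hsum' z.2 hz.2]
  · simp only [hsum z.2 hz.2]

/-! ### Cutoff functions and the Hartley-Chebyshev coefficients -/

/-- The Hartley kernel `cas x = cos x + sin x`. -/
def cas (x : ℝ) : ℝ := Real.cos x + Real.sin x

theorem continuous_cas : Continuous cas := by unfold cas; fun_prop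

theorem contDiff_cas : ContDiff ℝ ∞ cas := by
  unfold cas
  exact Real.contDiff_cos.add Real.contDiff_sin

theorem abs_cas_le (x : ℝ) : |cas x| ≤ 2 := by
  unfold cas
  refine (abs_add_le _ _).trans ?_
  linarith [Real.abs_cos_le_one x, Real.abs_sin_le_one x]

/-- `cas' x = cas (-x)`: differentiation sends the frequency `k` to `-k`, so one real family indexed
by `ℤ` plays the role of the complex exponentials. -/
theorem hasDerivAt_cas (k x : ℝ) :
    HasDerivAt (fun x => cas (k * x)) (k * cas (-k * x)) x := by
  have h : HasDerivAt (fun x : ℝ => k * x) k x := by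
    simpa using (hasDerivAt_id x).const_mul k
  have h1 := h.cos.add h.sin
  refine h1.congr_deriv ?_
  simp only [cas, neg_mul, Real.cos_neg, Real.sin_neg]
  ring

theorem cas_int_periodic (k : ℤ) (x : ℝ) : cas (k * (x + 2 * Real.pi)) = cas (k * x) := by
  have : (k : ℝ) * (x + 2 * Real.pi) = k * x + k * (2 * Real.pi) := by ring
  rw [cas, cas, this, Real.cos_add_int_mul_two_pi, Real.sin_add_int_mul_two_pi]

theorem deriv_smoothTransition_eq_zero {x : ℝ} (hx : x ∉ Icc (0 : ℝ) 1) :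
    deriv Real.smoothTransition x = 0 := by
  rw [mem_Icc, not_and_or, not_le, not_le] at hx
  rcases hx with hx | hx
  · have : Real.smoothTransition =ᶠ[𝓝 x] fun _ => 0 := by
      filter_upwards [Iio_mem_nhds hx] with y hy
      exact Real.smoothTransition.zero_of_nonpos (le_of_lt hy)
    rw [this.deriv_eq, deriv_const]
  · have : Real.smoothTransition =ᶠ[𝓝 x] fun _ => 1 := by
      filter_upwards [Ioi_mem_nhds hx] with y hy
      exact Real.smoothTransition.one_of_one_le (le_of_lt hy)
    rw [this.deriv_eq, deriv_const]

theorem exists_abs_deriv_smoothTransition_le :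
    ∃ C, 0 ≤ C ∧ ∀ x, |deriv Real.smoothTransition x| ≤ C := by
  have hc : Continuous (deriv Real.smoothTransition) :=
    (Real.smoothTransition.contDiff (n := 1)).continuous_deriv (by simp)
  obtain ⟨C, hC⟩ := (isCompact_Icc (a := (0 : ℝ)) (b := 1)).exists_bound_of_continuousOn
    hc.continuousOn
  refine ⟨max C 0, le_max_right _ _, fun x => ?_⟩
  by_cases hx : x ∈ Icc (0 : ℝ) 1
  · exact (hC x hx).trans (le_max_left _ _)
  · rw [deriv_smoothTransition_eq_zero hx]
    simp

/-- A smooth cutoff in `(-1, 1)` that equals one where `2 ≤ n (1 - ρ²)`. -/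
def radialCutoff (n : ℕ) (ρ : ℝ) : ℝ := Real.smoothTransition (n * (1 - ρ ^ 2) - 1)

/-- The cutoff vanishes where `n (1 - ρ²) ≤ 1`, so smoothness of `q` is needed only in the interior
and `q` may be singular at `±1`. -/
theorem isRadialTest_cutoff_mul (n : ℕ) {q : ℝ → ℝ}
    (hq : ∀ ρ ∈ Ioo (-1 : ℝ) 1, ContDiffAt ℝ ∞ q ρ) :
    IsRadialTest fun ρ => radialCutoff n ρ * q ρ := by
  have hcut : ContDiff ℝ ∞ (radialCutoff n) := by
    unfold radialCutoff
    exact Real.smoothTransition.contDiff.comp (by fun_prop)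
  have hsub : Function.support (fun ρ => radialCutoff n ρ * q ρ)
      ⊆ {ρ | 1 ≤ n * (1 - ρ ^ 2)} := by
    intro ρ h
    simp only [Function.mem_support, ne_eq, mul_eq_zero, not_or] at h
    by_contra h'
    rw [mem_ofPred_eq, not_le] at h'
    exact h.1 (Real.smoothTransition.zero_of_nonpos (by linarith))
  have hcl : IsClosed {ρ : ℝ | 1 ≤ n * (1 - ρ ^ 2)} :=
    isClosed_le continuous_const (by fun_prop)
  have hts : tsupport (fun ρ => radialCutoff n ρ * q ρ) ⊆ Ioo (-1) 1 := by
    refine (closure_minimal hsub hcl).trans fun ρ hρ => ?_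
    rw [mem_ofPred_eq] at hρ
    have hn : (0 : ℝ) ≤ n := n.cast_nonneg
    have h1 : 0 < 1 - ρ ^ 2 := by
      by_contra h
      nlinarith
    exact abs_lt.1 (by rw [← sq_lt_one_iff_abs_lt_one]; linarith)
  refine ⟨contDiff_iff_contDiffAt.2 fun ρ => ?_, hts⟩
  by_cases hρ : ρ ∈ Ioo (-1 : ℝ) 1
  · exact hcut.contDiffAt.mul (hq ρ hρ)
  · have : (fun ρ => radialCutoff n ρ * q ρ) =ᶠ[𝓝 ρ] fun _ => 0 :=
      notMem_tsupport_iff_eventuallyEq.1 fun h => hρ (hts h)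
    exact contDiffAt_const.congr_of_eventuallyEq this

theorem contDiffAt_sqrt_one_sub_sq {ρ : ℝ} (hρ : ρ ∈ Ioo (-1 : ℝ) 1) :
    ContDiffAt ℝ ∞ (fun ρ => Real.sqrt (1 - ρ ^ 2)) ρ := by
  have h1 : 0 < 1 - ρ ^ 2 := by nlinarith [hρ.1, hρ.2]
  exact ContDiffAt.sqrt (by fun_prop) h1.ne'

/-- Induction with the addition formula. This inequality pays for every division by `sin θ` near `ρ
= ±1`. -/
theorem abs_sin_int_mul_le (j : ℤ) (x : ℝ) : |Real.sin (j * x)| ≤ |(j : ℝ)| * |Real.sin x| := by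
  have h : ∀ n : ℕ, |Real.sin (n * x)| ≤ n * |Real.sin x| := by
    intro n
    induction n with
    | zero => simp
    | succ n ih =>
      have : ((n + 1 : ℕ) : ℝ) * x = n * x + x := by push_cast; ring
      rw [this, Real.sin_add]
      refine (abs_add_le _ _).trans ?_
      rw [abs_mul, abs_mul]
      have h1 := Real.abs_cos_le_one x
      have h2 := Real.abs_cos_le_one (n * x)
      have h3 := abs_nonneg (Real.sin x)
      have h4 := abs_nonneg (Real.sin (n * x))
      push_cast
      nlinarith
  obtain ⟨n, rfl | rfl⟩ := j.eq_nat_or_neg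
  · simpa using h n
  · simpa [Real.sin_neg] using h n

theorem contDiff_eval (p : Polynomial ℝ) : ContDiff ℝ ∞ fun x => p.eval x := by
  simpa using p.contDiff_aeval (𝕜 := ℝ) ∞

/-! ### Weak derivatives in the angular variable -/

theorem tendsto_integral_mul {α : Type*} [MeasurableSpace α] {μ : Measure α} {f : α → ℝ}
    (hf : Integrable f μ) {m : ℕ → α → ℝ} {g : α → ℝ} {C : ℝ}
    (hm : ∀ n, AEStronglyMeasurable (m n) μ) (hC : ∀ n, ∀ᵐ x ∂μ, |m n x| ≤ C)
    (hlim : ∀ᵐ x ∂μ, Tendsto (fun n => m n x) atTop (𝓝 (g x))) :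
    Tendsto (fun n => ∫ x, f x * m n x ∂μ) atTop (𝓝 (∫ x, f x * g x ∂μ)) := by
  refine tendsto_integral_of_dominated_convergence (fun x => ‖f x‖ * C)
    (fun n => hf.aestronglyMeasurable.mul (hm n)) (hf.norm.mul_const C) (fun n => ?_) ?_
  · filter_upwards [hC n] with x hx
    rw [norm_mul]
    exact mul_le_mul_of_nonneg_left hx (norm_nonneg _)
  · filter_upwards [hlim] with x hx using hx.const_mul _

theorem eventually_one_lt_nat_mul {s : ℝ} (hs : 0 < s) :
    ∀ᶠ n : ℕ in atTop, 1 < n * s ^ 2 - 1 := by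
  have h : Tendsto (fun n : ℕ => (n : ℝ) * s ^ 2) atTop atTop :=
    tendsto_natCast_atTop_atTop.atTop_mul_const (by positivity)
  filter_upwards [h.eventually_gt_atTop 2] with n hn
  linarith

theorem ae_angleDomain {P : ℝ × ℝ → Prop} (h : ∀ z ∈ angleDomain, P z) :
    ∀ᵐ z ∂volume.restrict angleDomain, P z :=
  (ae_restrict_iff' measurableSet_angleDomain).2 (Eventually.of_forall h)

theorem exists_abs_le_of_periodic {c : ℝ → ℝ} (hc : Continuous c)
    (hper : ∀ x, c (x + 2 * Real.pi) = c x) : ∃ C, 0 ≤ C ∧ ∀ x, |c x| ≤ C := by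
  have hp : Function.Periodic c (2 * Real.pi) := hper
  obtain ⟨C, hC⟩ := (isCompact_Icc (a := (0 : ℝ)) (b := 2 * Real.pi)).exists_bound_of_continuousOn
    hc.continuousOn
  refine ⟨max C 0, le_max_right _ _, fun x => ?_⟩
  obtain ⟨y, hy, hxy⟩ := hp.exists_mem_Ico₀ (by positivity) x
  rw [hxy]
  exact (hC y (Ico_subset_Icc_self hy)).trans (le_max_left _ _)

/-- The axial test function is `T_j / √(1 - ρ²)`, whose denominator cancels the Jacobian and leaves
`cos jθ`. It is singular at `±1`, so it is cut off and the cutoff is removed by dominated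
convergence. -/
theorem IsWeakDeriv.integral_phi_angle {u w : ℝ × ℝ → ℝ} (h : IsWeakDeriv (0, 1) u w)
    (hu : PeriodicPhi u) (hw : PeriodicPhi w) (hui : MemLp u 2 weightedMeasure)
    (hwi : MemLp w 2 weightedMeasure) {c : ℝ → ℝ} (hc : ContDiff ℝ ∞ c)
    (hper : ∀ x, c (x + 2 * Real.pi) = c x) (j : ℤ) :
    ∫ z in angleDomain, u (Real.cos z.1, z.2) * (Real.cos (j * z.1) * deriv c z.2)
      = -∫ z in angleDomain, w (Real.cos z.1, z.2) * (Real.cos (j * z.1) * c z.2) := by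
  set q : ℝ → ℝ := fun ρ => (Polynomial.Chebyshev.T ℝ j).eval ρ / Real.sqrt (1 - ρ ^ 2) with hq
  have hq' : ∀ ρ ∈ Ioo (-1 : ℝ) 1, ContDiffAt ℝ ∞ q ρ := fun ρ hρ => by
    have h1 : 0 < 1 - ρ ^ 2 := by nlinarith [hρ.1, hρ.2]
    exact (contDiff_eval _).contDiffAt.div (contDiffAt_sqrt_one_sub_sq hρ)
      (Real.sqrt_pos.2 h1).ne'
  have hT : ∀ (v : ℝ × ℝ → ℝ) (b : ℝ → ℝ) (n : ℕ),
      ∫ z in domain, v z * (radialCutoff n z.1 * q z.1) * b z.2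
      = ∫ z in angleDomain, v (Real.cos z.1, z.2)
        * (Real.smoothTransition (n * Real.sin z.1 ^ 2 - 1) * (Real.cos (j * z.1) * b z.2)) := by
    intro v b n
    rw [integral_domain]
    refine setIntegral_congr_fun measurableSet_angleDomain fun z hz => ?_
    have hs := Real.sin_pos_of_mem_Ioo hz.1
    have h1 : 1 - Real.cos z.1 ^ 2 = Real.sin z.1 ^ 2 := by
      have := Real.sin_sq_add_cos_sq z.1
      linarith
    simp only [hq, radialCutoff, Polynomial.Chebyshev.T_real_cos, h1, Real.sqrt_sq hs.le]
    field_simp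
  have hlim : ∀ (v : ℝ × ℝ → ℝ) (b : ℝ → ℝ), MemLp v 2 weightedMeasure → Continuous b →
      (∀ x, b (x + 2 * Real.pi) = b x) →
      Tendsto (fun n : ℕ => ∫ z in domain, v z * (radialCutoff n z.1 * q z.1) * b z.2) atTop
        (𝓝 (∫ z in angleDomain, v (Real.cos z.1, z.2) * (Real.cos (j * z.1) * b z.2))) := by
    intro v b hv hb hbper
    obtain ⟨C, hC0, hC⟩ := exists_abs_le_of_periodic hb hbper
    simp only [hT]
    refine tendsto_integral_mul (C := C) (integrableOn_of_memLp hv) (fun n => ?_) (fun n => ?_) ?_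
    · have := Real.smoothTransition.continuous
      exact Continuous.aestronglyMeasurable (by fun_prop)
    · refine Eventually.of_forall fun z => ?_
      rw [abs_mul, abs_mul, abs_of_nonneg (Real.smoothTransition.nonneg _)]
      calc _ ≤ 1 * (1 * C) := by
            gcongr
            · exact Real.smoothTransition.le_one _
            · exact Real.abs_cos_le_one _
            · exact hC _
        _ = C := by ring
    · refine ae_angleDomain fun z hz => ?_
      have hs := Real.sin_pos_of_mem_Ioo hz.1
      refine tendsto_const_nhds.congr' ?_
      filter_upwards [eventually_one_lt_nat_mul hs] with n hn
      rw [Real.smoothTransition.one_of_one_le hn.le, one_mul]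
  have hper' : ∀ x, deriv c (x + 2 * Real.pi) = deriv c x := fun x => by
    rw [← deriv_comp_add_const]
    simp only [hper]
  refine tendsto_nhds_unique (hlim u (deriv c) hui (hc.continuous_deriv (by simp)) hper') ?_
  refine (hlim w c hwi hc.continuous hper).neg.congr fun n => ?_
  rw [h.integral_phi hu hw (integrableOn_domain_of_memLp hui) (integrableOn_domain_of_memLp hwi)
    (isRadialTest_cutoff_mul n hq') hc hper]

/-- The axial test function is `√(1 - ρ²) U_{j-1}`, which is `sin jθ` in the angle, and `sin θ d/dρ`
acts as `-d/dθ`. Since `sin jθ` vanishes at `0` and `π`, the term with the derivative of the cutoff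
stays bounded and disappears in the limit. -/
theorem IsWeakDeriv.integral_rho_angle {u w : ℝ × ℝ → ℝ} (h : IsWeakDeriv (1, 0) u w)
    (hu : PeriodicPhi u) (hw : PeriodicPhi w) (hui : MemLp u 2 weightedMeasure)
    (hwi : MemLp w 2 weightedMeasure) {c : ℝ → ℝ} (hc : ContDiff ℝ ∞ c)
    (hper : ∀ x, c (x + 2 * Real.pi) = c x) (j : ℤ) :
    ∫ z in angleDomain, u (Real.cos z.1, z.2) * (j * Real.cos (j * z.1) * c z.2)
      = ∫ z in angleDomain,
        w (Real.cos z.1, z.2) * (Real.sin z.1 * Real.sin (j * z.1) * c z.2) := by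
  obtain ⟨C, hC0, hC⟩ := exists_abs_le_of_periodic hc.continuous hper
  obtain ⟨B, hB0, hB⟩ := exists_abs_deriv_smoothTransition_le
  have hσ := Real.smoothTransition.continuous
  have hσd : Differentiable ℝ Real.smoothTransition :=
    (Real.smoothTransition.contDiff (n := 1)).differentiable (by simp)
  have hσ' : Continuous (deriv Real.smoothTransition) :=
    (Real.smoothTransition.contDiff (n := 1)).continuous_deriv (by simp)
  set q : ℝ → ℝ := fun ρ =>
    Real.sqrt (1 - ρ ^ 2) * (Polynomial.Chebyshev.U ℝ (j - 1)).eval ρ with hq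
  have hq' : ∀ ρ ∈ Ioo (-1 : ℝ) 1, ContDiffAt ℝ ∞ q ρ := fun ρ hρ =>
    (contDiffAt_sqrt_one_sub_sq hρ).mul (contDiff_eval _).contDiffAt
  have hval : ∀ (n : ℕ), ∀ θ ∈ Ioo 0 Real.pi, radialCutoff n (Real.cos θ) * q (Real.cos θ)
      = Real.smoothTransition (n * Real.sin θ ^ 2 - 1) * Real.sin (j * θ) := by
    intro n θ hθ
    have h1 : 1 - Real.cos θ ^ 2 = Real.sin θ ^ 2 := by
      have := Real.sin_sq_add_cos_sq θ
      linarith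
    have h2 := Polynomial.Chebyshev.U_real_cos θ (j - 1)
    simp only [Int.cast_sub, Int.cast_one, sub_add_cancel] at h2
    simp only [hq, radialCutoff, h1, ← h2, Real.sqrt_sq (Real.sin_pos_of_mem_Ioo hθ).le]
    ring
  have hder : ∀ (n : ℕ), ∀ θ ∈ Ioo 0 Real.pi,
      Real.sin θ * deriv (fun ρ => radialCutoff n ρ * q ρ) (Real.cos θ)
      = -(deriv Real.smoothTransition (n * Real.sin θ ^ 2 - 1)
          * (n * (2 * Real.sin θ * Real.cos θ)) * Real.sin (j * θ)
        + Real.smoothTransition (n * Real.sin θ ^ 2 - 1) * (j * Real.cos (j * θ))) := by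
    intro n θ hθ
    have h1 : HasDerivAt (fun ρ => radialCutoff n ρ * q ρ)
        (deriv (fun ρ => radialCutoff n ρ * q ρ) (Real.cos θ)) (Real.cos θ) :=
      ((isRadialTest_cutoff_mul n hq').smooth.differentiable (by simp) _).hasDerivAt
    have h2 := h1.comp θ (Real.hasDerivAt_cos θ)
    have h3 : HasDerivAt (fun θ => (n : ℝ) * Real.sin θ ^ 2 - 1)
        (n * (2 * Real.sin θ * Real.cos θ)) θ := by
      have := (((Real.hasDerivAt_sin θ).pow 2).const_mul (n : ℝ)).sub_const 1
      simpa using this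
    have h4 : HasDerivAt (fun θ : ℝ => (j : ℝ) * θ) j θ := by
      simpa using (hasDerivAt_id θ).const_mul (j : ℝ)
    have h5 := ((hσd _).hasDerivAt.comp θ h3).mul h4.sin
    have h6 := h5.congr_of_eventuallyEq (f₁ := (fun ρ => radialCutoff n ρ * q ρ) ∘ Real.cos) (by
      filter_upwards [isOpen_Ioo.mem_nhds hθ] with t ht using hval n t ht)
    have h7 := h2.unique h6
    simp only [Function.comp_apply] at h7
    linear_combination (-1 : ℝ) * h7
  have hT : ∀ n : ℕ, ∫ z in domain, u z * deriv (fun ρ => radialCutoff n ρ * q ρ) z.1 * c z.2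
      = ∫ z in angleDomain, u (Real.cos z.1, z.2)
        * -((deriv Real.smoothTransition (n * Real.sin z.1 ^ 2 - 1)
          * (n * (2 * Real.sin z.1 * Real.cos z.1)) * Real.sin (j * z.1)
        + Real.smoothTransition (n * Real.sin z.1 ^ 2 - 1) * (j * Real.cos (j * z.1)))
          * c z.2) := by
    intro n
    rw [integral_domain]
    refine setIntegral_congr_fun measurableSet_angleDomain fun z hz => ?_
    have := hder n z.1 hz.1
    simp only
    linear_combination (u (Real.cos z.1, z.2) * c z.2) * this
  have hT' : ∀ n : ℕ, ∫ z in domain, w z * (radialCutoff n z.1 * q z.1) * c z.2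
      = ∫ z in angleDomain, w (Real.cos z.1, z.2)
        * (Real.smoothTransition (n * Real.sin z.1 ^ 2 - 1)
          * (Real.sin z.1 * Real.sin (j * z.1) * c z.2)) := by
    intro n
    rw [integral_domain]
    refine setIntegral_congr_fun measurableSet_angleDomain fun z hz => ?_
    have := hval n z.1 hz.1
    simp only
    linear_combination (w (Real.cos z.1, z.2) * c z.2 * Real.sin z.1) * this
  have hlim' : Tendsto (fun n : ℕ => ∫ z in domain, w z * (radialCutoff n z.1 * q z.1) * c z.2)
      atTop (𝓝 (∫ z in angleDomain,
        w (Real.cos z.1, z.2) * (Real.sin z.1 * Real.sin (j * z.1) * c z.2))) := by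
    simp only [hT']
    have hcc := hc.continuous
    refine tendsto_integral_mul (C := C) (integrableOn_of_memLp hwi) (fun n => ?_)
      (fun n => ?_) ?_
    · exact Continuous.aestronglyMeasurable (by fun_prop)
    · refine Eventually.of_forall fun z => ?_
      rw [abs_mul, abs_mul, abs_mul, abs_of_nonneg (Real.smoothTransition.nonneg _)]
      calc _ ≤ 1 * (1 * 1 * C) := by
            gcongr
            · exact Real.smoothTransition.le_one _
            · exact Real.abs_sin_le_one _
            · exact Real.abs_sin_le_one _
            · exact hC _
        _ = C := by ring
    · refine ae_angleDomain fun z hz => ?_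
      have hs := Real.sin_pos_of_mem_Ioo hz.1
      refine tendsto_const_nhds.congr' ?_
      filter_upwards [eventually_one_lt_nat_mul hs] with n hn
      rw [Real.smoothTransition.one_of_one_le hn.le, one_mul]
  have hlim : Tendsto
      (fun n : ℕ => ∫ z in domain, u z * deriv (fun ρ => radialCutoff n ρ * q ρ) z.1 * c z.2)
      atTop (𝓝 (∫ z in angleDomain,
        u (Real.cos z.1, z.2) * -(j * Real.cos (j * z.1) * c z.2))) := by
    simp only [hT]
    have hcc := hc.continuous
    refine tendsto_integral_mul (C := (4 * B * |(j : ℝ)| + |(j : ℝ)|) * C)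
      (integrableOn_of_memLp hui) (fun n => ?_) (fun n => ?_) ?_
    · exact Continuous.aestronglyMeasurable (by fun_prop)
    · refine ae_angleDomain fun z hz => ?_
      have hs := Real.sin_pos_of_mem_Ioo hz.1
      rw [abs_neg, abs_mul]
      refine mul_le_mul ((abs_add_le _ _).trans (add_le_add ?_ ?_)) (hC _) (abs_nonneg _)
        (by positivity)
      -- The derivative of the cutoff is nonzero only where `n sin² θ ≤ 2`. There its factor `n sin
      -- θ` is compensated by `|sin jθ| ≤ |j| sin θ`, which gives the bound `4 B |j|` uniformly in
      -- `n`.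
      · by_cases hI : (n : ℝ) * Real.sin z.1 ^ 2 - 1 ∈ Icc (0 : ℝ) 1
        · have h1 : |Real.sin (j * z.1)| ≤ |(j : ℝ)| * Real.sin z.1 := by
            simpa [abs_of_pos hs] using abs_sin_int_mul_le j z.1
          rw [abs_mul, abs_mul, abs_mul, abs_mul, abs_mul, abs_of_pos hs, Nat.abs_cast, abs_two]
          have h3 : (n : ℝ) * Real.sin z.1 ^ 2 ≤ 2 := by linarith [hI.2]
          calc _ ≤ B * (n * (2 * Real.sin z.1 * 1)) * (|(j : ℝ)| * Real.sin z.1) := by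
                gcongr
                · exact hB _
                · exact Real.abs_cos_le_one _
            _ = 2 * B * |(j : ℝ)| * (n * Real.sin z.1 ^ 2) := by ring
            _ ≤ 2 * B * |(j : ℝ)| * 2 := by gcongr
            _ = 4 * B * |(j : ℝ)| := by ring
        · rw [deriv_smoothTransition_eq_zero hI, zero_mul, zero_mul, abs_zero]
          positivity
      · rw [abs_mul, abs_mul, abs_of_nonneg (Real.smoothTransition.nonneg _)]
        calc _ ≤ 1 * (|(j : ℝ)| * 1) := by
              gcongr
              · exact Real.smoothTransition.le_one _
              · exact Real.abs_cos_le_one _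
          _ = |(j : ℝ)| := by ring
    · refine ae_angleDomain fun z hz => ?_
      have hs := Real.sin_pos_of_mem_Ioo hz.1
      refine tendsto_const_nhds.congr' ?_
      filter_upwards [eventually_one_lt_nat_mul hs] with n hn
      rw [Real.smoothTransition.one_of_one_le hn.le, one_mul,
        deriv_smoothTransition_eq_zero fun h => absurd h.2 (not_le.2 hn)]
      ring
  have hfin := tendsto_nhds_unique hlim (hlim'.neg.congr fun n => by
    rw [h.integral_rho hu hw (integrableOn_domain_of_memLp hui) (integrableOn_domain_of_memLp hwi)
      (isRadialTest_cutoff_mul n hq') hc hper])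
  simp only [mul_neg, integral_neg, neg_inj] at hfin
  exact hfin

/-! ### Coefficients and their recursions -/

/-- The Hartley-Chebyshev coefficients of `w` (up to a constant factor). -/
def hcoef (w : ℝ × ℝ → ℝ) (j k : ℤ) : ℝ :=
  ∫ z in angleDomain, w (Real.cos z.1, z.2) * (Real.cos (j * z.1) * cas (k * z.2))

theorem contDiff_cas_mul (k : ℝ) : ContDiff ℝ ∞ fun x => cas (k * x) :=
  contDiff_cas.comp (contDiff_const.mul contDiff_id)

theorem integrableOn_angle_mul {f g : ℝ × ℝ → ℝ} (hf : IntegrableOn f angleDomain)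
    (hg : Continuous g) {C : ℝ} (hC : ∀ z, |g z| ≤ C) :
    IntegrableOn (fun z => f z * g z) angleDomain :=
  Integrable.mul_bdd (c := C) hf hg.aestronglyMeasurable (Eventually.of_forall hC)

theorem continuous_cos_mul_cas (j k : ℤ) :
    Continuous fun z : ℝ × ℝ => Real.cos (j * z.1) * cas (k * z.2) := by
  have := continuous_cas
  fun_prop

theorem abs_cos_mul_cas_le (x y : ℝ) : |Real.cos x * cas y| ≤ 2 := by
  rw [abs_mul]
  exact (mul_le_mul (Real.abs_cos_le_one _) (abs_cas_le _) (abs_nonneg _) zero_le_one).trans_eq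
    (one_mul 2)

theorem IsWeakDeriv.int_mul_hcoef_phi {u w : ℝ × ℝ → ℝ} (h : IsWeakDeriv (0, 1) u w)
    (hu : PeriodicPhi u) (hw : PeriodicPhi w) (hui : MemLp u 2 weightedMeasure)
    (hwi : MemLp w 2 weightedMeasure) (j k : ℤ) :
    k * hcoef u j k = hcoef w j (-k) := by
  -- The test function has frequency `-k`, because its derivative is then a multiple of `cas (kφ)`.
  have h1 := h.integral_phi_angle hu hw hui hwi (contDiff_cas_mul ((-k : ℤ) : ℝ))
    (cas_int_periodic (-k)) j
  have h2 : ∀ x : ℝ, deriv (fun x => cas (((-k : ℤ) : ℝ) * x)) x = -k * cas (k * x) := fun x => by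
    rw [(hasDerivAt_cas _ x).deriv]
    push_cast
    ring_nf
  simp only [h2] at h1
  have h3 : ∫ z in angleDomain, u (Real.cos z.1, z.2)
      * (Real.cos (j * z.1) * (-(k : ℝ) * cas (k * z.2))) = -(k : ℝ) * hcoef u j k := by
    rw [hcoef, ← integral_const_mul]
    congr 1
    funext z
    ring
  rw [h3] at h1
  change _ = -hcoef w j (-k) at h1
  linarith

/-- Integration by parts leaves `sin θ sin jθ`, which is half of `cos (j-1)θ - cos (j+1)θ`. The
factor `sin θ` of the chain rule thus becomes a shift of the index by one. -/
theorem IsWeakDeriv.int_mul_hcoef_rho {u w : ℝ × ℝ → ℝ} (h : IsWeakDeriv (1, 0) u w)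
    (hu : PeriodicPhi u) (hw : PeriodicPhi w) (hui : MemLp u 2 weightedMeasure)
    (hwi : MemLp w 2 weightedMeasure) (j k : ℤ) :
    j * hcoef u j k = (hcoef w (j - 1) k - hcoef w (j + 1) k) / 2 := by
  have h1 := h.integral_rho_angle hu hw hui hwi (contDiff_cas_mul k) (cas_int_periodic k) j
  have h3 : ∫ z in angleDomain, u (Real.cos z.1, z.2)
      * (j * Real.cos (j * z.1) * cas (k * z.2)) = j * hcoef u j k := by
    rw [hcoef, ← integral_const_mul]
    congr 1
    funext z
    ring
  rw [← h3, h1, hcoef, hcoef, ← integral_sub, ← integral_div]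
  · congr 1
    funext z
    push_cast
    rw [sub_mul, add_mul, one_mul, Real.cos_sub, Real.cos_add]
    ring
  · exact integrableOn_angle_mul (integrableOn_of_memLp hwi) (continuous_cos_mul_cas _ _)
      fun z => abs_cos_mul_cas_le _ _
  · exact integrableOn_angle_mul (integrableOn_of_memLp hwi) (continuous_cos_mul_cas _ _)
      fun z => abs_cos_mul_cas_le _ _

/-! ### Bessel's inequality -/

theorem integral_sq_sum_of_orthogonal {α ι : Type*} [MeasurableSpace α] {μ : Measure α}
    (s : Finset ι) (a : ι → ℝ) (v : ι → α → ℝ)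
    (hint : ∀ i ∈ s, ∀ j ∈ s, Integrable (fun x => v i x * v j x) μ)
    (horth : ∀ i ∈ s, ∀ j ∈ s, i ≠ j → ∫ x, v i x * v j x ∂μ = 0) :
    ∫ x, (∑ i ∈ s, a i * v i x) ^ 2 ∂μ = ∑ i ∈ s, a i ^ 2 * ∫ x, v i x * v i x ∂μ := by
  have h1 : ∀ x, (∑ i ∈ s, a i * v i x) ^ 2
      = ∑ i ∈ s, ∑ j ∈ s, a i * a j * (v i x * v j x) := by
    intro x
    rw [sq, Finset.sum_mul_sum]
    exact Finset.sum_congr rfl fun i _ => Finset.sum_congr rfl fun j _ => by ring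
  simp only [h1]
  rw [integral_finsetSum _ fun i hi => integrable_finsetSum _ fun j hj =>
    (hint i hi j hj).const_mul _]
  refine Finset.sum_congr rfl fun i hi => ?_
  rw [integral_finsetSum _ fun j hj => (hint i hi j hj).const_mul _]
  rw [Finset.sum_eq_single i]
  · rw [integral_const_mul]
    ring
  · intro j hj hji
    rw [integral_const_mul, horth i hi j hj hji.symm, mul_zero]
  · exact fun h => absurd hi h

/-- Bessel's inequality for an orthogonal family that is not normalised: expand `∫ (C f - ∑ aᵢ vᵢ)²
≥ 0` with `aᵢ = ∫ f vᵢ`. Only an upper bound for the norms of the `vᵢ` enters. -/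
theorem sum_sq_integral_mul_le {α ι : Type*} [MeasurableSpace α] {μ : Measure α}
    [IsFiniteMeasure μ] {f : α → ℝ} (hf : MemLp f 2 μ) (s : Finset ι) (v : ι → α → ℝ)
    (hv : ∀ i, MemLp (v i) 2 μ) (horth : ∀ i j, i ≠ j → ∫ x, v i x * v j x ∂μ = 0)
    {C : ℝ} (hC : 0 < C) (hvC : ∀ i, ∫ x, v i x * v i x ∂μ ≤ C) :
    ∑ i ∈ s, (∫ x, f x * v i x ∂μ) ^ 2 ≤ C * ∫ x, f x ^ 2 ∂μ := by
  set a : ι → ℝ := fun i => ∫ x, f x * v i x ∂μ with ha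
  have hint : ∀ i j, Integrable (fun x => v i x * v j x) μ := fun i j =>
    (hv i).integrable_mul (hv j)
  have hS := integral_sq_sum_of_orthogonal s a v (fun i _ j _ => hint i j)
    fun i _ j _ => horth i j
  have hSm : MemLp (fun x => ∑ i ∈ s, a i * v i x) 2 μ :=
    memLp_finsetSum s fun i _ => (hv i).const_mul (a i)
  have hfS : ∫ x, f x * ∑ i ∈ s, a i * v i x ∂μ = ∑ i ∈ s, a i ^ 2 := by
    simp only [Finset.mul_sum]
    rw [integral_finsetSum]
    · refine Finset.sum_congr rfl fun i _ => ?_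
      rw [sq]
      conv_rhs => rw [ha]
      rw [← integral_const_mul]
      congr 1
      funext x
      ring
    · intro i _
      exact (hf.integrable_mul ((hv i).const_mul (a i)))
  have hle : ∫ x, (∑ i ∈ s, a i * v i x) ^ 2 ∂μ ≤ C * ∑ i ∈ s, a i ^ 2 := by
    rw [hS, Finset.mul_sum]
    refine Finset.sum_le_sum fun i _ => ?_
    rw [mul_comm]
    exact mul_le_mul_of_nonneg_right (hvC i) (sq_nonneg _)
  have hpos : 0 ≤ ∫ x, (C * f x - ∑ i ∈ s, a i * v i x) ^ 2 ∂μ :=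
    integral_nonneg fun x => sq_nonneg _
  have hexp : ∫ x, (C * f x - ∑ i ∈ s, a i * v i x) ^ 2 ∂μ
      = C ^ 2 * ∫ x, f x ^ 2 ∂μ - 2 * C * ∑ i ∈ s, a i ^ 2
        + ∫ x, (∑ i ∈ s, a i * v i x) ^ 2 ∂μ := by
    rw [← hfS, ← integral_const_mul, ← integral_const_mul, ← integral_sub, ← integral_add]
    · congr 1
      funext x
      ring
    · exact (hf.integrable_sq.const_mul _).sub ((hf.integrable_mul hSm).const_mul _)
    · exact hSm.integrable_sq
    · exact hf.integrable_sq.const_mul _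
    · exact (hf.integrable_mul hSm).const_mul _
  rw [hexp] at hpos
  have h4 : C * ∑ i ∈ s, a i ^ 2 ≤ C * (C * ∫ x, f x ^ 2 ∂μ) := by nlinarith
  exact le_of_mul_le_mul_left h4 hC

theorem integral_cos_int_mul {k : ℤ} (hk : k ≠ 0) :
    ∫ x in (0 : ℝ)..(2 * Real.pi), Real.cos (k * x) = 0 := by
  have hk' : (k : ℝ) ≠ 0 := by exact_mod_cast hk
  rw [intervalIntegral.integral_comp_mul_left _ hk', integral_cos]
  have h := Real.sin_int_mul_pi (k * 2)
  push_cast at h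
  rw [← mul_assoc, h]
  simp

theorem integral_sin_int_mul (k : ℤ) :
    ∫ x in (0 : ℝ)..(2 * Real.pi), Real.sin (k * x) = 0 := by
  by_cases hk : k = 0
  · simp [hk]
  have hk' : (k : ℝ) ≠ 0 := by exact_mod_cast hk
  rw [intervalIntegral.integral_comp_mul_left _ hk', integral_sin]
  simp [Real.cos_int_mul_two_pi]

theorem integral_cas_mul_cas (k m : ℤ) :
    ∫ x in Ioo 0 (2 * Real.pi), cas (k * x) * cas (m * x)
      = if k = m then 2 * Real.pi else 0 := by
  have h1 : ∀ x : ℝ, cas (k * x) * cas (m * x)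
      = Real.cos ((k - m : ℤ) * x) + Real.sin ((k + m : ℤ) * x) := by
    intro x
    push_cast
    rw [sub_mul, add_mul, Real.cos_sub, Real.sin_add, cas, cas]
    ring
  have hpi := Real.pi_pos
  rw [← integral_Ioc_eq_integral_Ioo, ← intervalIntegral.integral_of_le (by positivity)]
  simp only [h1]
  rw [intervalIntegral.integral_add (Continuous.intervalIntegrable (by fun_prop) _ _)
    (Continuous.intervalIntegrable (by fun_prop) _ _), integral_sin_int_mul, add_zero]
  split_ifs with h
  · simp [h]
  · exact integral_cos_int_mul (sub_ne_zero.2 h)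

theorem setIntegral_angle_mul (f g : ℝ → ℝ) : ∫ z in angleDomain, f z.1 * g z.2
    = (∫ θ in Ioo 0 Real.pi, f θ) * ∫ φ in Ioo 0 (2 * Real.pi), g φ := by
  rw [angleDomain, Measure.volume_eq_prod]
  exact setIntegral_prod_mul f g _ _

/-- With `j` fixed the modes are orthogonal through their factors in `φ`; the constant is the bound
`π` for `∫ cos²` times `2π`. Nothing is summed over `j`, and the bound does not depend on it. -/
theorem sum_hcoef_sq_le {w : ℝ × ℝ → ℝ} (hw : MemLp w 2 weightedMeasure) (j : ℤ)
    (s : Finset ℤ) :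
    ∑ k ∈ s, hcoef w j k ^ 2
      ≤ 2 * Real.pi ^ 2 * ∫ z in angleDomain, w (Real.cos z.1, z.2) ^ 2 := by
  have hpi := Real.pi_pos
  have hprod : ∀ k m : ℤ, ∫ z in angleDomain,
      (Real.cos (j * z.1) * cas (k * z.2)) * (Real.cos (j * z.1) * cas (m * z.2))
      = (∫ θ in Ioo 0 Real.pi, Real.cos (j * θ) ^ 2) * (if k = m then 2 * Real.pi else 0) := by
    intro k m
    rw [← integral_cas_mul_cas, ← setIntegral_angle_mul]
    congr 1
    funext z
    ring
  refine sum_sq_integral_mul_le (memLp_angle_of_memLp hw) s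
    (fun k z => Real.cos (j * z.1) * cas (k * z.2)) (fun k => ?_) (fun k m hkm => ?_)
    (by positivity) (fun k => ?_)
  · exact MemLp.of_bound (continuous_cos_mul_cas j k).aestronglyMeasurable 2
      (Eventually.of_forall fun z => abs_cos_mul_cas_le _ _)
  · rw [hprod, if_neg hkm, mul_zero]
  · rw [hprod, if_pos rfl]
    have h1 : ∫ θ in Ioo 0 Real.pi, Real.cos (j * θ) ^ 2 ≤ Real.pi := by
      calc ∫ θ in Ioo 0 Real.pi, Real.cos (j * θ) ^ 2
          ≤ ∫ θ in Ioo 0 Real.pi, (1 : ℝ) := by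
            refine integral_mono_of_nonneg (Eventually.of_forall fun _ => sq_nonneg _)
              (integrable_const _) (Eventually.of_forall fun θ => ?_)
            exact Real.cos_sq_le_one _
        _ = Real.pi := by simp [hpi.le]
    nlinarith

/-! ### Decay of the coefficients -/

/-- Every weak derivative in `ρ` gains a factor `j` through `IsWeakDeriv.int_mul_hcoef_rho`. The
shift `j ↦ j ± 1` costs a constant only, and the uniformity in `j` of the induction hypothesis
absorbs it. -/
theorem exists_decay_rho {l : ℕ} {w : ℕ → ℕ → ℝ × ℝ → ℝ}
    (hw : ∀ k ≤ l, ∀ j ≤ l, PeriodicPhi (w k j) ∧ MemLp (w k j) 2 weightedMeasure)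
    (hρ : ∀ k ≤ l, ∀ j < l, IsWeakDeriv (1, 0) (w k j) (w k (j + 1)))
    {b : ℕ} (hb : b ≤ l) (i : ℕ) : ∀ a, a + i ≤ l → ∃ C, 0 ≤ C ∧ ∀ (j : ℤ) (s : Finset ℤ),
      (1 + |(j : ℝ)|) ^ (2 * i) * ∑ k ∈ s, hcoef (w b a) j k ^ 2 ≤ C := by
  induction i with
  | zero =>
    intro a ha
    refine ⟨2 * Real.pi ^ 2 * ∫ z in angleDomain, w b a (Real.cos z.1, z.2) ^ 2,
      mul_nonneg (by positivity) (integral_nonneg fun z => sq_nonneg _), fun j s => ?_⟩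
    rw [mul_zero, pow_zero, one_mul]
    exact sum_hcoef_sq_le (hw b hb a (by omega)).2 j s
  | succ i ih =>
    intro a ha
    obtain ⟨C, hC0, hC⟩ := ih (a + 1) (by omega)
    set C₀ := 2 * Real.pi ^ 2 * ∫ z in angleDomain, w b a (Real.cos z.1, z.2) ^ 2 with hC₀
    have hC₀0 : 0 ≤ C₀ := mul_nonneg (by positivity) (integral_nonneg fun z => sq_nonneg _)
    refine ⟨C₀ + 4 ^ (i + 1) * C, by positivity, fun j s => ?_⟩
    -- At `j = 0` the recursion is empty, but there the weight is one and Bessel's inequality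
    -- suffices.
    by_cases hj : j = 0
    · subst hj
      have := sum_hcoef_sq_le (hw b hb a (by omega)).2 0 s
      simp only [Int.cast_zero, abs_zero, add_zero, one_pow, one_mul]
      have h2 : 0 ≤ 4 ^ (i + 1) * C := by positivity
      linarith
    · have h1 : ∀ k, (j : ℝ) ^ 2 * hcoef (w b a) j k ^ 2
          ≤ (hcoef (w b (a + 1)) (j - 1) k ^ 2 + hcoef (w b (a + 1)) (j + 1) k ^ 2) / 2 := by
        intro k
        have h := (hρ b hb a (by omega)).int_mul_hcoef_rho (hw b hb a (by omega)).1
          (hw b hb (a + 1) (by omega)).1 (hw b hb a (by omega)).2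
          (hw b hb (a + 1) (by omega)).2 j k
        rw [← mul_pow, h]
        nlinarith [sq_nonneg (hcoef (w b (a + 1)) (j - 1) k + hcoef (w b (a + 1)) (j + 1) k)]
      have h2 : (j : ℝ) ^ 2 * ∑ k ∈ s, hcoef (w b a) j k ^ 2
          ≤ (∑ k ∈ s, hcoef (w b (a + 1)) (j - 1) k ^ 2
            + ∑ k ∈ s, hcoef (w b (a + 1)) (j + 1) k ^ 2) / 2 := by
        rw [Finset.mul_sum, ← Finset.sum_add_distrib, Finset.sum_div]
        exact Finset.sum_le_sum fun k _ => h1 k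
      have hj1 : (1 : ℝ) ≤ |(j : ℝ)| := by
        have : (1 : ℤ) ≤ |j| := Int.one_le_abs hj
        exact_mod_cast this
      have h3 : (1 + |(j : ℝ)|) ^ 2 ≤ 4 * (j : ℝ) ^ 2 := by
        rw [← sq_abs (j : ℝ)]
        nlinarith
      have h4 : ∀ j' : ℤ, |(j : ℝ) - j'| ≤ 1 →
          (1 + |(j : ℝ)|) ^ (2 * i) * ∑ k ∈ s, hcoef (w b (a + 1)) j' k ^ 2 ≤ 4 ^ i * C := by
        intro j' hjj
        have h5 : 1 + |(j : ℝ)| ≤ 2 * (1 + |(j' : ℝ)|) := by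
          have := abs_sub_abs_le_abs_sub (j : ℝ) j'
          have := abs_nonneg (j' : ℝ)
          linarith
        calc _ ≤ (2 * (1 + |(j' : ℝ)|)) ^ (2 * i) * ∑ k ∈ s, hcoef (w b (a + 1)) j' k ^ 2 := by
              gcongr
          _ = 4 ^ i * ((1 + |(j' : ℝ)|) ^ (2 * i) * ∑ k ∈ s, hcoef (w b (a + 1)) j' k ^ 2) := by
              rw [mul_pow, pow_mul 2]
              ring
          _ ≤ 4 ^ i * C := by
              gcongr
              exact hC j' s
      have h5 := h4 (j - 1) (by push_cast; simp)
      have h6 := h4 (j + 1) (by push_cast; simp)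
      have hS : 0 ≤ ∑ k ∈ s, hcoef (w b a) j k ^ 2 := Finset.sum_nonneg fun k _ => sq_nonneg _
      calc _ = (1 + |(j : ℝ)|) ^ (2 * i)
            * ((1 + |(j : ℝ)|) ^ 2 * ∑ k ∈ s, hcoef (w b a) j k ^ 2) := by
            rw [mul_add, pow_add, mul_one]
            ring
        _ ≤ (1 + |(j : ℝ)|) ^ (2 * i) * (4 * (j : ℝ) ^ 2 * ∑ k ∈ s, hcoef (w b a) j k ^ 2) := by
            gcongr
        _ = 4 * ((1 + |(j : ℝ)|) ^ (2 * i) * ((j : ℝ) ^ 2 * ∑ k ∈ s, hcoef (w b a) j k ^ 2)) := by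
            ring
        _ ≤ 4 * ((1 + |(j : ℝ)|) ^ (2 * i) * ((∑ k ∈ s, hcoef (w b (a + 1)) (j - 1) k ^ 2
            + ∑ k ∈ s, hcoef (w b (a + 1)) (j + 1) k ^ 2) / 2)) := by gcongr
        _ ≤ 4 ^ (i + 1) * C := by
            rw [pow_succ]
            linarith
        _ ≤ C₀ + 4 ^ (i + 1) * C := by linarith

/-- The base case spends all `l` derivatives in `ρ`; each derivative in `φ` then gains `k²` in the
sum of squares. It also reverses the sign of `k`, hence the quantification over all finite sets `s`,
which is stable under this reflection. -/
theorem exists_decay_phi {l : ℕ} {w : ℕ → ℕ → ℝ × ℝ → ℝ}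
    (hw : ∀ k ≤ l, ∀ j ≤ l, PeriodicPhi (w k j) ∧ MemLp (w k j) 2 weightedMeasure)
    (hφ : ∀ k < l, ∀ j ≤ l, IsWeakDeriv (0, 1) (w k j) (w (k + 1) j))
    (hρ : ∀ k ≤ l, ∀ j < l, IsWeakDeriv (1, 0) (w k j) (w k (j + 1))) (i : ℕ) :
    ∀ b, b + i ≤ l → ∃ C, 0 ≤ C ∧ ∀ (j : ℤ) (s : Finset ℤ),
      (1 + |(j : ℝ)|) ^ (2 * l) * ∑ k ∈ s, (k : ℝ) ^ (2 * i) * hcoef (w b 0) j k ^ 2 ≤ C := by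
  induction i with
  | zero =>
    intro b hb
    obtain ⟨C, hC0, hC⟩ := exists_decay_rho hw hρ (b := b) (by omega) l 0 (by omega)
    exact ⟨C, hC0, by simpa using hC⟩
  | succ i ih =>
    intro b hb
    obtain ⟨C, hC0, hC⟩ := ih (b + 1) (by omega)
    refine ⟨C, hC0, fun j s => le_of_eq_of_le ?_ (hC j (s.map (Equiv.neg ℤ).toEmbedding))⟩
    rw [Finset.sum_map]
    congr 1
    refine Finset.sum_congr rfl fun k _ => ?_
    have h := (hφ b (by omega) 0 (by omega)).int_mul_hcoef_phi (hw b (by omega) 0 (by omega)).1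
      (hw (b + 1) (by omega) 0 (by omega)).1 (hw b (by omega) 0 (by omega)).2
      (hw (b + 1) (by omega) 0 (by omega)).2 j k
    simp only [Equiv.coe_toEmbedding, Equiv.neg_apply, ← h]
    push_cast
    rw [mul_add, pow_add, (even_two_mul i).neg_pow]
    ring

/-- The Hartley-Chebyshev coefficients of a function in `H^l(Λ; H^l_ω(I))`. -/
theorem MemSobolev.exists_decay {l : ℕ} {v : ℝ × ℝ → ℝ} (hv : MemSobolev l l v) :
    ∃ C, 0 ≤ C ∧ ∀ (j : ℤ) (s : Finset ℤ),
      ∑ k ∈ s, ((1 + |(j : ℝ)|) ^ l * (1 + |(k : ℝ)|) ^ l * hcoef v j k) ^ 2 ≤ C := by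
  obtain ⟨w, rfl, hw, hφ, hρ⟩ := hv
  obtain ⟨C₁, hC₁0, hC₁⟩ := exists_decay_phi hw hφ hρ 0 0 (by omega)
  obtain ⟨C₂, hC₂0, hC₂⟩ := exists_decay_phi hw hφ hρ l 0 (by omega)
  refine ⟨4 ^ l * (C₁ + C₂), by positivity, fun j s => ?_⟩
  -- Only the orders `0` and `l` in `φ` are needed, since `1 + |k|` is at most twice the larger of
  -- `1` and `|k|`.
  have h1 : ∀ k : ℤ, (1 + |(k : ℝ)|) ^ (2 * l) ≤ 4 ^ l * (1 + (k : ℝ) ^ (2 * l)) := by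
    intro k
    have h2 : 1 + |(k : ℝ)| ≤ 2 * max 1 |(k : ℝ)| := by
      linarith [le_max_left 1 |(k : ℝ)|, le_max_right 1 |(k : ℝ)|]
    have h3 : max 1 |(k : ℝ)| ^ (2 * l) ≤ 1 + (k : ℝ) ^ (2 * l) := by
      rw [← (even_two_mul l).pow_abs (k : ℝ)]
      rcases max_choice 1 |(k : ℝ)| with h | h <;> rw [h]
      · simp
      · linarith
    calc _ ≤ (2 * max 1 |(k : ℝ)|) ^ (2 * l) := by gcongr
      _ = 4 ^ l * max 1 |(k : ℝ)| ^ (2 * l) := by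
        rw [mul_pow, pow_mul 2]
        norm_num
      _ ≤ _ := by gcongr
  calc _ = (1 + |(j : ℝ)|) ^ (2 * l)
        * ∑ k ∈ s, (1 + |(k : ℝ)|) ^ (2 * l) * hcoef (w 0 0) j k ^ 2 := by
        rw [Finset.mul_sum]
        exact Finset.sum_congr rfl fun k _ => by ring
    _ ≤ (1 + |(j : ℝ)|) ^ (2 * l)
        * ∑ k ∈ s, 4 ^ l * (1 + (k : ℝ) ^ (2 * l)) * hcoef (w 0 0) j k ^ 2 := by
        gcongr with k
        exact h1 k
    _ = 4 ^ l * ((1 + |(j : ℝ)|) ^ (2 * l)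
          * ∑ k ∈ s, (k : ℝ) ^ (2 * 0) * hcoef (w 0 0) j k ^ 2
        + (1 + |(j : ℝ)|) ^ (2 * l) * ∑ k ∈ s, (k : ℝ) ^ (2 * l) * hcoef (w 0 0) j k ^ 2) := by
        have : ∑ k ∈ s, 4 ^ l * (1 + (k : ℝ) ^ (2 * l)) * hcoef (w 0 0) j k ^ 2
            = 4 ^ l * (∑ k ∈ s, (k : ℝ) ^ (2 * 0) * hcoef (w 0 0) j k ^ 2
              + ∑ k ∈ s, (k : ℝ) ^ (2 * l) * hcoef (w 0 0) j k ^ 2) := by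
          rw [← Finset.sum_add_distrib, Finset.mul_sum]
          exact Finset.sum_congr rfl fun k _ => by ring
        rw [this]
        ring
    _ ≤ 4 ^ l * (C₁ + C₂) := by
        gcongr
        · exact hC₁ j s
        · exact hC₂ j s

/-! ### Expansion into Hartley-Chebyshev series -/

theorem hasSum_zero_of_odd {g : ℤ → ℝ} (hg : Summable g) (hodd : ∀ k, g (-k) = -g k) :
    HasSum g 0 := by
  have h1 : HasSum (g ∘ Equiv.neg ℤ) (∑' k, g k) := (Equiv.neg ℤ).hasSum_iff.2 hg.hasSum
  have h2 : g ∘ Equiv.neg ℤ = fun k => -g k := funext fun k => hodd k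
  rw [h2] at h1
  have h3 := h1.unique hg.hasSum.neg
  have h4 : ∑' k, g k = 0 := by linarith
  rw [← h4]
  exact hg.hasSum

/-- The real part of the complex Fourier series on the circle, which converges pointwise because its
coefficients `a k - i b k` are summable. -/
theorem hasSum_cos_add_sin {f : ℝ → ℝ} (hf : Continuous f)
    (hper : ∀ x, f (x + 2 * Real.pi) = f x) {a b : ℤ → ℝ}
    (ha : ∀ k : ℤ, a k = (∫ x in (0 : ℝ)..(2 * Real.pi), f x * Real.cos (k * x)) / (2 * Real.pi))
    (hb : ∀ k : ℤ, b k = (∫ x in (0 : ℝ)..(2 * Real.pi), f x * Real.sin (k * x)) / (2 * Real.pi))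
    (hsa : Summable a) (hsb : Summable b) (x : ℝ) :
    HasSum (fun k : ℤ => a k * Real.cos (k * x) + b k * Real.sin (k * x)) (f x) := by
  have hpi := Real.pi_pos
  have : Fact (0 < 2 * Real.pi) := ⟨by positivity⟩
  have hp : Function.Periodic (fun x => (f x : ℂ)) (2 * Real.pi) := fun x => by
    simp only [hper]
  set F : C(AddCircle (2 * Real.pi), ℂ) := ⟨hp.lift, by
    exact continuous_coinduced_dom.2 (Complex.continuous_ofReal.comp hf)⟩ with hF
  have hFx : ∀ x : ℝ, F (x : AddCircle (2 * Real.pi)) = f x := fun x => rfl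
  have hfour : ∀ (n : ℤ) (x : ℝ), fourier n (x : AddCircle (2 * Real.pi))
      = Real.cos (n * x) + Real.sin (n * x) * Complex.I := by
    intro n x
    rw [fourier_coe_apply]
    have : 2 * Real.pi * Complex.I * n * x / ((2 * Real.pi : ℝ) : ℂ)
        = ((n * x : ℝ) : ℂ) * Complex.I := by
      push_cast
      field_simp
    rw [this, Complex.exp_mul_I, ← Complex.ofReal_cos, ← Complex.ofReal_sin]
  have hco : ∀ k : ℤ, fourierCoeff F k = (a k : ℂ) - b k * Complex.I := by
    intro k
    rw [fourierCoeff_eq_intervalIntegral F k 0, zero_add, ha, hb]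
    have h1 : ∀ x : ℝ, (fourier (-k) (x : AddCircle (2 * Real.pi)) : ℂ) • F x
        = ((f x * Real.cos (k * x) : ℝ) : ℂ) - ((f x * Real.sin (k * x) : ℝ) : ℂ) * Complex.I := by
      intro x
      rw [hfour, hFx]
      push_cast
      rw [neg_mul, Complex.cos_neg, Complex.sin_neg, smul_eq_mul]
      ring
    simp only [h1]
    rw [intervalIntegral.integral_sub, intervalIntegral.integral_mul_const,
      intervalIntegral.integral_ofReal, intervalIntegral.integral_ofReal]
    · rw [Complex.real_smul]
      push_cast
      ring
    · exact Continuous.intervalIntegrable (by fun_prop) _ _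
    · exact Continuous.intervalIntegrable (by fun_prop) _ _
  have hs : Summable (fourierCoeff F) := by
    have : Summable fun k => (a k : ℂ) - b k * Complex.I :=
      (Complex.ofRealCLM.summable hsa).sub ((Complex.ofRealCLM.summable hsb).mul_right _)
    exact this.congr fun k => (hco k).symm
  have h2 := has_pointwise_sum_fourier_series_of_summable hs (x : AddCircle (2 * Real.pi))
  have h3 := Complex.reCLM.hasSum h2
  rw [hFx] at h3
  refine h3.congr_fun fun k => ?_
  rw [hco, hfour]
  have hre : ∀ p q c s : ℝ, Complex.reCLM (((p : ℂ) - q * Complex.I) • ((c : ℂ) + s * Complex.I))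
      = p * c + q * s := fun p q c s => by simp
  exact (hre _ _ _ _).symm

/-- The even and odd parts of `c` are the cosine and sine coefficients. The product `c k cas (kx)`
contains in addition the cross terms (even part times sine, odd part times cosine), which are odd in
`k` and sum to zero. -/
theorem hasSum_hartley {f : ℝ → ℝ} (hf : Continuous f)
    (hper : ∀ x, f (x + 2 * Real.pi) = f x) {c : ℤ → ℝ}
    (hc : ∀ k : ℤ, c k = (∫ x in (0 : ℝ)..(2 * Real.pi), f x * cas (k * x)) / (2 * Real.pi))
    (hs : Summable c) (x : ℝ) : HasSum (fun k : ℤ => c k * cas (k * x)) (f x) := by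
  have hcas := continuous_cas
  have hneg : Summable fun k => c (-k) := (Equiv.neg ℤ).summable_iff.2 hs
  have ha : ∀ k : ℤ, (c k + c (-k)) / 2
      = (∫ x in (0 : ℝ)..(2 * Real.pi), f x * Real.cos (k * x)) / (2 * Real.pi) := by
    intro k
    rw [hc, hc, ← add_div, ← intervalIntegral.integral_add
      (Continuous.intervalIntegrable (by fun_prop) _ _)
      (Continuous.intervalIntegrable (by fun_prop) _ _), div_right_comm,
      ← intervalIntegral.integral_div]
    congr 2
    funext x
    push_cast
    rw [cas, cas, neg_mul, Real.cos_neg, Real.sin_neg]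
    ring
  have hb : ∀ k : ℤ, (c k - c (-k)) / 2
      = (∫ x in (0 : ℝ)..(2 * Real.pi), f x * Real.sin (k * x)) / (2 * Real.pi) := by
    intro k
    rw [hc, hc, ← sub_div, ← intervalIntegral.integral_sub
      (Continuous.intervalIntegrable (by fun_prop) _ _)
      (Continuous.intervalIntegrable (by fun_prop) _ _), div_right_comm,
      ← intervalIntegral.integral_div]
    congr 2
    funext x
    push_cast
    rw [cas, cas, neg_mul, Real.cos_neg, Real.sin_neg]
    ring
  have h1 := hasSum_cos_add_sin hf hper ha hb ((hs.add hneg).div_const 2)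
    ((hs.sub hneg).div_const 2) x
  have hbdd : ∀ {c : ℤ → ℝ} {g : ℤ → ℝ}, Summable c → (∀ k, |g k| ≤ 1) →
      Summable fun k => c k * g k := by
    intro c g hc hg
    refine Summable.of_norm_bounded hc.norm fun k => ?_
    rw [norm_mul]
    exact mul_le_of_le_one_right (norm_nonneg _) (hg k)
  have h2 : HasSum (fun k : ℤ => (c k + c (-k)) / 2 * Real.sin (k * x)
      + (c k - c (-k)) / 2 * Real.cos (k * x)) 0 := by
    refine hasSum_zero_of_odd ?_ fun k => ?_
    · exact (hbdd ((hs.add hneg).div_const 2) fun k => Real.abs_sin_le_one _).add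
        (hbdd ((hs.sub hneg).div_const 2) fun k => Real.abs_cos_le_one _)
    · push_cast
      rw [neg_neg, neg_mul, Real.cos_neg, Real.sin_neg]
      ring
  have h3 := h1.add h2
  rw [add_zero] at h3
  refine h3.congr_fun fun k => ?_
  rw [cas]
  ring

/-- For even `f` the Hartley coefficients reduce to cosine integrals over half a period and are even
in `k`, so the sine terms of the Hartley series cancel in pairs. -/
theorem hasSum_cos_of_even {f : ℝ → ℝ} (hf : Continuous f)
    (hper : ∀ x, f (x + 2 * Real.pi) = f x) (heven : ∀ x, f (-x) = f x) {c : ℤ → ℝ}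
    (hc : ∀ k : ℤ, c k = (∫ x in (0 : ℝ)..Real.pi, f x * Real.cos (k * x)) / Real.pi)
    (hs : Summable c) (x : ℝ) : HasSum (fun k : ℤ => c k * Real.cos (k * x)) (f x) := by
  have hcas := continuous_cas
  have hpi := Real.pi_pos
  have h0 : ∀ k : ℤ, ∫ x in (0 : ℝ)..(2 * Real.pi), f x * cas (k * x)
      = 2 * ∫ x in (0 : ℝ)..Real.pi, f x * Real.cos (k * x) := by
    intro k
    have hp : Function.Periodic (fun x => f x * cas (k * x)) (2 * Real.pi) := fun x => by
      simp only [hper, cas_int_periodic]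
    have h1 := hp.intervalIntegral_add_eq 0 (-Real.pi)
    rw [zero_add, show -Real.pi + 2 * Real.pi = Real.pi by ring] at h1
    have hi : ∀ a b : ℝ, IntervalIntegrable (fun x => f x * cas (k * x)) volume a b :=
      fun a b => Continuous.intervalIntegrable (by fun_prop) _ _
    have h2 := intervalIntegral.integral_comp_neg (a := 0) (b := Real.pi)
      (fun x => f x * cas (k * x))
    rw [neg_zero] at h2
    rw [h1, ← intervalIntegral.integral_add_adjacent_intervals (hi (-Real.pi) 0) (hi 0 Real.pi),
      ← h2, ← intervalIntegral.integral_add (Continuous.intervalIntegrable (by fun_prop) _ _)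
        (hi 0 Real.pi), ← intervalIntegral.integral_const_mul]
    congr 1
    funext x
    rw [heven, cas, cas, mul_neg, Real.cos_neg, Real.sin_neg]
    ring
  have h1 := hasSum_hartley hf hper (c := c) (fun k => by rw [hc, h0]; field_simp) hs x
  have hneg : ∀ k, c (-k) = c k := fun k => by
    rw [hc, hc]
    congr 2
    funext x
    push_cast
    rw [neg_mul, Real.cos_neg]
  have h2 : HasSum (fun k : ℤ => c k * Real.sin (k * x)) 0 := by
    refine hasSum_zero_of_odd ?_ fun k => ?_
    · refine Summable.of_norm_bounded hs.norm fun k => ?_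
      rw [norm_mul]
      exact mul_le_of_le_one_right (norm_nonneg _) (Real.abs_sin_le_one _)
    · push_cast
      rw [hneg, neg_mul, Real.sin_neg]
      ring
  have h3 := h1.sub h2
  rw [sub_zero] at h3
  refine h3.congr_fun fun k => ?_
  rw [cas]
  ring

theorem continuous_angle_of_continuousOn {v : ℝ × ℝ → ℝ}
    (hv : ContinuousOn v (Icc (-1) 1 ×ˢ univ)) :
    Continuous fun z : ℝ × ℝ => v (Real.cos z.1, z.2) := by
  refine hv.comp_continuous (by fun_prop) fun z => ⟨?_, mem_univ _⟩
  exact ⟨Real.neg_one_le_cos _, Real.cos_le_one _⟩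

/-- Expansion in one variable after the other: the Hartley coefficients `u k θ` in `φ` are even in
`θ` and have a cosine series, and absolute summability of the double series identifies its sum with
the iterated one. The constant `2π²` is the product of the normalisations `π` and `2π`; it is not
doubled further because `j` runs over all of `ℤ`. -/
theorem hasSum_hcoef {v : ℝ × ℝ → ℝ} (hv : ContinuousOn v (Icc (-1) 1 ×ˢ univ))
    (hper : PeriodicPhi v) (hs : Summable fun p : ℤ × ℤ => hcoef v p.1 p.2) (θ φ : ℝ) :
    HasSum (fun p : ℤ × ℤ => hcoef v p.1 p.2 / (2 * Real.pi ^ 2)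
      * (Real.cos (p.1 * θ) * cas (p.2 * φ))) (v (Real.cos θ, φ)) := by
  have hpi := Real.pi_pos
  have hcas := continuous_cas
  have hV := continuous_angle_of_continuousOn hv
  set u : ℤ → ℝ → ℝ := fun k θ =>
    ∫ φ in (0 : ℝ)..(2 * Real.pi), v (Real.cos θ, φ) * cas (k * φ) with hu
  have huc : ∀ k, Continuous (u k) := by
    intro k
    refine intervalIntegral.continuous_parametric_intervalIntegral_of_continuous' ?_ _ _
    exact hV.mul (by fun_prop)
  have hint : ∀ j k : ℤ, ∫ θ in (0 : ℝ)..Real.pi, u k θ * Real.cos (j * θ) = hcoef v j k := by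
    intro j k
    have hci : IntegrableOn (fun z : ℝ × ℝ => v (Real.cos z.1, z.2)
        * (Real.cos (j * z.1) * cas (k * z.2))) angleDomain := by
      refine IntegrableOn.mono_set (t := Icc 0 Real.pi ×ˢ Icc 0 (2 * Real.pi)) ?_
        (prod_mono Ioo_subset_Icc_self Ioo_subset_Icc_self)
      exact (hV.mul (continuous_cos_mul_cas j k)).continuousOn.integrableOn_compact
        (isCompact_Icc.prod isCompact_Icc)
    rw [hcoef, angleDomain, Measure.volume_eq_prod]
    rw [angleDomain, Measure.volume_eq_prod] at hci
    rw [setIntegral_prod _ hci, intervalIntegral.integral_of_le hpi.le,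
      integral_Ioc_eq_integral_Ioo]
    refine setIntegral_congr_fun measurableSet_Ioo fun θ _ => ?_
    simp only [hu]
    rw [← intervalIntegral.integral_mul_const, intervalIntegral.integral_of_le (by positivity),
      integral_Ioc_eq_integral_Ioo]
    congr 1
    funext φ
    ring
  have hsw : Summable fun p : ℤ × ℤ => hcoef v p.2 p.1 :=
    (Equiv.prodComm ℤ ℤ).summable_iff.2 hs
  have hk : ∀ k, HasSum (fun j : ℤ => hcoef v j k / Real.pi * Real.cos (j * θ)) (u k θ) := by
    intro k
    refine hasSum_cos_of_even (huc k) (fun x => ?_) (fun x => ?_) (fun j => ?_) ?_ θ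
    · simp only [hu, Real.cos_add_two_pi]
    · simp only [hu, Real.cos_neg]
    · rw [hint]
    · exact (hsw.prod_factor k).div_const _
  have hbdd : ∀ g : ℤ × ℤ → ℝ, (∀ p, |g p| ≤ 2) →
      Summable fun p : ℤ × ℤ => hcoef v p.2 p.1 / (2 * Real.pi ^ 2) * g p := by
    intro g hg
    refine Summable.of_norm_bounded ((hsw.norm.div_const (2 * Real.pi ^ 2)).mul_right 2)
      fun p => ?_
    rw [norm_mul, norm_div, Real.norm_of_nonneg (by positivity : 0 ≤ 2 * Real.pi ^ 2)]
    gcongr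
    exact hg p
  have hk' : ∀ (k : ℤ) (t : ℝ), HasSum (fun j : ℤ => hcoef v j k / (2 * Real.pi ^ 2)
      * (Real.cos (j * θ) * t)) (u k θ / (2 * Real.pi) * t) := by
    intro k t
    refine (((hk k).div_const (2 * Real.pi)).mul_right t).congr_fun fun j => ?_
    field_simp
  have hsu : Summable fun k => u k θ / (2 * Real.pi) := by
    have h1 := (hbdd (fun p => Real.cos (p.2 * θ) * 1) fun p => by
      rw [mul_one]; linarith [Real.abs_cos_le_one (p.2 * θ)]).hasSum
    have h2 := (h1.prod_fiberwise fun k => hk' k 1).summable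
    simpa using h2
  have h1 := hasSum_hartley (f := fun φ => v (Real.cos θ, φ)) (hV.comp (by fun_prop : Continuous
    fun φ : ℝ => (θ, φ))) (fun φ => hper _ ⟨Real.neg_one_le_cos _, Real.cos_le_one _⟩ φ)
    (fun k => rfl) hsu φ
  have h2 := (hbdd (fun p => Real.cos (p.2 * θ) * cas (p.1 * φ)) fun p =>
    abs_cos_mul_cas_le _ _).hasSum
  have h3 := h2.prod_fiberwise fun k => hk' k (cas (k * φ))
  rw [h3.unique h1] at h2
  exact (Equiv.prodComm ℤ ℤ).hasSum_iff.1 h2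

/-! ### Aliasing -/

/-- The representative in `[-m, m)` of the class of `k` modulo `2m`. -/
def centeredMod (m : ℕ) (k : ℤ) : ℤ := (k + m) % (2 * m) - m

theorem centeredMod_mem {m : ℕ} (hm : 0 < m) (k : ℤ) :
    -(m : ℤ) ≤ centeredMod m k ∧ centeredMod m k < m := by
  have h1 := Int.emod_nonneg (k + m) (b := 2 * m) (by omega)
  have h2 := Int.emod_lt_of_pos (k + m) (b := 2 * m) (by omega)
  unfold centeredMod
  omega

theorem exists_eq_centeredMod_add (m : ℕ) (k : ℤ) : ∃ t : ℤ, k = centeredMod m k + 2 * m * t := by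
  refine ⟨(k + m) / (2 * m), ?_⟩
  have := Int.emod_add_mul_ediv (k + m) (2 * m)
  unfold centeredMod
  linarith

theorem centeredMod_eq_self {m : ℕ} {k : ℤ} (h1 : -(m : ℤ) ≤ k) (h2 : k < m) :
    centeredMod m k = k := by
  rw [centeredMod, Int.emod_eq_of_lt (by omega) (by omega)]
  ring

theorem centeredMod_add_mul {m : ℕ} {b : ℤ} (h1 : -(m : ℤ) ≤ b) (h2 : b < m) (t : ℤ) :
    centeredMod m (b + 2 * m * t) = b := by
  have : b + 2 * m * t + m = b + m + 2 * m * t := by ring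
  rw [centeredMod, this, Int.add_mul_emod_self_left, ← centeredMod, centeredMod_eq_self h1 h2]

/-- An alias never has a larger frequency than the mode it replaces, so every bound by powers of the
frequency passes to aliases. -/
theorem abs_centeredMod_le_abs {m : ℕ} (hm : 0 < m) (k : ℤ) : |centeredMod m k| ≤ |k| := by
  have h := centeredMod_mem hm k
  by_cases hk : -(m : ℤ) ≤ k ∧ k < m
  · rw [centeredMod_eq_self hk.1 hk.2]
  · have h1 : |centeredMod m k| ≤ m := abs_le.2 ⟨h.1, h.2.le⟩
    refine h1.trans ?_
    rw [not_and_or] at hk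
    rcases hk with hk | hk
    · exact le_trans (by omega) (neg_le_abs k)
    · exact le_trans (by omega) (le_abs_self k)

/-- The trigonometric polynomial that agrees with `cas (b φ)` at the nodes `nπ/q`, for
`-q ≤ b < q`. -/
def aliasCas (q : ℕ) (b : ℤ) (φ : ℝ) : ℝ := if b = -q then Real.cos (q * φ) else cas (b * φ)

/-- The derivative of `aliasCas q b`. -/
def aliasCasDeriv (q : ℕ) (b : ℤ) (φ : ℝ) : ℝ :=
  if b = -q then -q * Real.sin (q * φ) else b * cas (-b * φ)

theorem hasDerivAt_cos_mul (k x : ℝ) :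
    HasDerivAt (fun x => Real.cos (k * x)) (-k * Real.sin (k * x)) x := by
  have h : HasDerivAt (fun x : ℝ => k * x) k x := by
    simpa using (hasDerivAt_id x).const_mul k
  refine h.cos.congr_deriv ?_
  ring

theorem hasDerivAt_aliasCas (q : ℕ) (b : ℤ) (φ : ℝ) :
    HasDerivAt (aliasCas q b) (aliasCasDeriv q b φ) φ := by
  by_cases hb : b = -q
  · have h1 : aliasCas q b = fun φ => Real.cos (q * φ) := funext fun φ => if_pos hb
    rw [h1, aliasCasDeriv, if_pos hb]
    exact hasDerivAt_cos_mul q φ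
  · have h1 : aliasCas q b = fun φ => cas (b * φ) := funext fun φ => if_neg hb
    rw [h1, aliasCasDeriv, if_neg hb]
    exact hasDerivAt_cas b φ

theorem continuous_aliasCas (q : ℕ) (b : ℤ) : Continuous (aliasCas q b) :=
  continuous_iff_continuousAt.2 fun φ => (hasDerivAt_aliasCas q b φ).continuousAt

theorem continuous_aliasCasDeriv (q : ℕ) (b : ℤ) : Continuous (aliasCasDeriv q b) := by
  have := continuous_cas
  unfold aliasCasDeriv
  split_ifs <;> fun_prop

theorem abs_aliasCas_le (q : ℕ) (b : ℤ) (φ : ℝ) : |aliasCas q b φ| ≤ 2 := by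
  unfold aliasCas
  split_ifs
  · linarith [Real.abs_cos_le_one (q * φ)]
  · exact abs_cas_le _

theorem abs_aliasCasDeriv_le (q : ℕ) (b : ℤ) (φ : ℝ) : |aliasCasDeriv q b φ| ≤ 2 * |(b : ℝ)| := by
  unfold aliasCasDeriv
  split_ifs with h
  · rw [abs_mul, abs_neg, h]
    push_cast
    rw [abs_neg]
    nlinarith [Real.abs_sin_le_one (q * φ), abs_nonneg (q : ℝ), abs_nonneg (Real.sin (q * φ))]
  · rw [abs_mul, mul_comm]
    exact mul_le_mul_of_nonneg_right (abs_cas_le _) (abs_nonneg _)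

/-- At the nodes only the class of `k` modulo `2q` matters. For the representative `-q` the sine
part vanishes at all nodes and is absent from the interpolation space, so only the cosine is kept.
-/
theorem cas_phiNode {q : ℕ} (hq : 0 < q) (k : ℤ) (n : ℕ) :
    cas (k * phiNode (2 * q) n) = aliasCas q (centeredMod q k) (phiNode (2 * q) n) := by
  obtain ⟨t, ht⟩ := exists_eq_centeredMod_add q k
  have hq' : (q : ℝ) ≠ 0 := by exact_mod_cast hq.ne'
  set b := centeredMod q k with hb
  have h1 : (k : ℝ) * phiNode (2 * q) n
      = b * phiNode (2 * q) n + ((t * n : ℤ) : ℝ) * (2 * Real.pi) := by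
    rw [ht, phiNode]
    push_cast
    field_simp
  have h2 : cas (k * phiNode (2 * q) n) = cas (b * phiNode (2 * q) n) := by
    rw [h1, cas, Real.cos_add_int_mul_two_pi, Real.sin_add_int_mul_two_pi, cas]
  rw [h2, aliasCas]
  split_ifs with h
  · have h3 : (q : ℝ) * phiNode (2 * q) n = n * Real.pi := by
      rw [phiNode]
      push_cast
      field_simp
    rw [h]
    push_cast
    rw [cas, neg_mul, Real.cos_neg, Real.sin_neg, h3, Real.sin_nat_mul_pi]
    simp
  · rfl

/-- At the nodes `T_j` is `cos (j m π / M)`, which depends on `j` modulo `2M` only. A negative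
representative is admissible because `T_{-a} = T_a`. -/
theorem T_rhoNode {M : ℕ} (hM : 0 < M) (j : ℤ) (m : ℕ) :
    (Polynomial.Chebyshev.T ℝ j).eval (rhoNode M m)
      = (Polynomial.Chebyshev.T ℝ (centeredMod M j)).eval (rhoNode M m) := by
  obtain ⟨t, ht⟩ := exists_eq_centeredMod_add M j
  have hM' : (M : ℝ) ≠ 0 := by exact_mod_cast hM.ne'
  set b := centeredMod M j with hb
  rw [rhoNode, Polynomial.Chebyshev.T_real_cos, Polynomial.Chebyshev.T_real_cos]
  have h1 : (j : ℝ) * (m * Real.pi / M)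
      = b * (m * Real.pi / M) + ((t * m : ℤ) : ℝ) * (2 * Real.pi) := by
    rw [ht]
    push_cast
    field_simp
  rw [h1, Real.cos_add_int_mul_two_pi]

/-! ### Fourier-Chebyshev polynomials -/

theorem exists_trigPoly_eq_aliasCas {q : ℕ} {b : ℤ} (h1 : -(q : ℤ) ≤ b) (h2 : b < q) :
    ∃ α β : ℕ → ℝ, ∀ φ, trigPoly (2 * q) α β φ = aliasCas q b φ := by
  have hq : 2 * q / 2 = q := by omega
  by_cases hb : b = -q
  · refine ⟨Pi.single q 1, 0, fun φ => ?_⟩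
    rw [trigPoly, aliasCas, if_pos hb, hq, Finset.sum_eq_single q]
    · simp
    · intro k _ hk
      simp [Pi.single_eq_of_ne hk]
    · simp
  -- `cas (bφ)` is `cos (|b|φ)` plus the sign of `b` times `sin (|b|φ)`. For `b = 0` the sign is
  -- zero, and the index `0` lies outside the sine range as well.
  · refine ⟨Pi.single b.natAbs 1, Pi.single b.natAbs (b.sign : ℝ), fun φ => ?_⟩
    have hlt : b.natAbs < q := by omega
    rw [trigPoly, aliasCas, if_neg hb, hq, Finset.sum_eq_single b.natAbs]
    · have hs : ∑ k ∈ Finset.Ico 1 q, (Pi.single b.natAbs (b.sign : ℝ) : ℕ → ℝ) k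
          * Real.sin (k * φ) = Real.sin (b * φ) := by
        by_cases hb0 : b = 0
        · subst hb0
          simp
        · rw [Finset.sum_eq_single b.natAbs]
          · rcases Int.natAbs_eq b with h | h
            · rw [Int.sign_eq_one_of_pos (by omega)]
              simp [Nat.cast_natAbs, abs_of_pos (show 0 < b by omega)]
            · rw [Int.sign_eq_neg_one_of_neg (by omega)]
              simp [Nat.cast_natAbs, abs_of_neg (show b < 0 by omega), Real.sin_neg]
          · intro k _ hk
            simp [Pi.single_eq_of_ne hk]
          · intro h
            exact absurd (Finset.mem_Ico.2 ⟨by omega, hlt⟩) h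
      rw [hs, cas]
      rcases abs_choice b with h | h
      · simp [Nat.cast_natAbs, h]
      · simp [Nat.cast_natAbs, h, Real.cos_neg]
    · intro k _ hk
      simp [Pi.single_eq_of_ne hk]
    · intro h
      exact absurd (Finset.mem_range.2 (by omega)) h

theorem isFourierChebyshev_mode {M q : ℕ} {a b : ℤ} (ha : |a| ≤ M) (h1 : -(q : ℤ) ≤ b)
    (h2 : b < q) : IsFourierChebyshev M (2 * q) fun z =>
      (Polynomial.Chebyshev.T ℝ a).eval z.1 * aliasCas q b z.2 := by
  obtain ⟨α, β, h⟩ := exists_trigPoly_eq_aliasCas h1 h2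
  rw [Int.abs_eq_natAbs] at ha
  refine ⟨fun k j => if j = a.natAbs then α k else 0,
    fun k j => if j = a.natAbs then β k else 0, fun z => ?_⟩
  rw [Finset.sum_eq_single a.natAbs]
  · simp only [if_true, h]
    rw [mul_comm, Polynomial.Chebyshev.T_natAbs]
  · intro j _ hj
    simp [trigPoly, hj]
  · intro h
    exact absurd (Finset.mem_range.2 (by omega)) h

theorem IsFourierChebyshev.sum {M N : ℕ} {ι : Type*} (s : Finset ι) (c : ι → ℝ)
    (f : ι → ℝ × ℝ → ℝ) (h : ∀ i ∈ s, IsFourierChebyshev M N (f i)) :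
    IsFourierChebyshev M N fun z => ∑ i ∈ s, c i * f i z := by
  classical
  induction s using Finset.induction_on with
  | empty => exact ⟨0, 0, fun z => by simp [trigPoly]⟩
  | insert i s hi ih =>
    obtain ⟨α, β, h1⟩ := ih fun k hk => h k (Finset.mem_insert_of_mem hk)
    obtain ⟨α', β', h2⟩ := h i (Finset.mem_insert_self i s)
    refine ⟨fun k j => c i * α' k j + α k j, fun k j => c i * β' k j + β k j, fun z => ?_⟩
    simp only [Finset.sum_insert hi, h1, h2]
    rw [Finset.mul_sum, ← Finset.sum_add_distrib]
    refine Finset.sum_congr rfl fun j _ => ?_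
    simp only [trigPoly, add_mul, Finset.sum_add_distrib, mul_assoc, mul_add, Finset.mul_sum,
      Finset.sum_mul]
    ring

theorem IsFourierChebyshev.contDiff {M N : ℕ} {w : ℝ × ℝ → ℝ} (h : IsFourierChebyshev M N w) :
    ContDiff ℝ 1 w := by
  obtain ⟨α, β, h⟩ := h
  rw [show w = _ from funext h]
  refine ContDiff.sum fun j _ => ContDiff.mul ?_ ?_
  · unfold trigPoly
    refine ContDiff.add (ContDiff.sum fun k _ => ?_) (ContDiff.sum fun k _ => ?_)
    · exact contDiff_const.mul (Real.contDiff_cos.comp (contDiff_const.mul contDiff_snd))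
    · exact contDiff_const.mul (Real.contDiff_sin.comp (contDiff_const.mul contDiff_snd))
  · exact ((contDiff_eval _).of_le (by exact_mod_cast le_top)).comp contDiff_fst

/-- The interpolant of a Hartley-Chebyshev series is the series of the aliases. -/
theorem interp_eq_tsum {M q : ℕ} (hM : 0 < M) (hq : 0 < q) {v : ℝ × ℝ → ℝ} {c : ℤ × ℤ → ℝ}
    (hc : Summable c) (hv : ∀ θ φ, HasSum (fun p : ℤ × ℤ =>
      c p * (Real.cos (p.1 * θ) * cas (p.2 * φ))) (v (Real.cos θ, φ))) (z : ℝ × ℝ) :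
    HasSum (fun p : ℤ × ℤ => c p * ((Polynomial.Chebyshev.T ℝ (centeredMod M p.1)).eval z.1
      * aliasCas q (centeredMod q p.2) z.2)) (interp M (2 * q) v z) := by
  classical
  set B : Finset (ℤ × ℤ) := Finset.Ico (-(M : ℤ)) M ×ˢ Finset.Ico (-(q : ℤ)) q with hB
  set r : ℤ × ℤ → ℤ × ℤ := fun p => (centeredMod M p.1, centeredMod q p.2) with hr
  set f : ℤ × ℤ → ℝ × ℝ → ℝ := fun a z =>
    (Polynomial.Chebyshev.T ℝ a.1).eval z.1 * aliasCas q a.2 z.2 with hf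
  have hrB : ∀ p, r p ∈ B := fun p => by
    have h1 := centeredMod_mem hM p.1
    have h2 := centeredMod_mem hq p.2
    simp only [hB, hr, Finset.mem_product, Finset.mem_Ico]
    exact ⟨h1, h2⟩
  -- `C a` collects the coefficients of all frequencies with alias `a`. The resulting finite sum
  -- lies in the interpolation space and matches `v` at the nodes, so uniqueness makes it the
  -- interpolant.
  set C : ℤ × ℤ → ℝ := fun a => ∑' p, if r p = a then c p else 0 with hC
  have hCs : ∀ a, HasSum (fun p => if r p = a then c p else 0) (C a) := fun a => by
    refine Summable.hasSum (Summable.of_norm_bounded hc.norm fun p => ?_)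
    split_ifs
    · exact le_rfl
    · simp
  have hsum : ∀ z, HasSum (fun p => c p * f (r p) z) (∑ a ∈ B, C a * f a z) := by
    intro z
    refine (hasSum_sum fun a _ => (hCs a).mul_right (f a z)).congr_fun fun p => ?_
    rw [Finset.sum_eq_single (r p)]
    · simp
    · intro a _ ha
      simp [ha.symm]
    · exact fun h => absurd (hrB p) h
  have hint : IsInterpolant M (2 * q) v fun z => ∑ a ∈ B, C a * f a z := by
    refine ⟨IsFourierChebyshev.sum B C f fun a ha => ?_, fun m hm n hn => ?_⟩
    · simp only [hB, Finset.mem_product, Finset.mem_Ico] at ha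
      exact isFourierChebyshev_mode (abs_le.2 ⟨ha.1.1, ha.1.2.le⟩) ha.2.1 ha.2.2
    · have h1 := hv (m * Real.pi / M) (phiNode (2 * q) n)
      refine (hsum _).unique (h1.congr_fun fun p => ?_)
      simp only [hf, hr]
      rw [← cas_phiNode hq, ← T_rhoNode hM, rhoNode, Polynomial.Chebyshev.T_real_cos]
  rw [← congrFun (eq_interp hM (by omega) (even_two_mul q) hint) z]
  exact hsum z

/-! ### Polynomial weights -/

/-- The weight `(1 + |j|)^(-s)`. -/
def weight (s : ℕ) (j : ℤ) : ℝ := ((1 + |(j : ℝ)|) ^ s)⁻¹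

theorem one_add_abs_pos (j : ℤ) : 0 < 1 + |(j : ℝ)| := by positivity

theorem weight_pos (s : ℕ) (j : ℤ) : 0 < weight s j := by
  have := one_add_abs_pos j
  unfold weight
  positivity

theorem weight_add (s t : ℕ) (j : ℤ) : weight (s + t) j = weight s j * weight t j := by
  rw [weight, weight, weight, pow_add, mul_inv]

theorem pow_mul_weight_add (s t : ℕ) (j : ℤ) :
    (1 + |(j : ℝ)|) ^ t * weight (s + t) j = weight s j := by
  have := one_add_abs_pos j
  rw [weight_add, mul_comm, mul_assoc, weight, weight, inv_mul_cancel₀ (by positivity), mul_one]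

theorem weight_neg (s : ℕ) (j : ℤ) : weight s (-j) = weight s j := by
  simp [weight]

theorem summable_weight {s : ℕ} (hs : 2 ≤ s) : Summable (weight s) := by
  have h : Summable fun n : ℕ => weight s n := by
    have h1 := (summable_nat_add_iff 1).2 (Real.summable_nat_pow_inv.2 hs)
    refine h1.congr fun n => ?_
    simp [weight, add_comm]
  exact Summable.of_nat_of_neg h (by simpa only [weight_neg] using h)

theorem tsum_weight_nonneg (s : ℕ) : 0 ≤ ∑' j, weight s j := tsum_nonneg fun j => (weight_pos s j).le

/-- Telescoping: `1/(n+1)² ≤ 1/n - 1/(n+1)` gives `1/M` for each sign of `j`. -/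
theorem tsum_weight_tail_le {M : ℕ} (hM : 0 < M) :
    ∑' j : ℤ, (if (M : ℤ) ≤ |j| then weight 2 j else 0) ≤ 2 / M := by
  set f : ℤ → ℝ := fun j => if (M : ℤ) ≤ |j| then weight 2 j else 0 with hf
  have hf0 : ∀ j, 0 ≤ f j := fun j => by
    simp only [hf]
    split_ifs
    · exact (weight_pos 2 j).le
    · exact le_rfl
  have hM' : (0 : ℝ) < M := by exact_mod_cast hM
  have hsum : ∀ K, ∑ n ∈ Finset.range (M + K), f n ≤ 1 / M - 1 / ((M + K : ℕ) : ℝ) := by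
    intro K
    induction K with
    | zero =>
      rw [add_zero, sub_self, Finset.sum_eq_zero fun n hn => ?_]
      have := Finset.mem_range.1 hn
      simp only [hf, Nat.abs_cast]
      rw [if_neg (by omega)]
    | succ K ih =>
      rw [← add_assoc, Finset.sum_range_succ]
      have h1 : f (M + K : ℕ) = ((1 + ((M + K : ℕ) : ℝ)) ^ 2)⁻¹ := by
        simp only [hf, Nat.abs_cast]
        rw [if_pos (by omega), weight, Int.cast_natCast, Nat.abs_cast]
      have h2 : (0 : ℝ) < ((M + K : ℕ) : ℝ) := by exact_mod_cast (by omega : 0 < M + K)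
      have h3 : ((1 + ((M + K : ℕ) : ℝ)) ^ 2)⁻¹ ≤ 1 / ((M + K : ℕ) : ℝ) - 1 / ((M + K + 1 : ℕ) : ℝ) := by
        have h4 : ((M + K + 1 : ℕ) : ℝ) = (M + K : ℕ) + 1 := by push_cast; ring
        rw [h4]
        set x : ℝ := ((M + K : ℕ) : ℝ) with hx
        have h5 : 1 / x - 1 / (x + 1) = (x * (x + 1))⁻¹ := by
          field_simp
          ring
        rw [h5]
        gcongr
        nlinarith
      rw [h1]
      linarith
  have hle : ∀ K, ∑ n ∈ Finset.range K, f n ≤ 1 / M := by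
    intro K
    refine (Finset.sum_le_sum_of_subset_of_nonneg (Finset.range_mono (Nat.le_add_left K M))
      fun n _ _ => hf0 n).trans ((hsum K).trans ?_)
    have : (0 : ℝ) ≤ 1 / ((M + K : ℕ) : ℝ) := by positivity
    linarith
  have hs : Summable fun n : ℕ => f n := summable_of_sum_range_le (fun n => hf0 n) hle
  have hneg : ∀ j, f (-j) = f j := fun j => by simp only [hf, abs_neg, weight_neg]
  have hs' : Summable fun n : ℕ => f (-n) := by simpa only [hneg] using hs
  have h0 := (HasSum.of_nat_of_neg hs.hasSum hs'.hasSum).tsum_eq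
  simp only [hneg] at h0
  have h1 := Real.tsum_le_of_sum_range_le (fun n => hf0 (n : ℕ)) hle
  have h2 := hf0 0
  have h3 : (2 : ℝ) / M = 1 / M + 1 / M := by ring
  linarith

/-! ### Sequences with the decay of Sobolev coefficients -/

/-- Decay of a double sequence: uniform in `j`, square summable in `k`. -/
structure CoefDecay (l : ℕ) (A : ℝ) (c : ℤ × ℤ → ℝ) : Prop where
  pos : 0 < A
  sum_le : ∀ (j : ℤ) (s : Finset ℤ),
    ∑ k ∈ s, ((1 + |(j : ℝ)|) ^ l * (1 + |(k : ℝ)|) ^ l * c (j, k)) ^ 2 ≤ A ^ 2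

theorem CoefDecay.abs_le {l : ℕ} {A : ℝ} {c : ℤ × ℤ → ℝ} (hc : CoefDecay l A c) (p : ℤ × ℤ) :
    |c p| ≤ A * (weight l p.1 * weight l p.2) := by
  have h1 := hc.sum_le p.1 {p.2}
  rw [Finset.sum_singleton] at h1
  have h3 := one_add_abs_pos p.1
  have h4 := one_add_abs_pos p.2
  have h5 : |(1 + |(p.1 : ℝ)|) ^ l * (1 + |(p.2 : ℝ)|) ^ l * c (p.1, p.2)| ≤ A := abs_le_of_sq_le_sq h1 hc.pos.le
  rw [abs_mul, abs_of_pos (by positivity)] at h5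
  rw [weight, weight, ← mul_inv, ← div_eq_mul_inv, le_div_iff₀ (by positivity), mul_comm]
  exact h5

theorem summable_weight_mul_weight {s t : ℕ} (hs : 2 ≤ s) (ht : 2 ≤ t) :
    Summable fun p : ℤ × ℤ => weight s p.1 * weight t p.2 :=
  (summable_weight hs).mul_of_nonneg (summable_weight ht) (fun j => (weight_pos s j).le)
    fun j => (weight_pos t j).le

theorem tsum_weight_mul_weight {s t : ℕ} (hs : 2 ≤ s) (ht : 2 ≤ t) :
    ∑' p : ℤ × ℤ, weight s p.1 * weight t p.2 = (∑' j, weight s j) * ∑' k, weight t k :=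
  ((summable_weight hs).tsum_mul_tsum (summable_weight ht)
    (summable_weight_mul_weight hs ht)).symm

theorem CoefDecay.mul_pow_le {l a b : ℕ} {A : ℝ} {c : ℤ × ℤ → ℝ} (hc : CoefDecay l A c)
    (ha : a ≤ l) (hb : b ≤ l) (p : ℤ × ℤ) :
    |c p| * ((1 + |(p.1 : ℝ)|) ^ a * (1 + |(p.2 : ℝ)|) ^ b)
      ≤ A * (weight (l - a) p.1 * weight (l - b) p.2) := by
  have h3 := one_add_abs_pos p.1
  have h4 := one_add_abs_pos p.2
  have h1 := pow_mul_weight_add (l - a) a p.1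
  have h2 := pow_mul_weight_add (l - b) b p.2
  rw [Nat.sub_add_cancel ha] at h1
  rw [Nat.sub_add_cancel hb] at h2
  rw [← h1, ← h2]
  calc _ ≤ A * (weight l p.1 * weight l p.2)
        * ((1 + |(p.1 : ℝ)|) ^ a * (1 + |(p.2 : ℝ)|) ^ b) := by
        gcongr
        exact hc.abs_le p
    _ = _ := by ring

theorem CoefDecay.summable_mul_pow {l a b : ℕ} {A : ℝ} {c : ℤ × ℤ → ℝ} (hc : CoefDecay l A c)
    (ha : a + 2 ≤ l) (hb : b + 2 ≤ l) :
    Summable fun p : ℤ × ℤ => |c p| * ((1 + |(p.1 : ℝ)|) ^ a * (1 + |(p.2 : ℝ)|) ^ b) := by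
  refine Summable.of_nonneg_of_le (fun p => ?_) (fun p => hc.mul_pow_le (by omega) (by omega) p)
    ((summable_weight_mul_weight (by omega) (by omega)).mul_left A)
  have h3 := one_add_abs_pos p.1
  have h4 := one_add_abs_pos p.2
  positivity

/-! ### Integrals of series -/

/-- With lower Lebesgue integrals the sum and the integral of the absolute values may be exchanged
without any summability of the integrands. -/
theorem integral_abs_tsum_le {α ι : Type*} [MeasurableSpace α] [Countable ι] {μ : Measure α}
    {F : ι → α → ℝ} (hF : ∀ i, Integrable (F i) μ)
    (hS : AEStronglyMeasurable (fun x => ∑' i, F i x) μ) {B : ι → ℝ}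
    (hB : ∀ i, ∫ x, |F i x| ∂μ ≤ B i) (hBs : Summable B) :
    ∫ x, |∑' i, F i x| ∂μ ≤ ∑' i, B i := by
  have hB0 : ∀ i, 0 ≤ B i := fun i => (integral_nonneg fun x => abs_nonneg _).trans (hB i)
  have h1 : ∫ x, |∑' i, F i x| ∂μ = (∫⁻ x, ‖∑' i, F i x‖ₑ ∂μ).toReal :=
    integral_norm_eq_lintegral_enorm hS
  rw [h1]
  refine ENNReal.toReal_le_of_le_ofReal (tsum_nonneg hB0) ?_
  calc ∫⁻ x, ‖∑' i, F i x‖ₑ ∂μ ≤ ∫⁻ x, ∑' i, ‖F i x‖ₑ ∂μ :=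
        lintegral_mono fun x => enorm_tsum_le_tsum_enorm
    _ = ∑' i, ∫⁻ x, ‖F i x‖ₑ ∂μ :=
        lintegral_tsum fun i => (hF i).aestronglyMeasurable.enorm
    _ ≤ ∑' i, ENNReal.ofReal (B i) := by
        refine ENNReal.tsum_le_tsum fun i => ?_
        rw [← ofReal_integral_norm_eq_lintegral_enorm (hF i)]
        exact ENNReal.ofReal_le_ofReal (hB i)
    _ = ENNReal.ofReal (∑' i, B i) := (ENNReal.ofReal_tsum_of_nonneg hB0 hBs).symm

/-! ### Blocks of frequencies -/

/-- The `i`-th frequency in the `m`-th block of length `2q`. -/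
def blockIndex (q : ℕ) (m : ℤ) (i : Fin (2 * q)) : ℤ := (i : ℕ) - q + 2 * q * m

theorem blockIndex_injective (q : ℕ) (m : ℤ) : Function.Injective (blockIndex q m) := by
  intro i i' h
  simp only [blockIndex] at h
  exact Fin.ext (by omega)

theorem centeredMod_blockIndex (q : ℕ) (m : ℤ) (i : Fin (2 * q)) :
    centeredMod q (blockIndex q m i) = (i : ℕ) - q := by
  have := i.2
  exact centeredMod_add_mul (by omega) (by omega) m

/-- Division by `2q` with centred remainder. The sum over frequencies can therefore be regrouped
into blocks in which each alias occurs exactly once. -/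
theorem blockIndex_bijective {q : ℕ} (hq : 0 < q) :
    Function.Bijective fun p : (ℤ × ℤ) × Fin (2 * q) => (p.1.1, blockIndex q p.1.2 p.2) := by
  constructor
  · rintro ⟨⟨j, m⟩, i⟩ ⟨⟨j', m'⟩, i'⟩ h
    simp only [Prod.mk.injEq] at h
    obtain ⟨rfl, h⟩ := h
    have h1 := centeredMod_blockIndex q m i
    rw [h, centeredMod_blockIndex] at h1
    have hi : i = i' := Fin.ext (by omega)
    subst hi
    simp only [blockIndex, add_right_inj] at h
    have h2 : m = m' := mul_left_cancel₀ (by omega : (2 * q : ℤ) ≠ 0) h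
    rw [h2]
  · rintro ⟨j, k⟩
    obtain ⟨m, hm⟩ := exists_eq_centeredMod_add q k
    have h := centeredMod_mem hq k
    refine ⟨((j, m), ⟨(centeredMod q k + q).toNat, by omega⟩), ?_⟩
    simp only [blockIndex, Prod.mk.injEq, true_and]
    rw [Int.toNat_of_nonneg (by omega)]
    conv_rhs => rw [hm]
    ring

/-- In a block with `m ≠ 0` every frequency has size at least `2q|m| - q`. The hypothesis matters
for the central block, where it leaves only the frequency `-q`. -/
theorem mul_one_add_abs_le_blockIndex {q : ℕ} {m : ℤ} {i : Fin (2 * q)}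
    (h : (q : ℤ) ≤ |blockIndex q m i|) :
    (q : ℝ) * (1 + |(m : ℝ)|) / 2 ≤ 1 + |(blockIndex q m i : ℝ)| := by
  have hi := i.2
  have key : (q : ℤ) * (1 + |m|) ≤ 2 * |blockIndex q m i| := by
    rcases eq_or_ne m 0 with rfl | hm
    · simp only [abs_zero, add_zero, mul_one]
      linarith [abs_nonneg (blockIndex q 0 i)]
    · have h1 : 1 ≤ |m| := Int.one_le_abs hm
      have h2 : 2 * q * |m| - q ≤ |blockIndex q m i| := by
        have h3 : |2 * (q : ℤ) * m| = 2 * q * |m| := by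
          rw [abs_mul, abs_of_nonneg (by positivity : (0 : ℤ) ≤ 2 * q)]
        have h4 := abs_sub_abs_le_abs_sub (2 * (q : ℤ) * m) (2 * q * m - blockIndex q m i)
        rw [sub_sub_cancel, h3] at h4
        have h5 : |2 * (q : ℤ) * m - blockIndex q m i| ≤ q := by
          unfold blockIndex
          rw [abs_le]
          omega
        omega
      have hq : (0 : ℤ) ≤ q := by positivity
      nlinarith
  have key' : (q : ℝ) * (1 + |(m : ℝ)|) ≤ 2 * |(blockIndex q m i : ℝ)| := by exact_mod_cast key
  linarith

/-- Functions `D k` that vanish for `|k| < q` and satisfy an almost orthogonality bound within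
each block of frequencies. -/
structure BlockBound (q : ℕ) (D : ℤ → ℝ → ℝ) : Prop where
  continuous : ∀ k, Continuous (D k)
  eq_zero : ∀ k : ℤ, |k| < (q : ℤ) → ∀ φ, D k φ = 0
  abs_le : ∀ (k : ℤ) (φ : ℝ), |D k φ| ≤ 4 * (1 + |(k : ℝ)|)
  integral_sq_le : ∀ (m : ℤ) (a : Fin (2 * q) → ℝ),
    ∫ φ in Ioo 0 (2 * Real.pi), (∑ i, a i * D (blockIndex q m i) φ) ^ 2
      ≤ 8 * Real.pi * ∑ i, a i ^ 2 * (1 + |(blockIndex q m i : ℝ)|) ^ 2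

theorem integrableOn_Ioo_of_continuous {f : ℝ → ℝ} (hf : Continuous f) (a b : ℝ) :
    IntegrableOn f (Ioo a b) :=
  hf.integrableOn_Icc.mono_set Ioo_subset_Icc_self

/-- From `|f| ≤ X/2 + f²/(2X)`; the two terms integrate to at most `πX` and `4πX`. -/
theorem integral_abs_le_of_integral_sq_le {f : ℝ → ℝ} (hf : Continuous f) {X : ℝ} (hX : 0 < X)
    (h : ∫ φ in Ioo 0 (2 * Real.pi), f φ ^ 2 ≤ 8 * Real.pi * X ^ 2) :
    ∫ φ in Ioo 0 (2 * Real.pi), |f φ| ≤ 5 * Real.pi * X := by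
  have hpi := Real.pi_pos
  calc ∫ φ in Ioo 0 (2 * Real.pi), |f φ|
      ≤ ∫ φ in Ioo 0 (2 * Real.pi), (X / 2 + 1 / (2 * X) * f φ ^ 2) := by
        refine setIntegral_mono (integrableOn_Ioo_of_continuous hf.abs _ _)
          (integrableOn_Ioo_of_continuous (by fun_prop) _ _) fun φ => ?_
        have h1 : X / 2 + 1 / (2 * X) * f φ ^ 2 - |f φ| = (X - |f φ|) ^ 2 / (2 * X) := by
          rw [← sq_abs (f φ)]
          field_simp
          ring
        have h2 : 0 ≤ (X - |f φ|) ^ 2 / (2 * X) := by positivity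
        simp only
        linarith
    _ = Real.pi * X + 1 / (2 * X) * ∫ φ in Ioo 0 (2 * Real.pi), f φ ^ 2 := by
        rw [integral_add (integrableOn_Ioo_of_continuous (by fun_prop) _ _)
          (integrableOn_Ioo_of_continuous (by fun_prop) _ _), integral_const_mul]
        simp [hpi.le]
        ring
    _ ≤ Real.pi * X + 1 / (2 * X) * (8 * Real.pi * X ^ 2) := by gcongr
    _ = 5 * Real.pi * X := by
        field_simp
        norm_num

theorem integrableOn_angle_of_continuous {f : ℝ × ℝ → ℝ} (hf : Continuous f) :
    IntegrableOn f angleDomain := by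
  refine IntegrableOn.mono_set (t := Icc 0 Real.pi ×ˢ Icc 0 (2 * Real.pi)) ?_
    (prod_mono Ioo_subset_Icc_self Ioo_subset_Icc_self)
  exact hf.continuousOn.integrableOn_compact (isCompact_Icc.prod isCompact_Icc)

/-- This is where the rate `1 - l` arises. Almost orthogonality turns the square summability of the
weighted coefficients into an `L²` bound for the block, with the largest value of `(1+|k|)^(1-l)` as
a factor; for the frequencies that count it is at most a multiple of `q^(1-l) (1+|m|)^(1-l)`. A
termwise estimate in `k` would lose a further power of `q`. -/
theorem CoefDecay.integral_block_le {l : ℕ} {A : ℝ} {c : ℤ × ℤ → ℝ} (hc : CoefDecay l A c)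
    (hl : 1 ≤ l) {q : ℕ} (hq : 0 < q) {D : ℤ → ℝ → ℝ} (hD : BlockBound q D) (j m : ℤ) :
    ∫ φ in Ioo 0 (2 * Real.pi), |∑ i, c (j, blockIndex q m i) * D (blockIndex q m i) φ|
      ≤ 5 * Real.pi * (A * weight l j * (2 ^ (l - 1) * ((q : ℝ) ^ (l - 1))⁻¹ * weight (l - 1) m)) := by
  have hpi := Real.pi_pos
  have hA := hc.pos
  have hq' : (0 : ℝ) < q := by exact_mod_cast hq
  have hwj := weight_pos l j
  have hwm := weight_pos (l - 1) m
  set Y : ℝ := 2 ^ (l - 1) * ((q : ℝ) ^ (l - 1))⁻¹ * weight (l - 1) m with hY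
  have hY0 : 0 < Y := by positivity
  -- Coefficients with `|k| < q` may be set to zero because `D k` vanishes there; only then does the
  -- lower bound on the frequencies hold in the central block.
  set a : Fin (2 * q) → ℝ := fun i =>
    if (q : ℤ) ≤ |blockIndex q m i| then c (j, blockIndex q m i) else 0 with ha
  have hsum : ∀ φ, ∑ i, c (j, blockIndex q m i) * D (blockIndex q m i) φ
      = ∑ i, a i * D (blockIndex q m i) φ := by
    intro φ
    refine Finset.sum_congr rfl fun i _ => ?_
    simp only [ha]
    split_ifs with h
    · rfl
    · rw [hD.eq_zero _ (not_le.1 h), mul_zero, mul_zero]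
  simp only [hsum]
  refine integral_abs_le_of_integral_sq_le ?_ (by positivity) ?_
  · have := hD.continuous
    fun_prop
  · refine (hD.integral_sq_le m a).trans ?_
    have hterm : ∀ i, a i ^ 2 * (1 + |(blockIndex q m i : ℝ)|) ^ 2
        ≤ (weight l j * Y) ^ 2 * ((1 + |(j : ℝ)|) ^ l * (1 + |(blockIndex q m i : ℝ)|) ^ l
          * c (j, blockIndex q m i)) ^ 2 := by
      intro i
      simp only [ha]
      split_ifs with h
      · set k := blockIndex q m i with hk
        have hj1 := one_add_abs_pos j
        have hk1 := one_add_abs_pos k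
        have h1 : weight (l - 1) k ≤ Y := by
          have h2 := mul_one_add_abs_le_blockIndex h
          have hm1 := one_add_abs_pos m
          have h3 : Y = ((q * (1 + |(m : ℝ)|) / 2) ^ (l - 1))⁻¹ := by
            rw [hY, weight, div_pow, mul_pow]
            field_simp
          rw [h3, weight]
          gcongr
        have h4 : (1 + |(j : ℝ)|) ^ l * weight l j = 1 := by
          rw [weight]
          field_simp
        have h5 : (1 + |(k : ℝ)|) ^ (l - 1) * weight (l - 1) k = 1 := by
          rw [weight]
          field_simp
        have h6 : (1 + |(k : ℝ)|) ^ l = (1 + |(k : ℝ)|) * (1 + |(k : ℝ)|) ^ (l - 1) := by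
          rw [← pow_succ', Nat.sub_add_cancel hl]
        calc c (j, k) ^ 2 * (1 + |(k : ℝ)|) ^ 2
            = ((1 + |(j : ℝ)|) ^ l * weight l j) ^ 2
              * ((1 + |(k : ℝ)|) ^ (l - 1) * weight (l - 1) k) ^ 2
              * (c (j, k) ^ 2 * (1 + |(k : ℝ)|) ^ 2) := by
              rw [h4, h5]
              ring
          _ = (weight l j * weight (l - 1) k) ^ 2
              * ((1 + |(j : ℝ)|) ^ l * (1 + |(k : ℝ)|) ^ l * c (j, k)) ^ 2 := by
              rw [h6]
              ring
          _ ≤ _ := by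
              have := weight_pos (l - 1) k
              gcongr
      · rw [zero_pow two_ne_zero, zero_mul]
        positivity
    have hs : ∑ i, ((1 + |(j : ℝ)|) ^ l * (1 + |(blockIndex q m i : ℝ)|) ^ l
          * c (j, blockIndex q m i)) ^ 2 ≤ A ^ 2 := by
      have := hc.sum_le j (Finset.univ.map ⟨blockIndex q m, blockIndex_injective q m⟩)
      rwa [Finset.sum_map] at this
    calc 8 * Real.pi * ∑ i, a i ^ 2 * (1 + |(blockIndex q m i : ℝ)|) ^ 2
        ≤ 8 * Real.pi * ((weight l j * Y) ^ 2 * A ^ 2) := by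
          gcongr
          refine (Finset.sum_le_sum fun i _ => hterm i).trans ?_
          rw [← Finset.mul_sum]
          gcongr
      _ = _ := by ring

/-- The aliasing error in the periodic variable. -/
theorem CoefDecay.integral_abs_tsum_phi_le {l : ℕ} {A : ℝ} {c : ℤ × ℤ → ℝ}
    (hc : CoefDecay l A c) (hl : 3 ≤ l) {q : ℕ} (hq : 0 < q) {D : ℤ → ℝ → ℝ}
    (hD : BlockBound q D) {t : ℤ → ℝ → ℝ} (ht : ∀ j, Continuous (t j))
    (htj : ∀ j θ, |t j θ| ≤ 1 + |(j : ℝ)|) :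
    ∫ z in angleDomain, |∑' p : ℤ × ℤ, c p * (t p.1 z.1 * D p.2 z.2)|
      ≤ 5 * Real.pi ^ 2 * A * 2 ^ (l - 1) * (∑' j, weight (l - 1) j) ^ 2
        * ((q : ℝ) ^ (l - 1))⁻¹ := by
  have hpi := Real.pi_pos
  have hA := hc.pos
  have hq' : (0 : ℝ) < q := by exact_mod_cast hq
  have hDc := hD.continuous
  have hbound : ∀ (p : ℤ × ℤ) (z : ℝ × ℝ), ‖c p * (t p.1 z.1 * D p.2 z.2)‖
      ≤ 4 * (|c p| * ((1 + |(p.1 : ℝ)|) ^ 1 * (1 + |(p.2 : ℝ)|) ^ 1)) := by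
    intro p z
    rw [norm_mul, norm_mul, Real.norm_eq_abs, Real.norm_eq_abs, Real.norm_eq_abs]
    calc _ ≤ |c p| * ((1 + |(p.1 : ℝ)|) * (4 * (1 + |(p.2 : ℝ)|))) := by
          gcongr
          · exact htj _ _
          · exact hD.abs_le _ _
      _ = _ := by ring
  have hsm := (hc.summable_mul_pow (a := 1) (b := 1) hl hl).mul_left 4
  have hsz : ∀ z : ℝ × ℝ, Summable fun p : ℤ × ℤ => c p * (t p.1 z.1 * D p.2 z.2) := fun z =>
    Summable.of_norm_bounded hsm fun p => hbound p z
  have hcont : Continuous fun z : ℝ × ℝ => ∑' p : ℤ × ℤ, c p * (t p.1 z.1 * D p.2 z.2) :=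
    continuous_tsum (fun p => by fun_prop) hsm hbound
  set e := Equiv.ofBijective _ (blockIndex_bijective hq) with he
  -- Absolute convergence permits summing inside each block first, so that orthogonality is used
  -- before absolute values are taken.
  have hregroup : ∀ z : ℝ × ℝ, ∑' p : ℤ × ℤ, c p * (t p.1 z.1 * D p.2 z.2)
      = ∑' r : ℤ × ℤ, t r.1 z.1
        * ∑ i, c (r.1, blockIndex q r.2 i) * D (blockIndex q r.2 i) z.2 := by
    intro z
    have h1 := e.hasSum_iff.2 (hsz z).hasSum
    refine ((h1.prod_fiberwise fun r => ?_).tsum_eq).symm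
    rw [Finset.mul_sum]
    refine (hasSum_fintype _).congr_fun fun i => ?_
    simp only [he, Function.comp_apply, Equiv.ofBijective_apply]
    ring
  simp only [hregroup] at hcont ⊢
  have hw := summable_weight_mul_weight (s := l - 1) (t := l - 1) (by omega) (by omega)
  refine (integral_abs_tsum_le (B := fun r : ℤ × ℤ =>
    5 * Real.pi ^ 2 * A * 2 ^ (l - 1) * ((q : ℝ) ^ (l - 1))⁻¹
      * (weight (l - 1) r.1 * weight (l - 1) r.2)) (fun r => ?_) hcont.aestronglyMeasurable
      (fun r => ?_) (hw.mul_left _)).trans_eq ?_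
  · exact integrableOn_angle_of_continuous (by fun_prop)
  · simp only [abs_mul]
    rw [setIntegral_angle_mul (fun θ => |t r.1 θ|)
      (fun φ => |∑ i, c (r.1, blockIndex q r.2 i) * D (blockIndex q r.2 i) φ|)]
    have h1 : ∫ θ in Ioo 0 Real.pi, |t r.1 θ| ≤ Real.pi * (1 + |(r.1 : ℝ)|) := by
      calc ∫ θ in Ioo 0 Real.pi, |t r.1 θ| ≤ ∫ θ in Ioo 0 Real.pi, (1 + |(r.1 : ℝ)|) :=
            setIntegral_mono (integrableOn_Ioo_of_continuous (ht _).abs _ _)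
              (integrableOn_Ioo_of_continuous continuous_const _ _) fun θ => htj _ _
        _ = _ := by simp [hpi.le]
    have h2 := hc.integral_block_le (by omega) hq hD r.1 r.2
    have h3 := pow_mul_weight_add (l - 1) 1 r.1
    rw [Nat.sub_add_cancel (by omega), pow_one] at h3
    have h4 := one_add_abs_pos r.1
    have h5 := weight_pos l r.1
    have h6 := weight_pos (l - 1) r.2
    rw [← h3]
    refine (mul_le_mul h1 h2 (integral_nonneg fun _ => abs_nonneg _) (by positivity)).trans_eq ?_
    ring
  · rw [tsum_mul_left, tsum_weight_mul_weight (by omega) (by omega)]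
    ring

/-! ### Orthogonality of modes and aliases within a block -/

/-- Each family is orthogonal, but the two need not be orthogonal to each other. The bound `(X - Y)²
≤ 2X² + 2Y²` separates them and turns `2π` into `8π`. -/
theorem integral_sq_sum_sub_le {ι : Type*} [Fintype ι] {x y : ι → ℝ → ℝ}
    (hx : ∀ i, Continuous (x i)) (hy : ∀ i, Continuous (y i))
    (hxo : ∀ i j, i ≠ j → ∫ φ in Ioo 0 (2 * Real.pi), x i φ * x j φ = 0)
    (hyo : ∀ i j, i ≠ j → ∫ φ in Ioo 0 (2 * Real.pi), y i φ * y j φ = 0) {L : ι → ℝ}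
    (hxL : ∀ i, ∫ φ in Ioo 0 (2 * Real.pi), x i φ * x i φ ≤ 2 * Real.pi * L i)
    (hyL : ∀ i, ∫ φ in Ioo 0 (2 * Real.pi), y i φ * y i φ ≤ 2 * Real.pi * L i) (a : ι → ℝ) :
    ∫ φ in Ioo 0 (2 * Real.pi), (∑ i, a i * (x i φ - y i φ)) ^ 2
      ≤ 8 * Real.pi * ∑ i, a i ^ 2 * L i := by
  have key : ∀ {v : ι → ℝ → ℝ}, (∀ i, Continuous (v i)) →
      (∀ i j, i ≠ j → ∫ φ in Ioo 0 (2 * Real.pi), v i φ * v j φ = 0) →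
      (∀ i, ∫ φ in Ioo 0 (2 * Real.pi), v i φ * v i φ ≤ 2 * Real.pi * L i) →
      ∫ φ in Ioo 0 (2 * Real.pi), (∑ i, a i * v i φ) ^ 2
        ≤ 2 * Real.pi * ∑ i, a i ^ 2 * L i := by
    intro v hv hvo hvL
    rw [integral_sq_sum_of_orthogonal _ _ _
      (fun i _ j _ => integrableOn_Ioo_of_continuous ((hv i).mul (hv j)) _ _)
      fun i _ j _ => hvo i j, Finset.mul_sum]
    refine Finset.sum_le_sum fun i _ => ?_
    calc _ ≤ a i ^ 2 * (2 * Real.pi * L i) := by gcongr; exact hvL i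
      _ = _ := by ring
  have h1 := key hx hxo hxL
  have h2 := key hy hyo hyL
  calc _ ≤ ∫ φ in Ioo 0 (2 * Real.pi),
        (2 * (∑ i, a i * x i φ) ^ 2 + 2 * (∑ i, a i * y i φ) ^ 2) := by
        refine setIntegral_mono (integrableOn_Ioo_of_continuous (by fun_prop) _ _)
          (integrableOn_Ioo_of_continuous (by fun_prop) _ _) fun φ => ?_
        simp only [mul_sub, Finset.sum_sub_distrib]
        nlinarith [sq_nonneg (∑ i, a i * x i φ + ∑ i, a i * y i φ)]
    _ = 2 * (∫ φ in Ioo 0 (2 * Real.pi), (∑ i, a i * x i φ) ^ 2)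
        + 2 * ∫ φ in Ioo 0 (2 * Real.pi), (∑ i, a i * y i φ) ^ 2 := by
        rw [integral_add (integrableOn_Ioo_of_continuous (by fun_prop) _ _)
          (integrableOn_Ioo_of_continuous (by fun_prop) _ _), integral_const_mul,
          integral_const_mul]
    _ ≤ _ := by linarith

/-- Aliases and their derivatives are means of two Hartley waves, so all their inner products are
instances of this one. -/
theorem integral_cas_comb (p p' r r' : ℝ) (u u' w w' : ℤ) :
    ∫ φ in Ioo 0 (2 * Real.pi), (p * cas (u * φ) + p' * cas (u' * φ)) / 2
      * ((r * cas (w * φ) + r' * cas (w' * φ)) / 2)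
      = Real.pi / 2 * ((if u = w then p * r else 0) + (if u = w' then p * r' else 0)
        + (if u' = w then p' * r else 0) + (if u' = w' then p' * r' else 0)) := by
  have hcas := continuous_cas
  have hi : ∀ (a : ℝ) (m n : ℤ), IntegrableOn (fun φ : ℝ => a * (cas (m * φ) * cas (n * φ)))
      (Ioo 0 (2 * Real.pi)) := fun a m n => integrableOn_Ioo_of_continuous (by fun_prop) _ _
  have h1 : ∀ φ : ℝ, (p * cas (u * φ) + p' * cas (u' * φ)) / 2
      * ((r * cas (w * φ) + r' * cas (w' * φ)) / 2)
      = p * r / 4 * (cas (u * φ) * cas (w * φ)) + p * r' / 4 * (cas (u * φ) * cas (w' * φ))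
        + p' * r / 4 * (cas (u' * φ) * cas (w * φ))
        + p' * r' / 4 * (cas (u' * φ) * cas (w' * φ)) := fun φ => by ring
  simp only [h1]
  rw [integral_add (integrableOn_Ioo_of_continuous (by fun_prop) _ _) (hi _ _ _),
    integral_add (integrableOn_Ioo_of_continuous (by fun_prop) _ _) (hi _ _ _),
    integral_add (hi _ _ _) (hi _ _ _)]
  simp only [integral_const_mul, integral_cas_mul_cas]
  split_ifs <;> ring

/-- The mirror image of the frequency `-q`. -/
def mirror (q : ℕ) (b : ℤ) : ℤ := if b = -q then q else b

/-- `cos (qφ)` is the mean of the waves of frequencies `-q` and `q`; for any other `b` the two waves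
coincide. The exceptional alias thus needs no separate treatment in inner products. -/
theorem aliasCas_eq (q : ℕ) (b : ℤ) (φ : ℝ) :
    aliasCas q b φ = (1 * cas (b * φ) + 1 * cas (mirror q b * φ)) / 2 := by
  unfold aliasCas mirror
  split_ifs with h
  · rw [h]
    push_cast
    rw [cas, cas, neg_mul, Real.cos_neg, Real.sin_neg]
    ring
  · ring

theorem aliasCasDeriv_eq (q : ℕ) (b : ℤ) (φ : ℝ) :
    aliasCasDeriv q b φ = (b * cas ((-b : ℤ) * φ)
      + mirror q b * cas ((-mirror q b : ℤ) * φ)) / 2 := by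
  unfold aliasCasDeriv mirror
  split_ifs with h
  · rw [h]
    push_cast
    simp only [cas, neg_neg, neg_mul, Real.cos_neg, Real.sin_neg]
    ring
  · push_cast
    ring

theorem mirror_sq (q : ℕ) (b : ℤ) : (mirror q b : ℝ) ^ 2 = b ^ 2 := by
  unfold mirror
  split_ifs with h
  · rw [h]
    push_cast
    ring
  · rfl

/-- The mirrored frequency `q` lies outside the range of representatives, so distinct
representatives share no wave. -/
theorem mirror_ne {q : ℕ} {b b' : ℤ} (h : b ≠ b') (h1 : b < q) (h2 : b' < q) :
    b ≠ mirror q b' ∧ mirror q b ≠ b' ∧ mirror q b ≠ mirror q b' := by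
  unfold mirror
  split_ifs <;> omega

theorem integral_aliasCas_mul {q : ℕ} {b b' : ℤ} (h : b ≠ b') (h1 : b < q) (h2 : b' < q) :
    ∫ φ in Ioo 0 (2 * Real.pi), aliasCas q b φ * aliasCas q b' φ = 0 := by
  obtain ⟨h3, h4, h5⟩ := mirror_ne h h1 h2
  simp only [aliasCas_eq]
  rw [integral_cas_comb, if_neg h, if_neg h3, if_neg h4, if_neg h5]
  simp

theorem integral_aliasCasDeriv_mul {q : ℕ} {b b' : ℤ} (h : b ≠ b') (h1 : b < q) (h2 : b' < q) :
    ∫ φ in Ioo 0 (2 * Real.pi), aliasCasDeriv q b φ * aliasCasDeriv q b' φ = 0 := by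
  obtain ⟨h3, h4, h5⟩ := mirror_ne h h1 h2
  simp only [aliasCasDeriv_eq]
  rw [integral_cas_comb, if_neg (by rwa [neg_inj]), if_neg (by rwa [neg_inj]),
    if_neg (by rwa [neg_inj]), if_neg (by rwa [neg_inj])]
  simp

theorem integral_aliasCas_sq_le (q : ℕ) (b : ℤ) :
    ∫ φ in Ioo 0 (2 * Real.pi), aliasCas q b φ * aliasCas q b φ ≤ 2 * Real.pi := by
  have hpi := Real.pi_pos
  simp only [aliasCas_eq]
  rw [integral_cas_comb]
  split_ifs <;> linarith

theorem integral_aliasCasDeriv_sq_le (q : ℕ) (b : ℤ) :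
    ∫ φ in Ioo 0 (2 * Real.pi), aliasCasDeriv q b φ * aliasCasDeriv q b φ
      ≤ 2 * Real.pi * (b : ℝ) ^ 2 := by
  have hpi := Real.pi_pos
  have hm := mirror_sq q b
  simp only [aliasCasDeriv_eq]
  rw [integral_cas_comb]
  have h1 : (b : ℝ) * mirror q b ≤ b ^ 2 := by nlinarith [sq_nonneg ((b : ℝ) - mirror q b)]
  have h2 : (0 : ℝ) ≤ b ^ 2 := sq_nonneg _
  have h3 : (b : ℝ) * b + b * mirror q b + mirror q b * b + mirror q b * mirror q b
      ≤ 4 * b ^ 2 := by nlinarith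
  have key : (if -b = -b then (b : ℝ) * b else 0) + (if -b = -mirror q b then (b : ℝ) * mirror q b else 0)
      + (if -mirror q b = -b then (mirror q b : ℝ) * b else 0)
      + (if -mirror q b = -mirror q b then (mirror q b : ℝ) * mirror q b else 0) ≤ 4 * b ^ 2 := by
    split_ifs <;> nlinarith
  exact (mul_le_mul_of_nonneg_left key (by positivity)).trans_eq (by ring)

/-- The aliasing error of a single frequency. -/
def aliasErr (q : ℕ) (k : ℤ) (φ : ℝ) : ℝ := cas (k * φ) - aliasCas q (centeredMod q k) φ

/-- The derivative of the aliasing error of a single frequency. -/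
def aliasErrDeriv (q : ℕ) (k : ℤ) (φ : ℝ) : ℝ :=
  k * cas (-k * φ) - aliasCasDeriv q (centeredMod q k) φ

theorem abs_int_mul_cas_le (k : ℤ) (x : ℝ) : |k * cas x| ≤ 2 * |(k : ℝ)| := by
  rw [abs_mul, mul_comm]
  exact mul_le_mul_of_nonneg_right (abs_cas_le _) (abs_nonneg _)

theorem abs_cast_centeredMod_le {m : ℕ} (hm : 0 < m) (k : ℤ) :
    |(centeredMod m k : ℝ)| ≤ |(k : ℝ)| := by
  exact_mod_cast abs_centeredMod_le_abs hm k

/-- Within a block the frequencies are distinct and so are their aliases, hence both families are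
orthogonal. The condition `|k| < q` in the vanishing clause is strict because the mode `-q` loses
its sine part. -/
theorem blockBound_aliasErr (q : ℕ) : BlockBound q (aliasErr q) where
  continuous k := (continuous_cas.comp (continuous_const.mul continuous_id)).sub
    (continuous_aliasCas q _)
  eq_zero k hk φ := by
    have h := abs_lt.1 hk
    rw [aliasErr, centeredMod_eq_self h.1.le h.2, aliasCas, if_neg h.1.ne', sub_self]
  abs_le k φ := by
    refine (abs_sub _ _).trans ?_
    have h1 := abs_cas_le (k * φ)
    have h2 := abs_aliasCas_le q (centeredMod q k) φ
    linarith [abs_nonneg (k : ℝ)]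
  integral_sq_le m a := by
    have hcas := continuous_cas
    have hpi := Real.pi_pos
    have h1 : ∀ i : Fin (2 * q), (1 : ℝ) ≤ (1 + |(blockIndex q m i : ℝ)|) ^ 2 := fun i =>
      one_le_pow₀ (by linarith [abs_nonneg (blockIndex q m i : ℝ)])
    refine integral_sq_sum_sub_le (fun i => by fun_prop) (fun i => continuous_aliasCas q _)
      (fun i j hij => ?_) (fun i j hij => ?_) (fun i => ?_) (fun i => ?_) a
    · rw [integral_cas_mul_cas, if_neg ((blockIndex_injective q m).ne hij)]
    · rw [centeredMod_blockIndex, centeredMod_blockIndex]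
      have := i.2
      have := j.2
      have := fun h => hij (Fin.ext h)
      exact integral_aliasCas_mul (by omega) (by omega) (by omega)
    · rw [integral_cas_mul_cas, if_pos rfl]
      nlinarith [h1 i]
    · refine (integral_aliasCas_sq_le q _).trans ?_
      nlinarith [h1 i]

theorem blockBound_aliasErrDeriv {q : ℕ} (hq : 0 < q) : BlockBound q (aliasErrDeriv q) where
  continuous k := (continuous_const.mul (continuous_cas.comp
    (continuous_const.mul continuous_id))).sub (continuous_aliasCasDeriv q _)
  eq_zero k hk φ := by
    have h := abs_lt.1 hk
    rw [aliasErrDeriv, centeredMod_eq_self h.1.le h.2, aliasCasDeriv, if_neg h.1.ne', sub_self]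
  abs_le k φ := by
    refine (abs_sub _ _).trans ?_
    have h1 := abs_int_mul_cas_le k (-k * φ)
    have h2 := abs_aliasCasDeriv_le q (centeredMod q k) φ
    have h3 := abs_cast_centeredMod_le hq k
    linarith
  integral_sq_le m a := by
    have hcas := continuous_cas
    have hpi := Real.pi_pos
    have h1 : ∀ i : Fin (2 * q), (blockIndex q m i : ℝ) ^ 2
        ≤ (1 + |(blockIndex q m i : ℝ)|) ^ 2 := fun i => by
      rw [← sq_abs (blockIndex q m i : ℝ)]
      have := abs_nonneg (blockIndex q m i : ℝ)
      gcongr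
      linarith
    have h2 : ∀ k k' : ℤ, ∫ φ in Ioo 0 (2 * Real.pi), (k * cas (-k * φ)) * (k' * cas (-k' * φ))
        = if k = k' then 2 * Real.pi * (k : ℝ) ^ 2 else 0 := by
      intro k k'
      have h3 : ∀ φ : ℝ, (k * cas (-k * φ)) * (k' * cas (-k' * φ))
          = (k * k') * (cas ((-k : ℤ) * φ) * cas ((-k' : ℤ) * φ)) := fun φ => by
        push_cast
        ring
      simp only [h3]
      rw [integral_const_mul, integral_cas_mul_cas]
      simp only [neg_inj]
      split_ifs with h
      · rw [h]
        ring
      · ring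
    refine integral_sq_sum_sub_le (fun i => by fun_prop) (fun i => continuous_aliasCasDeriv q _)
      (fun i j hij => ?_) (fun i j hij => ?_) (fun i => ?_) (fun i => ?_) a
    · rw [h2, if_neg ((blockIndex_injective q m).ne hij)]
    · rw [centeredMod_blockIndex, centeredMod_blockIndex]
      have := i.2
      have := j.2
      have := fun h => hij (Fin.ext h)
      exact integral_aliasCasDeriv_mul (by omega) (by omega) (by omega)
    · rw [h2, if_pos rfl]
      nlinarith [h1 i]
    · refine (integral_aliasCasDeriv_sq_le q _).trans ?_
      have h3 : ((centeredMod q (blockIndex q m i) : ℤ) : ℝ) ^ 2 ≤ (blockIndex q m i : ℝ) ^ 2 :=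
        sq_le_sq.2 (abs_cast_centeredMod_le hq _)
      nlinarith [h1 i]

/-! ### Series of interpolation errors -/

/-- The term of the series of interpolation errors with frequency `p`, where `t j`, `x k` are the
modes in the two variables and `y k` is the alias of `x k`. -/
def errTerm (M : ℕ) (c : ℤ × ℤ → ℝ) (t x y : ℤ → ℝ → ℝ) (p : ℤ × ℤ) (z : ℝ × ℝ) : ℝ :=
  c p * (t p.1 z.1 * x p.2 z.2 - t (centeredMod M p.1) z.1 * y p.2 z.2)

/-- The constant in the bounds for the interpolation error. -/
def errConst (l : ℕ) (A : ℝ) : ℝ :=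
  5 * Real.pi ^ 2 * A * 2 ^ (l - 1) * (∑' j, weight (l - 1) j) ^ 2
    + 16 * Real.pi ^ 2 * A * (∑' j, weight (l - 1) j)
    + 4 * A * ((∑' j, weight (l - 3) j) * ∑' k, weight (l - 2) k)

theorem errConst_nonneg (l : ℕ) {A : ℝ} (hA : 0 < A) : 0 ≤ errConst l A := by
  have h1 := tsum_weight_nonneg (l - 1)
  have h2 := tsum_weight_nonneg (l - 2)
  have h3 := tsum_weight_nonneg (l - 3)
  unfold errConst
  positivity

theorem continuous_errTerm {M : ℕ} {c : ℤ × ℤ → ℝ} {t x y : ℤ → ℝ → ℝ}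
    (ht : ∀ j, Continuous (t j)) (hx : ∀ k, Continuous (x k)) (hy : ∀ k, Continuous (y k))
    (p : ℤ × ℤ) : Continuous (errTerm M c t x y p) := by
  unfold errTerm
  fun_prop

theorem abs_mul_sub_mul_le {a a' b b' X Y : ℝ} (ha : |a| ≤ X) (ha' : |a'| ≤ X) (hb : |b| ≤ Y)
    (hb' : |b'| ≤ Y) : |a * b - a' * b'| ≤ 2 * (X * Y) := by
  refine (abs_sub _ _).trans ?_
  rw [abs_mul, abs_mul]
  have h1 := mul_le_mul ha hb (abs_nonneg _) ((abs_nonneg _).trans ha)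
  have h2 := mul_le_mul ha' hb' (abs_nonneg _) ((abs_nonneg _).trans ha)
  linarith

/-- One majorant for the values and both first derivatives: at most one power is lost in each
variable. It justifies termwise differentiation. -/
theorem abs_errTerm_le {M : ℕ} (hM : 0 < M) (c : ℤ × ℤ → ℝ) {t x y : ℤ → ℝ → ℝ}
    (htj : ∀ j θ, |t j θ| ≤ 1 + |(j : ℝ)|) (hx : ∀ k φ, |x k φ| ≤ 2 * (1 + |(k : ℝ)|))
    (hy : ∀ k φ, |y k φ| ≤ 2 * (1 + |(k : ℝ)|)) (p : ℤ × ℤ) (z : ℝ × ℝ) :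
    ‖errTerm M c t x y p z‖
      ≤ 4 * (|c p| * ((1 + |(p.1 : ℝ)|) ^ 1 * (1 + |(p.2 : ℝ)|) ^ 1)) := by
  rw [errTerm, norm_mul, Real.norm_eq_abs, Real.norm_eq_abs]
  have h1 := abs_cast_centeredMod_le hM p.1
  have h2 := abs_mul_sub_mul_le (htj p.1 z.1)
    ((htj (centeredMod M p.1) z.1).trans (by linarith)) (hx p.2 z.2) (hy p.2 z.2)
  calc _ ≤ |c p| * (2 * ((1 + |(p.1 : ℝ)|) * (2 * (1 + |(p.2 : ℝ)|)))) := by gcongr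
    _ = _ := by ring

/-- Terms with `|j| < M` and `|k| < q` vanish, and all others satisfy `1 ≤ (1+|j|)(1+|k|)(1/M +
1/q)`, so smallness is bought with one power of each frequency. In total three powers of `j` and two
of `k` are spent, whence `5 ≤ l`. The parameter `τ` will be `1`, or `sin θ` for the derivative in
`θ`, so that `sin θ` can be divided out. -/
theorem CoefDecay.abs_tsum_errTerm_le {l : ℕ} {A : ℝ} {c : ℤ × ℤ → ℝ} (hc : CoefDecay l A c)
    (hl : 5 ≤ l) {M q : ℕ} (hM : 0 < M) (hq : 0 < q) {t x y : ℤ → ℝ → ℝ}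
    (hD : BlockBound q fun k φ => x k φ - y k φ)
    (hx : ∀ k φ, |x k φ| ≤ 2 * (1 + |(k : ℝ)|)) (hy : ∀ k φ, |y k φ| ≤ 2 * (1 + |(k : ℝ)|))
    {z : ℝ × ℝ} {τ : ℝ} (hτ : 0 ≤ τ) (ht : ∀ j : ℤ, |t j z.1| ≤ (1 + |(j : ℝ)|) ^ 2 * τ) :
    |∑' p, errTerm M c t x y p z| ≤ τ * (errConst l A * (1 / M + 1 / q)) := by
  have hA := hc.pos
  have hM' : (0 : ℝ) < M := by exact_mod_cast hM
  have hq' : (0 : ℝ) < q := by exact_mod_cast hq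
  set δ : ℝ := 1 / M + 1 / q with hδ
  have hδ0 : 0 ≤ δ := by positivity
  have hterm : ∀ p : ℤ × ℤ, ‖errTerm M c t x y p z‖
      ≤ 4 * τ * δ * (A * (weight (l - 3) p.1 * weight (l - 2) p.2)) := by
    intro p
    have hw1 := weight_pos (l - 3) p.1
    have hw2 := weight_pos (l - 2) p.2
    have hp1 := one_add_abs_pos p.1
    have hp2 := one_add_abs_pos p.2
    by_cases hbox : |p.1| < (M : ℤ) ∧ |p.2| < (q : ℤ)
    · have h1 := abs_lt.1 hbox.1
      have h2 := hD.eq_zero p.2 hbox.2 z.2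
      rw [errTerm, centeredMod_eq_self h1.1.le h1.2, ← mul_sub, h2, mul_zero, mul_zero, norm_zero]
      positivity
    · have h1 := abs_cast_centeredMod_le hM p.1
      have h2 := abs_mul_sub_mul_le (ht p.1) ((ht (centeredMod M p.1)).trans (by gcongr))
        (hx p.2 z.2) (hy p.2 z.2)
      have h3 : 1 ≤ (1 + |(p.1 : ℝ)|) * (1 + |(p.2 : ℝ)|) * δ := by
        have h4 : 0 ≤ |(p.1 : ℝ)| := abs_nonneg _
        have h5 : 0 ≤ |(p.2 : ℝ)| := abs_nonneg _
        rw [not_and_or, not_lt, not_lt] at hbox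
        rcases hbox with h | h
        · have h6 : (M : ℝ) ≤ |(p.1 : ℝ)| := by exact_mod_cast h
          calc (1 : ℝ) = M * (1 / M) := by field_simp
            _ ≤ (1 + |(p.1 : ℝ)|) * (1 / M) := by gcongr; linarith
            _ ≤ ((1 + |(p.1 : ℝ)|) * (1 + |(p.2 : ℝ)|)) * δ := by
              gcongr
              · nlinarith
              · rw [hδ]
                linarith [show (0 : ℝ) ≤ 1 / q by positivity]
        · have h6 : (q : ℝ) ≤ |(p.2 : ℝ)| := by exact_mod_cast h
          calc (1 : ℝ) = q * (1 / q) := by field_simp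
            _ ≤ (1 + |(p.2 : ℝ)|) * (1 / q) := by gcongr; linarith
            _ ≤ ((1 + |(p.1 : ℝ)|) * (1 + |(p.2 : ℝ)|)) * δ := by
              gcongr
              · nlinarith
              · rw [hδ]
                linarith [show (0 : ℝ) ≤ 1 / M by positivity]
      rw [errTerm, norm_mul, Real.norm_eq_abs, Real.norm_eq_abs]
      calc _ ≤ |c p| * (2 * ((1 + |(p.1 : ℝ)|) ^ 2 * τ * (2 * (1 + |(p.2 : ℝ)|)))) * 1 := by
            rw [mul_one]
            gcongr
        _ ≤ |c p| * (2 * ((1 + |(p.1 : ℝ)|) ^ 2 * τ * (2 * (1 + |(p.2 : ℝ)|))))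
            * ((1 + |(p.1 : ℝ)|) * (1 + |(p.2 : ℝ)|) * δ) := by gcongr
        _ = 4 * τ * δ * (|c p| * ((1 + |(p.1 : ℝ)|) ^ 3 * (1 + |(p.2 : ℝ)|) ^ 2)) := by ring
        _ ≤ _ := by
            exact mul_le_mul_of_nonneg_left
              (hc.mul_pow_le (a := 3) (b := 2) (by omega) (by omega) p) (by positivity)
  have hs := (((summable_weight_mul_weight (s := l - 3) (t := l - 2) (by omega)
    (by omega)).mul_left A).mul_left (4 * τ * δ))
  refine (tsum_of_norm_bounded hs.hasSum hterm).trans ?_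
  rw [tsum_mul_left, tsum_mul_left, tsum_weight_mul_weight (by omega) (by omega)]
  have h1 := tsum_weight_nonneg (l - 1)
  have h2 : 4 * A * ((∑' j, weight (l - 3) j) * ∑' k, weight (l - 2) k) ≤ errConst l A := by
    unfold errConst
    have : 0 ≤ 5 * Real.pi ^ 2 * A * 2 ^ (l - 1) * (∑' j, weight (l - 1) j) ^ 2
      + 16 * Real.pi ^ 2 * A * (∑' j, weight (l - 1) j) := by positivity
    linarith
  calc _ = τ * (4 * A * ((∑' j, weight (l - 3) j) * ∑' k, weight (l - 2) k) * δ) := by ring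
    _ ≤ _ := by gcongr

/-- Only `|j| ≥ M` contributes, with size `(1+|j|)^(1-l)`. Two of these powers are kept for
summation, whose tail is at most `2/M`, and the rest give `M^(3-l)`. -/
theorem CoefDecay.abs_tsum_rho_le {l : ℕ} {A : ℝ} {c : ℤ × ℤ → ℝ} (hc : CoefDecay l A c)
    (hl : 5 ≤ l) {M : ℕ} (hM : 0 < M) {t y : ℤ → ℝ → ℝ}
    (htj : ∀ j θ, |t j θ| ≤ 1 + |(j : ℝ)|) (hy : ∀ k φ, |y k φ| ≤ 2 * (1 + |(k : ℝ)|))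
    (z : ℝ × ℝ) :
    |∑' p : ℤ × ℤ, c p * ((t p.1 z.1 - t (centeredMod M p.1) z.1) * y p.2 z.2)|
      ≤ 8 * A * (∑' j, weight (l - 1) j) * ((M : ℝ) ^ (l - 2))⁻¹ := by
  have hA := hc.pos
  have hM' : (0 : ℝ) < M := by exact_mod_cast hM
  set τ : ℤ → ℝ := fun j => if (M : ℤ) ≤ |j| then weight 2 j else 0 with hτ
  have hτ0 : ∀ j, 0 ≤ τ j := fun j => by
    simp only [hτ]
    split_ifs
    · exact (weight_pos 2 j).le
    · exact le_rfl
  have hτs : Summable τ := Summable.of_nonneg_of_le hτ0 (fun j => by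
    simp only [hτ]
    split_ifs
    · exact le_rfl
    · exact (weight_pos 2 j).le) (summable_weight le_rfl)
  have hws := summable_weight (s := l - 1) (by omega)
  have hterm : ∀ p : ℤ × ℤ, ‖c p * ((t p.1 z.1 - t (centeredMod M p.1) z.1) * y p.2 z.2)‖
      ≤ 4 * A * ((M : ℝ) ^ (l - 3))⁻¹ * (τ p.1 * weight (l - 1) p.2) := by
    intro p
    have hw := weight_pos (l - 1) p.2
    by_cases h : (M : ℤ) ≤ |p.1|
    · have h1 := abs_cast_centeredMod_le hM p.1
      have h2 : |t p.1 z.1 - t (centeredMod M p.1) z.1| ≤ 2 * (1 + |(p.1 : ℝ)|) := by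
        refine (abs_sub _ _).trans ?_
        linarith [htj p.1 z.1, htj (centeredMod M p.1) z.1]
      have h3 : weight (l - 1) p.1 ≤ ((M : ℝ) ^ (l - 3))⁻¹ * τ p.1 := by
        have h4 : l - 1 = (l - 3) + 2 := by omega
        have h5 : (M : ℝ) ≤ |(p.1 : ℝ)| := by exact_mod_cast h
        have h6 := weight_pos 2 p.1
        simp only [hτ, if_pos h]
        rw [h4, weight_add]
        gcongr
        rw [weight]
        gcongr
        linarith
      have h4 := hc.mul_pow_le (a := 1) (b := 1) (by omega) (by omega) p
      rw [norm_mul, norm_mul, Real.norm_eq_abs, Real.norm_eq_abs, Real.norm_eq_abs]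
      calc _ ≤ |c p| * (2 * (1 + |(p.1 : ℝ)|) * (2 * (1 + |(p.2 : ℝ)|))) := by
            gcongr
            exact hy _ _
        _ = 4 * (|c p| * ((1 + |(p.1 : ℝ)|) ^ 1 * (1 + |(p.2 : ℝ)|) ^ 1)) := by ring
        _ ≤ 4 * (A * (weight (l - 1) p.1 * weight (l - 1) p.2)) := by gcongr
        _ ≤ 4 * (A * (((M : ℝ) ^ (l - 3))⁻¹ * τ p.1 * weight (l - 1) p.2)) := by gcongr
        _ = _ := by ring
    · have h1 := abs_lt.1 (not_le.1 h)
      rw [centeredMod_eq_self h1.1.le h1.2, sub_self, zero_mul, mul_zero, norm_zero]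
      have := hτ0 p.1
      positivity
  have hprod : Summable fun p : ℤ × ℤ => τ p.1 * weight (l - 1) p.2 :=
    hτs.mul_of_nonneg hws hτ0 fun k => (weight_pos _ k).le
  refine (tsum_of_norm_bounded (hprod.mul_left _).hasSum hterm).trans ?_
  have hS := tsum_weight_nonneg (l - 1)
  rw [tsum_mul_left, ← hτs.tsum_mul_tsum hws hprod]
  have h2 : (M : ℝ) ^ (l - 2) = M ^ (l - 3) * M := by
    rw [← pow_succ]
    congr 1
    omega
  calc _ ≤ 4 * A * ((M : ℝ) ^ (l - 3))⁻¹ * (2 / M * ∑' j, weight (l - 1) j) := by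
        gcongr
        exact tsum_weight_tail_le hM
    _ = _ := by
        rw [h2]
        field_simp
        ring

/-- Write `t x - t' y = t (x - y) + (t - t') y`. The first part is the aliasing error in `φ`,
treated by blocks in `L¹`; the second is the one in `ρ`, bounded uniformly and multiplied by the
area `2π²`. -/
theorem CoefDecay.integral_abs_tsum_errTerm_le {l : ℕ} {A : ℝ} {c : ℤ × ℤ → ℝ}
    (hc : CoefDecay l A c) (hl : 5 ≤ l) {M q : ℕ} (hM : 0 < M) (hq : 0 < q)
    {t x y : ℤ → ℝ → ℝ} (hD : BlockBound q fun k φ => x k φ - y k φ)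
    (htc : ∀ j, Continuous (t j)) (hyc : ∀ k, Continuous (y k))
    (htj : ∀ j θ, |t j θ| ≤ 1 + |(j : ℝ)|) (hy : ∀ k φ, |y k φ| ≤ 2 * (1 + |(k : ℝ)|)) :
    ∫ z in angleDomain, |∑' p, errTerm M c t x y p z|
      ≤ errConst l A * (((M : ℝ) ^ (l - 2))⁻¹ + ((q : ℝ) ^ (l - 1))⁻¹) := by
  have hpi := Real.pi_pos
  have hA := hc.pos
  have hM' : (0 : ℝ) < M := by exact_mod_cast hM
  have hq' : (0 : ℝ) < q := by exact_mod_cast hq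
  have hDc := hD.continuous
  have hsm := hc.summable_mul_pow (a := 1) (b := 1) (by omega) (by omega)
  have hb1 : ∀ (p : ℤ × ℤ) (z : ℝ × ℝ), ‖c p * (t p.1 z.1 * (x p.2 z.2 - y p.2 z.2))‖
      ≤ 4 * (|c p| * ((1 + |(p.1 : ℝ)|) ^ 1 * (1 + |(p.2 : ℝ)|) ^ 1)) := by
    intro p z
    rw [norm_mul, norm_mul, Real.norm_eq_abs, Real.norm_eq_abs, Real.norm_eq_abs]
    calc _ ≤ |c p| * ((1 + |(p.1 : ℝ)|) * (4 * (1 + |(p.2 : ℝ)|))) := by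
          gcongr
          · exact htj _ _
          · exact hD.abs_le _ _
      _ = _ := by ring
  have hb2 : ∀ (p : ℤ × ℤ) (z : ℝ × ℝ),
      ‖c p * ((t p.1 z.1 - t (centeredMod M p.1) z.1) * y p.2 z.2)‖
      ≤ 4 * (|c p| * ((1 + |(p.1 : ℝ)|) ^ 1 * (1 + |(p.2 : ℝ)|) ^ 1)) := by
    intro p z
    have h1 := abs_cast_centeredMod_le hM p.1
    have h2 : |t p.1 z.1 - t (centeredMod M p.1) z.1| ≤ 2 * (1 + |(p.1 : ℝ)|) := by
      refine (abs_sub _ _).trans ?_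
      linarith [htj p.1 z.1, htj (centeredMod M p.1) z.1]
    rw [norm_mul, norm_mul, Real.norm_eq_abs, Real.norm_eq_abs, Real.norm_eq_abs]
    calc _ ≤ |c p| * (2 * (1 + |(p.1 : ℝ)|) * (2 * (1 + |(p.2 : ℝ)|))) := by
          gcongr
          exact hy _ _
      _ = _ := by ring
  have hs1 := fun z => Summable.of_norm_bounded (hsm.mul_left 4) fun p => hb1 p z
  have hs2 := fun z => Summable.of_norm_bounded (hsm.mul_left 4) fun p => hb2 p z
  have hc1 : Continuous fun z : ℝ × ℝ =>
      ∑' p : ℤ × ℤ, c p * (t p.1 z.1 * (x p.2 z.2 - y p.2 z.2)) :=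
    continuous_tsum (fun p => continuous_const.mul
      (((htc p.1).comp continuous_fst).mul ((hDc p.2).comp continuous_snd)))
      (hsm.mul_left 4) hb1
  have hc2 : Continuous fun z : ℝ × ℝ =>
      ∑' p : ℤ × ℤ, c p * ((t p.1 z.1 - t (centeredMod M p.1) z.1) * y p.2 z.2) :=
    continuous_tsum (fun p => by fun_prop) (hsm.mul_left 4) hb2
  have hsplit : ∀ z, ∑' p, errTerm M c t x y p z
      = ∑' p : ℤ × ℤ, c p * (t p.1 z.1 * (x p.2 z.2 - y p.2 z.2))
        + ∑' p : ℤ × ℤ, c p * ((t p.1 z.1 - t (centeredMod M p.1) z.1) * y p.2 z.2) := by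
    intro z
    rw [← (hs1 z).tsum_add (hs2 z)]
    refine tsum_congr fun p => ?_
    rw [errTerm]
    ring
  have hS := tsum_weight_nonneg (l - 1)
  have hS2 := tsum_weight_nonneg (l - 2)
  have hS3 := tsum_weight_nonneg (l - 3)
  set R2 : ℝ := 8 * A * (∑' j, weight (l - 1) j) * ((M : ℝ) ^ (l - 2))⁻¹ with hR2
  have hvol : ∫ _ in angleDomain, R2 = 2 * Real.pi ^ 2 * R2 := by
    have h1 := setIntegral_angle_mul (fun _ => R2) (fun _ => 1)
    simp only [mul_one] at h1
    rw [h1]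
    simp [hpi.le]
    ring
  calc ∫ z in angleDomain, |∑' p, errTerm M c t x y p z|
      ≤ ∫ z in angleDomain,
        (|∑' p : ℤ × ℤ, c p * (t p.1 z.1 * (x p.2 z.2 - y p.2 z.2))| + R2) := by
        simp only [hsplit]
        refine setIntegral_mono (integrableOn_angle_of_continuous (hc1.add hc2).abs)
          (integrableOn_angle_of_continuous (hc1.abs.add continuous_const)) fun z => ?_
        refine (abs_add_le _ _).trans (add_le_add le_rfl ?_)
        exact hc.abs_tsum_rho_le hl hM htj hy z
    _ = (∫ z in angleDomain, |∑' p : ℤ × ℤ, c p * (t p.1 z.1 * (x p.2 z.2 - y p.2 z.2))|)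
        + 2 * Real.pi ^ 2 * R2 := by
        rw [integral_add (integrableOn_angle_of_continuous hc1.abs)
          (integrableOn_angle_of_continuous continuous_const), hvol]
    _ ≤ 5 * Real.pi ^ 2 * A * 2 ^ (l - 1) * (∑' j, weight (l - 1) j) ^ 2
        * ((q : ℝ) ^ (l - 1))⁻¹ + 2 * Real.pi ^ 2 * R2 := by
        gcongr
        exact hc.integral_abs_tsum_phi_le (by omega) hq hD htc htj
    _ ≤ _ := by
        have h1 : 0 ≤ ((M : ℝ) ^ (l - 2))⁻¹ := by positivity
        have h2 : 0 ≤ ((q : ℝ) ^ (l - 1))⁻¹ := by positivity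
        set a := 5 * Real.pi ^ 2 * A * 2 ^ (l - 1) * (∑' j, weight (l - 1) j) ^ 2 with ha
        set b := 16 * Real.pi ^ 2 * A * (∑' j, weight (l - 1) j) with hb
        set d := 4 * A * ((∑' j, weight (l - 3) j) * ∑' k, weight (l - 2) k) with hd
        have ha0 : 0 ≤ a := by positivity
        have hb0 : 0 ≤ b := by positivity
        have hd0 : 0 ≤ d := by positivity
        have h3 : 2 * Real.pi ^ 2 * R2 = b * ((M : ℝ) ^ (l - 2))⁻¹ := by
          rw [hR2, hb]
          ring
        have h4 : errConst l A = a + b + d := rfl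
        rw [h3, h4]
        nlinarith [mul_nonneg ha0 h1, mul_nonneg hb0 h2, mul_nonneg hd0 h1, mul_nonneg hd0 h2]

/-! ### The interpolation error of a single function -/

theorem uniqueDiffOn_strip : UniqueDiffOn ℝ (Icc (-1 : ℝ) 1 ×ˢ (univ : Set ℝ)) :=
  (uniqueDiffOn_Icc (by norm_num)).prod uniqueDiffOn_univ

theorem hasDerivWithinAt_rho {v : ℝ × ℝ → ℝ} (hv : ContDiffOn ℝ 1 v (Icc (-1) 1 ×ˢ univ))
    {z : ℝ × ℝ} (hz : z ∈ Icc (-1 : ℝ) 1 ×ˢ (univ : Set ℝ)) :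
    HasDerivWithinAt (fun s => v (s, z.2))
      (fderivWithin ℝ v (Icc (-1) 1 ×ˢ univ) z (1, 0)) (Icc (-1) 1) z.1 := by
  have h1 := (hv.differentiableOn (by norm_num) z hz).hasFDerivWithinAt
  have h2 : HasDerivWithinAt (fun s : ℝ => (s, z.2)) (1, 0) (Icc (-1) 1) z.1 :=
    (hasDerivWithinAt_id _ _).prodMk (hasDerivWithinAt_const _ _ _)
  exact HasFDerivWithinAt.comp_hasDerivWithinAt z.1 h1 h2 fun s hs => ⟨hs, mem_univ _⟩

theorem hasDerivAt_phi {v : ℝ × ℝ → ℝ} (hv : ContDiffOn ℝ 1 v (Icc (-1) 1 ×ˢ univ))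
    {z : ℝ × ℝ} (hz : z ∈ Icc (-1 : ℝ) 1 ×ˢ (univ : Set ℝ)) :
    HasDerivAt (fun t => v (z.1, t))
      (fderivWithin ℝ v (Icc (-1) 1 ×ˢ univ) z (0, 1)) z.2 := by
  have h1 := (hv.differentiableOn (by norm_num) z hz).hasFDerivWithinAt
  have h2 : HasDerivWithinAt (fun t : ℝ => (z.1, t)) (0, 1) univ z.2 :=
    (hasDerivWithinAt_const _ _ _).prodMk (hasDerivWithinAt_id _ _)
  rw [← hasDerivWithinAt_univ]
  exact HasFDerivWithinAt.comp_hasDerivWithinAt z.2 h1 h2 fun s _ => ⟨hz.1, mem_univ _⟩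

theorem dRho_eq {v : ℝ × ℝ → ℝ} (hv : ContDiffOn ℝ 1 v (Icc (-1) 1 ×ˢ univ))
    {z : ℝ × ℝ} (hz : z ∈ Icc (-1 : ℝ) 1 ×ˢ (univ : Set ℝ)) :
    dRho v z = fderivWithin ℝ v (Icc (-1) 1 ×ˢ univ) z (1, 0) :=
  (hasDerivWithinAt_rho hv hz).derivWithin (uniqueDiffOn_Icc (by norm_num) _ hz.1)

theorem dPhi_eq {v : ℝ × ℝ → ℝ} (hv : ContDiffOn ℝ 1 v (Icc (-1) 1 ×ˢ univ))
    {z : ℝ × ℝ} (hz : z ∈ Icc (-1 : ℝ) 1 ×ˢ (univ : Set ℝ)) :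
    dPhi v z = fderivWithin ℝ v (Icc (-1) 1 ×ˢ univ) z (0, 1) :=
  (hasDerivAt_phi hv hz).deriv

theorem continuousOn_dRho {v : ℝ × ℝ → ℝ} (hv : ContDiffOn ℝ 1 v (Icc (-1) 1 ×ˢ univ)) :
    ContinuousOn (dRho v) (Icc (-1) 1 ×ˢ univ) :=
  ((hv.continuousOn_fderivWithin uniqueDiffOn_strip le_rfl).clm_apply continuousOn_const).congr
    fun _ hz => dRho_eq hv hz

theorem continuousOn_dPhi {v : ℝ × ℝ → ℝ} (hv : ContDiffOn ℝ 1 v (Icc (-1) 1 ×ˢ univ)) :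
    ContinuousOn (dPhi v) (Icc (-1) 1 ×ˢ univ) :=
  ((hv.continuousOn_fderivWithin uniqueDiffOn_strip le_rfl).clm_apply continuousOn_const).congr
    fun _ hz => dPhi_eq hv hz

theorem dRho_sub {v w : ℝ × ℝ → ℝ} (hv : ContDiffOn ℝ 1 v (Icc (-1) 1 ×ˢ univ))
    (hw : ContDiffOn ℝ 1 w (Icc (-1) 1 ×ˢ univ)) {z : ℝ × ℝ}
    (hz : z ∈ Icc (-1 : ℝ) 1 ×ˢ (univ : Set ℝ)) :
    dRho (fun z => v z - w z) z = dRho v z - dRho w z := by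
  rw [dRho_eq hv hz, dRho_eq hw hz]
  exact ((hasDerivWithinAt_rho hv hz).sub (hasDerivWithinAt_rho hw hz)).derivWithin
    (uniqueDiffOn_Icc (by norm_num) _ hz.1)

theorem dPhi_sub {v w : ℝ × ℝ → ℝ} (hv : ContDiffOn ℝ 1 v (Icc (-1) 1 ×ˢ univ))
    (hw : ContDiffOn ℝ 1 w (Icc (-1) 1 ×ˢ univ)) {z : ℝ × ℝ}
    (hz : z ∈ Icc (-1 : ℝ) 1 ×ˢ (univ : Set ℝ)) :
    dPhi (fun z => v z - w z) z = dPhi v z - dPhi w z := by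
  rw [dPhi_eq hv hz, dPhi_eq hw hz]
  exact ((hasDerivAt_phi hv hz).sub (hasDerivAt_phi hw hz)).deriv

/-- `e` and its first derivatives are bounded by `δ` in the supremum norm and by `η` in `L¹`. -/
structure ErrBound (δ η : ℝ) (e : ℝ × ℝ → ℝ) : Prop where
  contDiffOn : ContDiffOn ℝ 1 e (Icc (-1) 1 ×ˢ univ)
  abs_le : ∀ z ∈ Icc (-1 : ℝ) 1 ×ˢ (univ : Set ℝ), |e z| ≤ δ
  abs_dRho_le : ∀ z ∈ Icc (-1 : ℝ) 1 ×ˢ (univ : Set ℝ), |dRho e z| ≤ δ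
  abs_dPhi_le : ∀ z ∈ Icc (-1 : ℝ) 1 ×ˢ (univ : Set ℝ), |dPhi e z| ≤ δ
  integral_le : ∫ z in domain, |e z| ≤ η
  integral_dRho_le : ∫ z in domain, |dRho e z| ≤ η
  integral_dPhi_le : ∫ z in domain, |dPhi e z| ≤ η

theorem hasDerivAt_errTerm_fst {M : ℕ} (c : ℤ × ℤ → ℝ) {t t' : ℤ → ℝ → ℝ} (x y : ℤ → ℝ → ℝ)
    (ht : ∀ j θ, HasDerivAt (t j) (t' j θ) θ) (p : ℤ × ℤ) (θ φ : ℝ) :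
    HasDerivAt (fun θ => errTerm M c t x y p (θ, φ)) (errTerm M c t' x y p (θ, φ)) θ :=
  (((ht p.1 θ).mul_const (x p.2 φ)).fun_sub
    ((ht (centeredMod M p.1) θ).mul_const (y p.2 φ))).const_mul (c p)

theorem hasDerivAt_errTerm_snd {M : ℕ} (c : ℤ × ℤ → ℝ) (t : ℤ → ℝ → ℝ) {x x' y y' : ℤ → ℝ → ℝ}
    (hx : ∀ k φ, HasDerivAt (x k) (x' k φ) φ) (hy : ∀ k φ, HasDerivAt (y k) (y' k φ) φ)
    (p : ℤ × ℤ) (θ φ : ℝ) :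
    HasDerivAt (fun φ => errTerm M c t x y p (θ, φ)) (errTerm M c t x' y' p (θ, φ)) φ :=
  (((hx p.2 φ).const_mul (t p.1 θ)).fun_sub
    ((hy p.2 φ).const_mul (t (centeredMod M p.1) θ))).const_mul (c p)

theorem CoefDecay.continuous_tsum_errTerm {l : ℕ} {A : ℝ} {c : ℤ × ℤ → ℝ}
    (hc : CoefDecay l A c) (hl : 5 ≤ l) {M : ℕ} (hM : 0 < M) {t x y : ℤ → ℝ → ℝ}
    (ht : ∀ j, Continuous (t j)) (hx : ∀ k, Continuous (x k)) (hy : ∀ k, Continuous (y k))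
    (htj : ∀ j θ, |t j θ| ≤ 1 + |(j : ℝ)|) (hxk : ∀ k φ, |x k φ| ≤ 2 * (1 + |(k : ℝ)|))
    (hyk : ∀ k φ, |y k φ| ≤ 2 * (1 + |(k : ℝ)|)) :
    Continuous fun z : ℝ × ℝ => ∑' p, errTerm M c t x y p z :=
  continuous_tsum (fun p => continuous_errTerm ht hx hy p)
    ((hc.summable_mul_pow (a := 1) (b := 1) (by omega) (by omega)).mul_left 4)
    fun p z => abs_errTerm_le hM c htj hxk hyk p z

/-- In `(θ, φ)` the error and its derivatives are series of the form `errTerm`, with differentiated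
modes in one slot. What remains is the passage from `∂_θ` back to `∂_ρ`, which differ by the factor
`-sin θ`. -/
theorem CoefDecay.errBound {l : ℕ} {A : ℝ} {c : ℤ × ℤ → ℝ} (hc : CoefDecay l A c) (hl : 5 ≤ l)
    {v : ℝ × ℝ → ℝ} (hv : ContDiffOn ℝ 1 v (Icc (-1) 1 ×ˢ univ))
    (hsum : ∀ θ φ, HasSum (fun p : ℤ × ℤ => c p * (Real.cos (p.1 * θ) * cas (p.2 * φ)))
      (v (Real.cos θ, φ))) {M q : ℕ} (hM : 0 < M) (hq : 0 < q) :
    ErrBound (errConst l A * (1 / M + 1 / q))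
      (errConst l A * (((M : ℝ) ^ (l - 2))⁻¹ + ((q : ℝ) ^ (l - 1))⁻¹))
      (fun z => v z - interp M (2 * q) v z) := by
  set e : ℝ × ℝ → ℝ := fun z => v z - interp M (2 * q) v z with he_def
  have hsm := hc.summable_mul_pow (a := 1) (b := 1) (by omega) (by omega)
  have hcs : Summable c := by
    have h0 := hc.summable_mul_pow (a := 0) (b := 0) (by omega) (by omega)
    simp only [pow_zero, mul_one] at h0
    exact h0.of_abs
  have heC : ContDiffOn ℝ 1 e (Icc (-1) 1 ×ˢ univ) :=
    hv.sub ((isInterpolant_interp hM (by omega) (even_two_mul q) v).1.contDiff.contDiffOn)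
  set tC : ℤ → ℝ → ℝ := fun j θ => Real.cos (j * θ) with htC
  set tS : ℤ → ℝ → ℝ := fun j θ => -j * Real.sin (j * θ) with htS
  set xC : ℤ → ℝ → ℝ := fun k φ => cas (k * φ) with hxC
  set xS : ℤ → ℝ → ℝ := fun k φ => k * cas (-k * φ) with hxS
  set yC : ℤ → ℝ → ℝ := fun k φ => aliasCas q (centeredMod q k) φ with hyC
  set yS : ℤ → ℝ → ℝ := fun k φ => aliasCasDeriv q (centeredMod q k) φ with hyS
  have htC0 : ∀ j, Continuous (tC j) := fun j => by simp only [htC]; fun_prop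
  have htS0 : ∀ j, Continuous (tS j) := fun j => by simp only [htS]; fun_prop
  have hxC0 : ∀ j, Continuous (xC j) := fun j => by
    have := continuous_cas
    simp only [hxC]; fun_prop
  have hxS0 : ∀ j, Continuous (xS j) := fun j => by
    have := continuous_cas
    simp only [hxS]; fun_prop
  have hyC0 : ∀ j, Continuous (yC j) := fun j => continuous_aliasCas q _
  have hyS0 : ∀ j, Continuous (yS j) := fun j => continuous_aliasCasDeriv q _
  have htC1 : ∀ j θ, |tC j θ| ≤ 1 + |(j : ℝ)| := fun j θ => by
    have := Real.abs_cos_le_one (j * θ)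
    have := abs_nonneg (j : ℝ)
    simp only [htC]
    linarith
  have htS1 : ∀ j θ, |tS j θ| ≤ 1 + |(j : ℝ)| := fun j θ => by
    have h1 := Real.abs_sin_le_one (j * θ)
    have h2 := abs_nonneg (j : ℝ)
    simp only [htS, abs_mul, abs_neg]
    nlinarith
  have hxC1 : ∀ k φ, |xC k φ| ≤ 2 * (1 + |(k : ℝ)|) := fun k φ => by
    have := abs_cas_le (k * φ)
    have := abs_nonneg (k : ℝ)
    simp only [hxC]
    linarith
  have hxS1 : ∀ k φ, |xS k φ| ≤ 2 * (1 + |(k : ℝ)|) := fun k φ =>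
    (abs_int_mul_cas_le k _).trans (by linarith)
  have hyC1 : ∀ k φ, |yC k φ| ≤ 2 * (1 + |(k : ℝ)|) := fun k φ =>
    (abs_aliasCas_le q _ φ).trans (by linarith [abs_nonneg (k : ℝ)])
  have hyS1 : ∀ k φ, |yS k φ| ≤ 2 * (1 + |(k : ℝ)|) := fun k φ =>
    (abs_aliasCasDeriv_le q _ φ).trans (by linarith [abs_cast_centeredMod_le hq k])
  have hDC : BlockBound q fun k φ => xC k φ - yC k φ := blockBound_aliasErr q
  have hDS : BlockBound q fun k φ => xS k φ - yS k φ := blockBound_aliasErrDeriv hq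
  have hE : ∀ θ φ, HasSum (fun p => errTerm M c tC xC yC p (θ, φ)) (e (Real.cos θ, φ)) := by
    intro θ φ
    refine ((hsum θ φ).sub (interp_eq_tsum hM hq hcs hsum (Real.cos θ, φ))).congr_fun ?_
    intro p
    simp only [errTerm, htC, hxC, hyC, Polynomial.Chebyshev.T_real_cos]
    ring
  have hEθ : ∀ θ φ, HasDerivAt (fun θ => e (Real.cos θ, φ))
      (∑' p, errTerm M c tS xC yC p (θ, φ)) θ := by
    intro θ φ
    have h1 := hasDerivAt_tsum (g := fun p θ => errTerm M c tC xC yC p (θ, φ))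
      (g' := fun p θ => errTerm M c tS xC yC p (θ, φ)) (y₀ := θ) (hsm.mul_left 4)
      (fun p x => hasDerivAt_errTerm_fst c xC yC (fun j => hasDerivAt_cos_mul j) p x φ)
      (fun p x => abs_errTerm_le hM c htS1 hxC1 hyC1 p (x, φ)) (hE θ φ).summable θ
    refine h1.congr_of_eventuallyEq (Eventually.of_forall fun x => ?_)
    exact (hE x φ).tsum_eq.symm
  have hEφ : ∀ θ φ, HasDerivAt (fun φ => e (Real.cos θ, φ))
      (∑' p, errTerm M c tC xS yS p (θ, φ)) φ := by
    intro θ φ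
    have h1 := hasDerivAt_tsum (g := fun p φ => errTerm M c tC xC yC p (θ, φ))
      (g' := fun p φ => errTerm M c tC xS yS p (θ, φ)) (y₀ := φ) (hsm.mul_left 4)
      (fun p x => hasDerivAt_errTerm_snd c tC (fun k => hasDerivAt_cas k)
        (fun k => hasDerivAt_aliasCas q _) p θ x)
      (fun p x => abs_errTerm_le hM c htC1 hxS1 hyS1 p (θ, x)) (hE θ φ).summable φ
    refine h1.congr_of_eventuallyEq (Eventually.of_forall fun x => ?_)
    exact (hE θ x).tsum_eq.symm
  have hval : ∀ θ φ, e (Real.cos θ, φ) = ∑' p, errTerm M c tC xC yC p (θ, φ) :=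
    fun θ φ => (hE θ φ).tsum_eq.symm
  have hphi : ∀ θ φ, dPhi e (Real.cos θ, φ) = ∑' p, errTerm M c tC xS yS p (θ, φ) :=
    fun θ φ => (hEφ θ φ).deriv
  have hrho : ∀ θ ∈ Ioo 0 Real.pi, ∀ φ, dRho e (Real.cos θ, φ) * -Real.sin θ
      = ∑' p, errTerm M c tS xC yC p (θ, φ) := by
    intro θ hθ φ
    have hmem := cos_mem_Ioo hθ
    have hS : (Real.cos θ, φ) ∈ Icc (-1 : ℝ) 1 ×ˢ (univ : Set ℝ) :=
      ⟨Ioo_subset_Icc_self hmem, mem_univ _⟩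
    have h1 := (hasDerivWithinAt_rho heC hS).hasDerivAt (Icc_mem_nhds hmem.1 hmem.2)
    rw [← dRho_eq heC hS] at h1
    exact (HasDerivAt.comp (h₂ := fun s => e (s, φ)) θ h1 (Real.hasDerivAt_cos θ)).unique
      (hEθ θ φ)
  have hcC := hc.continuous_tsum_errTerm hl hM htC0 hxC0 hyC0 htC1 hxC1 hyC1
  have hcS := hc.continuous_tsum_errTerm hl hM htC0 hxS0 hyS0 htC1 hxS1 hyS1
  have htC2 : ∀ θ (j : ℤ), |tC j θ| ≤ (1 + |(j : ℝ)|) ^ 2 * 1 := fun θ j =>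
    (htC1 j θ).trans (by nlinarith [abs_nonneg (j : ℝ)])
  have hsin : ∀ z ∈ angleDomain, 0 ≤ Real.sin z.1 ∧ Real.sin z.1 ≤ 1 := fun z hz =>
    ⟨(Real.sin_pos_of_mem_Ioo hz.1).le, Real.sin_le_one _⟩
  -- For the values and the derivative in `φ` the Jacobian is not needed and is bounded by one.
  have hint : ∀ {g : ℝ × ℝ → ℝ}, Continuous g →
      ∫ z in angleDomain, Real.sin z.1 * |g z| ≤ ∫ z in angleDomain, |g z| := by
    intro g hg
    refine setIntegral_mono_on (integrableOn_angle_of_continuous (by fun_prop))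
      (integrableOn_angle_of_continuous hg.abs) measurableSet_angleDomain fun z hz => ?_
    have := hsin z hz
    nlinarith [abs_nonneg (g z)]
  refine ⟨heC, ?_, ?_, ?_, ?_, ?_, ?_⟩
  · intro z hz
    have h1 := hc.abs_tsum_errTerm_le hl hM hq hDC hxC1 hyC1 (z := (Real.arccos z.1, z.2))
      zero_le_one (htC2 _)
    rwa [← hval, Real.cos_arccos hz.1.1 hz.1.2, one_mul] at h1
  · have h1 : ∀ z ∈ Ioo (-1 : ℝ) 1 ×ˢ (univ : Set ℝ),
        |dRho e z| ≤ errConst l A * (1 / M + 1 / q) := by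
      rintro ⟨ρ, φ⟩ ⟨hρ, -⟩
      rw [← cos_image_Ioo] at hρ
      obtain ⟨θ, hθ, rfl⟩ := hρ
      have hs := Real.sin_pos_of_mem_Ioo hθ
      -- With `τ = sin θ`: the derivative `-j sin jθ` is at most `j² sin θ`, so the factor `sin θ`
      -- cancels against the chain rule.
      have h2 := hc.abs_tsum_errTerm_le hl hM hq hDC hxC1 hyC1 (z := (θ, φ)) (t := tS)
        (τ := Real.sin θ) hs.le (fun j => by
          have h3 := abs_sin_int_mul_le j θ
          rw [abs_of_pos hs] at h3
          have h4 := abs_nonneg (j : ℝ)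
          simp only [htS, abs_mul, abs_neg]
          calc |(j : ℝ)| * |Real.sin (j * θ)| ≤ |(j : ℝ)| * (|(j : ℝ)| * Real.sin θ) := by gcongr
            _ ≤ _ := by nlinarith [mul_nonneg h4 hs.le])
      rw [← hrho θ hθ φ, abs_mul, abs_neg, abs_of_pos hs, mul_comm] at h2
      exact le_of_mul_le_mul_left h2 hs
    -- The angle argument divides by `sin θ > 0`, so the sides `ρ = ±1` are reached by continuity of
    -- the derivative.
    have hcl : closure (Ioo (-1 : ℝ) 1 ×ˢ (univ : Set ℝ)) = Icc (-1) 1 ×ˢ univ := by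
      rw [closure_prod_eq, closure_Ioo (by norm_num), closure_univ]
    intro z hz
    rw [← hcl] at hz
    refine le_on_closure h1 ?_ continuousOn_const hz
    rw [hcl]
    exact (continuousOn_dRho heC).abs
  · intro z hz
    have h1 := hc.abs_tsum_errTerm_le hl hM hq hDS hxS1 hyS1 (z := (Real.arccos z.1, z.2))
      zero_le_one (htC2 _)
    rwa [← hphi, Real.cos_arccos hz.1.1 hz.1.2, one_mul] at h1
  · rw [integral_domain]
    simp only [hval]
    exact (hint hcC).trans
      (hc.integral_abs_tsum_errTerm_le hl hM hq hDC htC0 hyC0 htC1 hyC1)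
  · rw [integral_domain]
    -- Here the Jacobian is essential: `sin θ |∂_ρ e|` is exactly `|∂_θ e|`.
    refine le_trans (le_of_eq ?_)
      (hc.integral_abs_tsum_errTerm_le hl hM hq hDC htS0 hyC0 htS1 hyC1)
    refine setIntegral_congr_fun measurableSet_angleDomain fun z hz => ?_
    have hs := Real.sin_pos_of_mem_Ioo hz.1
    have h1 := hrho z.1 hz.1 z.2
    rw [Prod.mk.eta] at h1
    rw [← h1, abs_mul, abs_neg, abs_of_pos hs, mul_comm]
  · rw [integral_domain]
    simp only [hphi]
    exact (hint hcS).trans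
      (hc.integral_abs_tsum_errTerm_le hl hM hq hDS htC0 hyS0 htC1 hyS1)

theorem MemSobolev.exists_errBound {l : ℕ} (hl : 5 ≤ l) {v : ℝ × ℝ → ℝ} (hs : MemSobolev l l v)
    (hv : ContDiffOn ℝ 1 v (Icc (-1) 1 ×ˢ univ)) (hper : PeriodicPhi v) :
    ∃ C : ℝ, 0 ≤ C ∧ ∀ M q : ℕ, 0 < M → 0 < q →
      ErrBound (C * (1 / M + 1 / q))
        (C * (((M : ℝ) ^ (l - 2))⁻¹ + ((q : ℝ) ^ (l - 1))⁻¹))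
        (fun z => v z - interp M (2 * q) v z) := by
  obtain ⟨B, hB, hdec⟩ := hs.exists_decay
  have hpi : 1 ≤ 2 * Real.pi ^ 2 := by nlinarith [Real.pi_gt_three]
  -- `B + 1` is positive even if `B = 0`, and its square dominates `B`, as `CoefDecay` requires.
  have hcoefDecay : CoefDecay l (B + 1) fun p => hcoef v p.1 p.2 := by
    refine ⟨by linarith, fun j s => (hdec j s).trans (by nlinarith)⟩
  have hc : CoefDecay l (B + 1) fun p => hcoef v p.1 p.2 / (2 * Real.pi ^ 2) := by
    refine ⟨by linarith, fun j s => (Finset.sum_le_sum fun k _ => ?_).trans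
      (hcoefDecay.sum_le j s)⟩
    rw [← mul_div_assoc, div_pow]
    exact div_le_self (sq_nonneg _) (one_le_pow₀ hpi)
  have hsum : Summable fun p : ℤ × ℤ => hcoef v p.1 p.2 := by
    have h0 := hcoefDecay.summable_mul_pow (a := 0) (b := 0) (by omega) (by omega)
    simp only [pow_zero, mul_one] at h0
    exact h0.of_abs
  exact ⟨errConst l (B + 1), errConst_nonneg l (by linarith), fun M q hM hq =>
    hc.errBound hl hv (fun θ φ => hasSum_hcoef hv.continuousOn hper hsum θ φ) hM hq⟩

/-! ### Stability of the energy under small `C¹` perturbations -/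

/-- A `C¹` function is locally Lipschitz, and compactness makes constant and radius uniform. The
point `y` may leave `K`; balls are halved so that `x` and `y` lie in a common ball of Lipschitz
continuity. -/
theorem exists_lipschitz_near_compact {V : Type*} [NormedAddCommGroup V] [NormedSpace ℝ V]
    {G : V → ℝ} {K U : Set V} (hK : IsCompact K) (hU : IsOpen U) (hKU : K ⊆ U)
    (hG : ∀ x ∈ K, ContDiffAt ℝ 1 G x) :
    ∃ L : ℝ, 0 ≤ L ∧ ∃ δ > 0, ∀ x ∈ K, ∀ y, dist y x < δ →
      y ∈ U ∧ |G y - G x| ≤ L * dist y x := by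
  refine hK.induction_on (p := fun s => ∃ L : ℝ, 0 ≤ L ∧ ∃ δ > 0, ∀ x ∈ s, ∀ y, dist y x < δ →
      y ∈ U ∧ |G y - G x| ≤ L * dist y x) ?_ ?_ ?_ ?_
  · exact ⟨0, le_rfl, 1, one_pos, fun x hx => hx.elim⟩
  · rintro s t hst ⟨L, hL, δ, hδ, h⟩
    exact ⟨L, hL, δ, hδ, fun x hx => h x (hst hx)⟩
  · rintro s t ⟨L, hL, δ, hδ, h⟩ ⟨L', hL', δ', hδ', h'⟩
    refine ⟨max L L', hL.trans (le_max_left _ _), min δ δ', lt_min hδ hδ', ?_⟩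
    rintro x (hx | hx) y hy
    · obtain ⟨h1, h2⟩ := h x hx y (hy.trans_le (min_le_left _ _))
      exact ⟨h1, h2.trans (by gcongr; exact le_max_left _ _)⟩
    · obtain ⟨h1, h2⟩ := h' x hx y (hy.trans_le (min_le_right _ _))
      exact ⟨h1, h2.trans (by gcongr; exact le_max_right _ _)⟩
  · intro x hx
    obtain ⟨L, t, ht, hL⟩ := (hG x hx).exists_lipschitzOnWith
    obtain ⟨r, hr, hball⟩ := Metric.mem_nhds_iff.1 (inter_mem ht (hU.mem_nhds (hKU hx)))
    refine ⟨Metric.ball x (r / 2),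
      mem_nhdsWithin_of_mem_nhds (Metric.ball_mem_nhds _ (by positivity)), L, L.2, r / 2, by positivity, fun a ha y hy => ?_⟩
    have ha' : a ∈ Metric.ball x r := Metric.ball_subset_ball (by linarith) ha
    have hy' : y ∈ Metric.ball x r := by
      rw [Metric.mem_ball] at ha ⊢
      linarith [dist_triangle y a x]
    exact ⟨(hball hy').2, hL.dist_le_mul y (hball hy').1 a (hball ha').1⟩

/-! ### The energy density as a function of the jet -/

/-- The variables of the energy density: `1/r`, `P`, `P_ρ`, `P_φ`, `Q_ρ`, `Q_φ`. -/
abbrev JetSpace : Type := ℝ × ℝ × ℝ × ℝ × ℝ × ℝ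

/-- `D` as a function of the jet. -/
def detVar (R : ℝ) (x : JetSpace) : ℝ :=
  R * x.1 * x.2.1 * (x.2.2.1 * (x.2.2.2.2.2 + 1) - x.2.2.2.1 * x.2.2.2.2.1)

/-- `F` as a function of the jet. -/
def normVar (R : ℝ) (x : JetSpace) : ℝ :=
  R ^ 2 / 2 * (x.2.2.1 ^ 2 + x.2.1 ^ 2 * x.2.2.2.2.1 ^ 2)
    + x.1 ^ 2 / 2 * (x.2.2.2.1 ^ 2 + x.2.1 ^ 2 * (x.2.2.2.2.2 + 1) ^ 2)

/-- `g(F) + h(D)` as a function of the jet. -/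
def density (κ p : ℝ) (h : ℝ → ℝ) (R : ℝ) (x : JetSpace) : ℝ :=
  κ * Real.sqrt (2 * normVar R x) ^ p + h (detVar R x)

/-- The jet of `(P, Q)` at a point. -/
def jet (ε γ : ℝ) (P Q : ℝ × ℝ → ℝ) (z : ℝ × ℝ) : JetSpace :=
  ((radius ε γ z.1)⁻¹, P z, dRho P z, dPhi P z, dRho Q z, dPhi Q z)

theorem detD_eq (ε γ : ℝ) (P Q : ℝ × ℝ → ℝ) (z : ℝ × ℝ) :
    detD ε γ P Q z = detVar (rhoR ε γ) (jet ε γ P Q z) := by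
  simp only [detD, detVar, jet]
  ring

theorem normF_eq (ε γ : ℝ) (P Q : ℝ × ℝ → ℝ) (z : ℝ × ℝ) :
    normF ε γ P Q z = normVar (rhoR ε γ) (jet ε γ P Q z) := by
  simp only [normF, normVar, jet]
  ring

theorem energyIntegrand_eq (κ p ε γ : ℝ) (h : ℝ → ℝ) (P Q : ℝ × ℝ → ℝ) (z : ℝ × ℝ) :
    energyIntegrand κ p ε γ h P Q z
      = density κ p h (rhoR ε γ) (jet ε γ P Q z) * (radius ε γ z.1 / rhoR ε γ) := by
  rw [energyIntegrand, density, detD_eq, normF_eq]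

theorem contDiff_detVar (R : ℝ) : ContDiff ℝ ∞ (detVar R) := by
  unfold detVar
  fun_prop

theorem contDiff_normVar (R : ℝ) : ContDiff ℝ ∞ (normVar R) := by
  unfold normVar
  fun_prop

theorem contDiffAt_density {κ p : ℝ} {h : ℝ → ℝ} (hh : ContDiffOn ℝ 1 h (Ioi 0)) {R : ℝ}
    {x : JetSpace} (hD : 0 < detVar R x) (hF : 0 < normVar R x) :
    ContDiffAt ℝ 1 (density κ p h R) x := by
  have h1 : ContDiffAt ℝ 1 (detVar R) x := ((contDiff_detVar R).of_le (by simp)).contDiffAt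
  have h2 : ContDiffAt ℝ 1 (normVar R) x := ((contDiff_normVar R).of_le (by simp)).contDiffAt
  have h3 : ContDiffAt ℝ 1 h (detVar R x) := hh.contDiffAt (Ioi_mem_nhds hD)
  have h4 : ContDiffAt ℝ 1 (fun x => Real.sqrt (2 * normVar R x)) x :=
    (contDiffAt_const.mul h2).sqrt (by positivity)
  exact (contDiffAt_const.mul (h4.rpow_const_of_ne (Real.sqrt_pos.2 (by positivity)).ne')).add
    (h3.comp x h1)

theorem continuousAt_density {κ p : ℝ} (hp : 0 ≤ p) {h : ℝ → ℝ} (hh : ContinuousOn h (Ioi 0))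
    {R : ℝ} {x : JetSpace} (hD : 0 < detVar R x) : ContinuousAt (density κ p h R) x := by
  have h1 : Continuous fun x => κ * Real.sqrt (2 * normVar R x) ^ p :=
    continuous_const.mul
      ((Real.continuous_sqrt.comp (continuous_const.mul (contDiff_normVar R).continuous)).rpow_const
        fun _ => Or.inr hp)
  have h2 : ContinuousAt h (detVar R x) := hh.continuousAt (Ioi_mem_nhds hD)
  exact h1.continuousAt.add
    (ContinuousAt.comp (f := detVar R) h2 (contDiff_detVar R).continuous.continuousAt)

/-- `A` is the deformation gradient in polar frames: its determinant is `D` and its squared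
Frobenius norm is `2F`. -/
theorem density_pos {κ p : ℝ} {h : ℝ → ℝ}
    (hW : ∀ A : Matrix (Fin 2) (Fin 2) ℝ, 0 < A.det → 0 < storedEnergy κ p h A) {R : ℝ}
    {x : JetSpace} (hD : 0 < detVar R x) : 0 < density κ p h R x := by
  set A : Matrix (Fin 2) (Fin 2) ℝ :=
    !![R * x.2.2.1, x.1 * x.2.2.2.1;
      R * x.2.1 * x.2.2.2.2.1, x.1 * x.2.1 * (x.2.2.2.2.2 + 1)] with hA
  have h1 : A.det = detVar R x := by
    rw [hA, Matrix.det_fin_two_of, detVar]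
    ring
  have h2 : ∑ i, ∑ j, A i j ^ 2 = 2 * normVar R x := by
    simp only [hA, Fin.sum_univ_two, Matrix.of_apply, Matrix.cons_val', Matrix.cons_val_zero,
      Matrix.cons_val_one, Matrix.cons_val_fin_one, normVar]
    ring
  have h3 := hW A (h1 ▸ hD)
  rwa [storedEnergy, h1, h2] at h3

theorem closedDomain_subset_strip : closedDomain ⊆ Icc (-1 : ℝ) 1 ×ˢ (univ : Set ℝ) :=
  prod_mono subset_rfl (subset_univ _)

theorem domain_subset_closedDomain : domain ⊆ closedDomain :=
  prod_mono Ioo_subset_Icc_self Ioo_subset_Icc_self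

theorem isCompact_closedDomain : IsCompact closedDomain := isCompact_Icc.prod isCompact_Icc

theorem integrableOn_domain_of_continuousOn {f : ℝ × ℝ → ℝ} (hf : ContinuousOn f closedDomain) :
    IntegrableOn f domain :=
  (hf.integrableOn_compact isCompact_closedDomain).mono_set domain_subset_closedDomain

theorem radius_pos {ε γ : ℝ} (hε : 0 < ε) (hεγ : ε < γ) {ρ : ℝ} (hρ : ρ ∈ Icc (-1 : ℝ) 1) :
    0 < radius ε γ ρ := by
  unfold radius
  nlinarith [hρ.1]

theorem rhoR_pos {ε γ : ℝ} (hεγ : ε < γ) : 0 < rhoR ε γ := by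
  have : 0 < γ - ε := by linarith
  unfold rhoR
  positivity

theorem radius_div_rhoR_le_one {ε γ : ℝ} (hε : 0 < ε) (hεγ : ε < γ) (hγ : γ ≤ 1) {ρ : ℝ}
    (hρ : ρ ∈ Icc (-1 : ℝ) 1) : radius ε γ ρ / rhoR ε γ ≤ 1 := by
  have h1 : 0 < γ - ε := by linarith
  have h2 : 1 ≤ rhoR ε γ := by
    rw [rhoR, le_div_iff₀ h1]
    linarith
  rw [div_le_one (rhoR_pos hεγ)]
  refine le_trans ?_ h2
  unfold radius
  nlinarith [hρ.2]

theorem continuousOn_jet {ε γ : ℝ} (hε : 0 < ε) (hεγ : ε < γ) {P Q : ℝ × ℝ → ℝ}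
    (hP : ContDiffOn ℝ 1 P (Icc (-1) 1 ×ˢ univ)) (hQ : ContDiffOn ℝ 1 Q (Icc (-1) 1 ×ˢ univ)) :
    ContinuousOn (jet ε γ P Q) closedDomain := by
  have h1 : ContinuousOn (fun z : ℝ × ℝ => (radius ε γ z.1)⁻¹) closedDomain := by
    refine ContinuousOn.inv₀ ?_ fun z hz => (radius_pos hε hεγ hz.1).ne'
    unfold radius
    fun_prop
  exact h1.prodMk ((hP.continuousOn.prodMk ((continuousOn_dRho hP).prodMk
    ((continuousOn_dPhi hP).prodMk ((continuousOn_dRho hQ).prodMk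
      (continuousOn_dPhi hQ))))).mono closedDomain_subset_strip)

theorem continuousOn_energyIntegrand {κ p ε γ : ℝ} (hp : 0 ≤ p) (hε : 0 < ε) (hεγ : ε < γ)
    {h : ℝ → ℝ} (hh : ContinuousOn h (Ioi 0)) {P Q : ℝ × ℝ → ℝ}
    (hP : ContDiffOn ℝ 1 P (Icc (-1) 1 ×ˢ univ)) (hQ : ContDiffOn ℝ 1 Q (Icc (-1) 1 ×ˢ univ))
    (hD : ∀ z ∈ closedDomain, 0 < detD ε γ P Q z) :
    ContinuousOn (energyIntegrand κ p ε γ h P Q) closedDomain := by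
  have h1 : ContinuousOn (fun z => density κ p h (rhoR ε γ) (jet ε γ P Q z)) closedDomain := by
    intro z hz
    refine ContinuousAt.comp_continuousWithinAt (f := jet ε γ P Q)
      (continuousAt_density hp hh ?_) (continuousOn_jet hε hεγ hP hQ z hz)
    rw [← detD_eq]
    exact hD z hz
  have h2 : Continuous fun z : ℝ × ℝ => radius ε γ z.1 / rhoR ε γ := by
    unfold radius
    fun_prop
  exact (h1.mul h2.continuousOn).congr fun z _ => energyIntegrand_eq κ p ε γ h P Q z

theorem energy_pos {κ p ε γ : ℝ} (hp : 0 ≤ p) (hε : 0 < ε) (hεγ : ε < γ)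
    {h : ℝ → ℝ} (hh : ContinuousOn h (Ioi 0))
    (hW : ∀ A : Matrix (Fin 2) (Fin 2) ℝ, 0 < A.det → 0 < storedEnergy κ p h A)
    {P Q : ℝ × ℝ → ℝ}
    (hP : ContDiffOn ℝ 1 P (Icc (-1) 1 ×ˢ univ)) (hQ : ContDiffOn ℝ 1 Q (Icc (-1) 1 ×ˢ univ))
    (hD : ∀ z ∈ closedDomain, 0 < detD ε γ P Q z) : 0 < energy κ p ε γ h P Q := by
  have hpos : ∀ z ∈ domain, 0 < energyIntegrand κ p ε γ h P Q z := by
    intro z hz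
    have hz' := domain_subset_closedDomain hz
    rw [energyIntegrand_eq]
    refine mul_pos (density_pos hW ?_) (div_pos (radius_pos hε hεγ hz'.1) (rhoR_pos hεγ))
    rw [← detD_eq]
    exact hD z hz'
  have hint := integrableOn_domain_of_continuousOn
    (continuousOn_energyIntegrand (κ := κ) hp hε hεγ hh hP hQ hD)
  rw [energy, setIntegral_pos_iff_support_of_nonneg_ae
    (ae_restrict_of_forall_mem measurableSet_domain fun z hz => (hpos z hz).le) hint]
  have hsupp : domain ⊆ Function.support (energyIntegrand κ p ε γ h P Q) ∩ domain :=
    fun z hz => ⟨(hpos z hz).ne', hz⟩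
  refine lt_of_lt_of_le ?_ (measure_mono hsupp)
  refine (isOpen_Ioo.prod isOpen_Ioo).measure_pos volume ⟨(0, 1), ⟨?_, ?_⟩⟩
  · constructor <;> norm_num
  · constructor
    · exact one_pos
    · simp only
      linarith [Real.pi_gt_three]

theorem ErrBound.mono {δ δ' η η' : ℝ} {e : ℝ × ℝ → ℝ} (h : ErrBound δ η e) (hδ : δ ≤ δ')
    (hη : η ≤ η') : ErrBound δ' η' e :=
  ⟨h.contDiffOn, fun z hz => (h.abs_le z hz).trans hδ, fun z hz => (h.abs_dRho_le z hz).trans hδ,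
    fun z hz => (h.abs_dPhi_le z hz).trans hδ, h.integral_le.trans hη,
    h.integral_dRho_le.trans hη, h.integral_dPhi_le.trans hη⟩

/-- The coordinate `1/r` is common to both jets, and `Q` itself enters neither `D` nor `F`. Five
differences remain, hence the factor `5` in the stability estimate. -/
theorem dist_jet_le {ε γ : ℝ} {P Q P' Q' : ℝ × ℝ → ℝ}
    (hP : ContDiffOn ℝ 1 P (Icc (-1) 1 ×ˢ univ)) (hQ : ContDiffOn ℝ 1 Q (Icc (-1) 1 ×ˢ univ))
    (hP' : ContDiffOn ℝ 1 P' (Icc (-1) 1 ×ˢ univ)) (hQ' : ContDiffOn ℝ 1 Q' (Icc (-1) 1 ×ˢ univ))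
    {z : ℝ × ℝ} (hz : z ∈ Icc (-1 : ℝ) 1 ×ˢ (univ : Set ℝ)) :
    dist (jet ε γ P' Q' z) (jet ε γ P Q z)
      ≤ |P z - P' z| + |dRho (fun z => P z - P' z) z| + |dPhi (fun z => P z - P' z) z|
        + |dRho (fun z => Q z - Q' z) z| + |dPhi (fun z => Q z - Q' z) z| := by
  rw [dRho_sub hP hP' hz, dPhi_sub hP hP' hz, dRho_sub hQ hQ' hz, dPhi_sub hQ hQ' hz]
  simp only [jet, Prod.dist_eq, Real.dist_eq, sub_self, abs_zero]
  rw [abs_sub_comm (P' z), abs_sub_comm (dRho P' z), abs_sub_comm (dPhi P' z),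
    abs_sub_comm (dRho Q' z), abs_sub_comm (dPhi Q' z)]
  have h1 := abs_nonneg (P z - P' z)
  have h2 := abs_nonneg (dRho P z - dRho P' z)
  have h3 := abs_nonneg (dPhi P z - dPhi P' z)
  have h4 := abs_nonneg (dRho Q z - dRho Q' z)
  have h5 := abs_nonneg (dPhi Q z - dPhi Q' z)
  refine max_le ?_ (max_le ?_ (max_le ?_ (max_le ?_ (max_le ?_ ?_)))) <;> linarith

/-- Stability of the energy: a small `C¹` perturbation is admissible and changes the energy by at
most a multiple of its `W^{1,1}` size. -/
theorem exists_energy_stability {κ p ε γ : ℝ} (hp : 0 ≤ p) (hε : 0 < ε) (hεγ : ε < γ)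
    (hγ : γ ≤ 1) {h : ℝ → ℝ} (hh : ContDiffOn ℝ 1 h (Ioi 0)) {P Q : ℝ × ℝ → ℝ}
    (hP : ContDiffOn ℝ 1 P (Icc (-1) 1 ×ˢ univ)) (hQ : ContDiffOn ℝ 1 Q (Icc (-1) 1 ×ˢ univ))
    (hD : ∀ z ∈ closedDomain, 0 < detD ε γ P Q z)
    (hF : ∀ z ∈ closedDomain, 0 < normF ε γ P Q z) :
    ∃ L : ℝ, 0 ≤ L ∧ ∃ δ₀ > 0, ∀ P' Q' : ℝ × ℝ → ℝ,
      ContDiffOn ℝ 1 P' (Icc (-1) 1 ×ˢ univ) → ContDiffOn ℝ 1 Q' (Icc (-1) 1 ×ˢ univ) →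
      ∀ δ η : ℝ, ErrBound δ η (fun z => P z - P' z) → ErrBound δ η (fun z => Q z - Q' z) →
      5 * δ < δ₀ →
      (∀ z ∈ closedDomain, 0 < detD ε γ P' Q' z) ∧
      IntegrableOn (energyIntegrand κ p ε γ h P' Q') domain ∧
      |energy κ p ε γ h P' Q' - energy κ p ε γ h P Q| ≤ L * (5 * η) := by
  set R := rhoR ε γ with hR
  -- The compact set of jets lies in the open region `D > 0`, and at its points `F > 0` keeps the
  -- square root away from its singularity, so the density is `C¹` there.
  have hK : IsCompact (jet ε γ P Q '' closedDomain) :=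
    isCompact_closedDomain.image_of_continuousOn (continuousOn_jet hε hεγ hP hQ)
  obtain ⟨L, hL, δ₀, hδ₀, hlip⟩ := exists_lipschitz_near_compact (G := density κ p h R) hK
    (U := {x | 0 < detVar R x}) (isOpen_lt continuous_const (contDiff_detVar R).continuous)
    (by
      rintro _ ⟨z, hz, rfl⟩
      have := hD z hz
      rwa [detD_eq] at this)
    (by
      rintro _ ⟨z, hz, rfl⟩
      have h1 := hD z hz
      have h2 := hF z hz
      rw [detD_eq] at h1
      rw [normF_eq] at h2
      exact contDiffAt_density hh h1 h2)
  refine ⟨L, hL, δ₀, hδ₀, fun P' Q' hP' hQ' δ η heP heQ hδ => ?_⟩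
  set eP : ℝ × ℝ → ℝ := fun z => P z - P' z with heP_def
  set eQ : ℝ × ℝ → ℝ := fun z => Q z - Q' z with heQ_def
  have hdist : ∀ z ∈ closedDomain, dist (jet ε γ P' Q' z) (jet ε γ P Q z)
      ≤ |eP z| + |dRho eP z| + |dPhi eP z| + |dRho eQ z| + |dPhi eQ z| := fun z hz =>
    dist_jet_le hP hQ hP' hQ' (closedDomain_subset_strip hz)
  have hnear : ∀ z ∈ closedDomain, dist (jet ε γ P' Q' z) (jet ε γ P Q z) < δ₀ := by
    intro z hz
    have hz' := closedDomain_subset_strip hz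
    linarith [hdist z hz, heP.abs_le z hz', heP.abs_dRho_le z hz', heP.abs_dPhi_le z hz',
      heQ.abs_dRho_le z hz', heQ.abs_dPhi_le z hz']
  have hD' : ∀ z ∈ closedDomain, 0 < detD ε γ P' Q' z := by
    intro z hz
    rw [detD_eq]
    exact (hlip _ ⟨z, hz, rfl⟩ _ (hnear z hz)).1
  have hint := integrableOn_domain_of_continuousOn
    (continuousOn_energyIntegrand (κ := κ) hp hε hεγ hh.continuousOn hP hQ hD)
  have hint' := integrableOn_domain_of_continuousOn
    (continuousOn_energyIntegrand (κ := κ) hp hε hεγ hh.continuousOn hP' hQ' hD')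
  refine ⟨hD', hint', ?_⟩
  have hstrip : ∀ {f : ℝ × ℝ → ℝ}, ContinuousOn f (Icc (-1) 1 ×ˢ univ) →
      IntegrableOn (fun z => |f z|) domain := fun hf =>
    integrableOn_domain_of_continuousOn (hf.mono closedDomain_subset_strip).abs
  have i1 := hstrip heP.contDiffOn.continuousOn
  have i2 := hstrip (continuousOn_dRho heP.contDiffOn)
  have i3 := hstrip (continuousOn_dPhi heP.contDiffOn)
  have i4 := hstrip (continuousOn_dRho heQ.contDiffOn)
  have i5 := hstrip (continuousOn_dPhi heQ.contDiffOn)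
  have i12 : IntegrableOn (fun z => |eP z| + |dRho eP z|) domain := i1.add i2
  have i13 : IntegrableOn (fun z => |eP z| + |dRho eP z| + |dPhi eP z|) domain := i12.add i3
  have i14 : IntegrableOn (fun z => |eP z| + |dRho eP z| + |dPhi eP z| + |dRho eQ z|) domain :=
    i13.add i4
  rw [energy, energy, ← integral_sub hint' hint]
  calc |∫ z in domain, (energyIntegrand κ p ε γ h P' Q' z - energyIntegrand κ p ε γ h P Q z)|
      ≤ ∫ z in domain,
        |energyIntegrand κ p ε γ h P' Q' z - energyIntegrand κ p ε γ h P Q z| :=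
        abs_integral_le_integral_abs
    _ ≤ ∫ z in domain, L * (|eP z| + |dRho eP z| + |dPhi eP z| + |dRho eQ z| + |dPhi eQ z|) := by
        refine setIntegral_mono_on (hint'.sub hint).abs
          ((i14.add i5).const_mul L) measurableSet_domain fun z hz => ?_
        have hz' := domain_subset_closedDomain hz
        have h1 := (hlip _ ⟨z, hz', rfl⟩ _ (hnear z hz')).2
        have h2 := radius_div_rhoR_le_one hε hεγ hγ hz'.1
        have h3 : 0 ≤ radius ε γ z.1 / R :=
          (div_pos (radius_pos hε hεγ hz'.1) (rhoR_pos hεγ)).le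
        rw [energyIntegrand_eq, energyIntegrand_eq, ← sub_mul, abs_mul, abs_of_nonneg h3]
        calc _ ≤ |density κ p h R (jet ε γ P' Q' z) - density κ p h R (jet ε γ P Q z)| * 1 := by
              gcongr
          _ ≤ L * dist (jet ε γ P' Q' z) (jet ε γ P Q z) := by rwa [mul_one]
          _ ≤ _ := by
              gcongr
              exact hdist z hz'
    _ = L * ((∫ z in domain, |eP z|) + (∫ z in domain, |dRho eP z|) + (∫ z in domain, |dPhi eP z|)
        + (∫ z in domain, |dRho eQ z|) + ∫ z in domain, |dPhi eQ z|) := by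
        rw [integral_const_mul, integral_add i14 i5, integral_add i13 i4, integral_add i12 i3,
          integral_add i1 i2]
    _ ≤ L * (5 * η) := by
        refine mul_le_mul_of_nonneg_left ?_ hL
        linarith [heP.integral_le, heP.integral_dRho_le, heP.integral_dPhi_le,
          heQ.integral_dRho_le, heQ.integral_dPhi_le]

/-! ### Rates of convergence -/

theorem inv_pow_add_inv_pow_le {l M N q : ℕ} (hl : 2 ≤ l) (hq : 0 < q) (hN : N = 2 * q) :
    ((M : ℝ) ^ (l - 2))⁻¹ + ((q : ℝ) ^ (l - 1))⁻¹
      ≤ 2 ^ (l - 1) * ((M : ℝ) ^ (2 - (l : ℤ)) + (N : ℝ) ^ (1 - (l : ℤ))) := by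
  have hM : (M : ℝ) ^ (2 - (l : ℤ)) = ((M : ℝ) ^ (l - 2))⁻¹ := by
    rw [← zpow_natCast, ← zpow_neg]
    congr 1
    omega
  have hN' : (N : ℝ) ^ (1 - (l : ℤ)) = ((N : ℝ) ^ (l - 1))⁻¹ := by
    rw [← zpow_natCast, ← zpow_neg]
    congr 1
    omega
  have hq' : (0 : ℝ) < q := by exact_mod_cast hq
  have h1 : ((q : ℝ) ^ (l - 1))⁻¹ = 2 ^ (l - 1) * ((N : ℝ) ^ (l - 1))⁻¹ := by
    rw [hN]
    push_cast
    rw [mul_pow]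
    field_simp
  have h2 : (1 : ℝ) ≤ 2 ^ (l - 1) := one_le_pow₀ (by norm_num)
  have h3 : 0 ≤ ((M : ℝ) ^ (l - 2))⁻¹ := by positivity
  rw [hM, hN', h1, mul_add]
  nlinarith

theorem exists_interp_energy_error {κ p ε γ : ℝ} (hp : 0 ≤ p) (hε : 0 < ε) (hεγ : ε < γ)
    (hγ : γ ≤ 1) {h : ℝ → ℝ} (hh : ContDiffOn ℝ 1 h (Ioi 0)) {P Q : ℝ × ℝ → ℝ}
    (hP : ContDiffOn ℝ 1 P (Icc (-1) 1 ×ˢ univ)) (hQ : ContDiffOn ℝ 1 Q (Icc (-1) 1 ×ˢ univ))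
    (hPper : PeriodicPhi P) (hQper : PeriodicPhi Q) {l : ℕ} (hl : 5 ≤ l)
    (hPs : MemSobolev l l P) (hQs : MemSobolev l l Q)
    (hD : ∀ z ∈ closedDomain, 0 < detD ε γ P Q z)
    (hF : ∀ z ∈ closedDomain, 0 < normF ε γ P Q z) :
    ∃ C : ℝ, 0 < C ∧ ∃ n₀ : ℕ, 0 < n₀ ∧ ∀ M N : ℕ, n₀ ≤ M → 2 * n₀ ≤ N → Even N →
      (∀ z ∈ closedDomain, 0 < detD ε γ (interp M N P) (interp M N Q) z) ∧
      IntegrableOn (energyIntegrand κ p ε γ h (interp M N P) (interp M N Q)) domain ∧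
      |energy κ p ε γ h (interp M N P) (interp M N Q) - energy κ p ε γ h P Q|
        ≤ C * ((M : ℝ) ^ (2 - (l : ℤ)) + (N : ℝ) ^ (1 - (l : ℤ))) := by
  obtain ⟨CP, hCP, heP⟩ := hPs.exists_errBound hl hP hPper
  obtain ⟨CQ, hCQ, heQ⟩ := hQs.exists_errBound hl hQ hQper
  obtain ⟨L, hL, δ₀, hδ₀, hstab⟩ := exists_energy_stability (κ := κ) hp hε hεγ hγ hh hP hQ hD hF
  set B := CP + CQ with hB
  have hB0 : 0 ≤ B := by positivity
  -- Chosen so that `M, q ≥ n + 1` give `5 B (1/M + 1/q) ≤ 10 B/(n+1) < δ₀`. The lower bound on `N =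
  -- 2q` is therefore doubled; the summand `1` in the constant only makes it positive.
  obtain ⟨n, hn⟩ := exists_nat_gt (10 * B / δ₀)
  refine ⟨L * (5 * (B * 2 ^ (l - 1))) + 1, by positivity, n + 1, n.succ_pos,
    fun M N hM hN hE => ?_⟩
  obtain ⟨q, hq⟩ := hE
  have hNq : N = 2 * q := by omega
  have hM0 : 0 < M := by omega
  have hq0 : 0 < q := by omega
  have hnpos : (0 : ℝ) < n + 1 := by positivity
  have hM1 : 1 / (M : ℝ) ≤ 1 / (n + 1) := by
    gcongr
    exact_mod_cast hM
  have hq1 : 1 / (q : ℝ) ≤ 1 / (n + 1) := by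
    gcongr
    exact_mod_cast (show n + 1 ≤ q by omega)
  have hsmall : 5 * (B * (1 / M + 1 / q)) < δ₀ := by
    calc 5 * (B * (1 / M + 1 / q)) ≤ 5 * (B * (1 / (n + 1) + 1 / (n + 1))) := by gcongr
      _ = 10 * B / (n + 1) := by ring
      _ < δ₀ := by
        rw [div_lt_iff₀ hnpos]
        rw [div_lt_iff₀ hδ₀] at hn
        nlinarith
  have hδ : 0 ≤ 1 / (M : ℝ) + 1 / q := by positivity
  have hη : 0 ≤ ((M : ℝ) ^ (l - 2))⁻¹ + ((q : ℝ) ^ (l - 1))⁻¹ := by positivity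
  have hsmooth : ∀ v, ContDiffOn ℝ 1 (interp M N v) (Icc (-1) 1 ×ˢ univ) := fun v =>
    (isInterpolant_interp hM0 (by omega) ⟨q, hq⟩ v).1.contDiff.contDiffOn
  have hPb := (heP M q hM0 hq0).mono
    (mul_le_mul_of_nonneg_right (show CP ≤ B by linarith) hδ)
    (mul_le_mul_of_nonneg_right (show CP ≤ B by linarith) hη)
  have hQb := (heQ M q hM0 hq0).mono
    (mul_le_mul_of_nonneg_right (show CQ ≤ B by linarith) hδ)
    (mul_le_mul_of_nonneg_right (show CQ ≤ B by linarith) hη)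
  rw [← hNq] at hPb hQb
  obtain ⟨h1, h2, h3⟩ := hstab _ _ (hsmooth P) (hsmooth Q) _ _ hPb hQb hsmall
  refine ⟨h1, h2, h3.trans ?_⟩
  have hrate := inv_pow_add_inv_pow_le (M := M) (show 2 ≤ l by omega) hq0 hNq
  have hrate0 : 0 ≤ (M : ℝ) ^ (2 - (l : ℤ)) + (N : ℝ) ^ (1 - (l : ℤ)) := by positivity
  calc _ ≤ L * (5 * (B * (2 ^ (l - 1) * ((M : ℝ) ^ (2 - (l : ℤ)) + (N : ℝ) ^ (1 - (l : ℤ)))))) := by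
        gcongr
    _ ≤ _ := by nlinarith

end Cavitation

end

/-! ### The main theorem -/

theorem theorem4p5
    -- the material: `W(A) = κ |A|^p + h(det A)` is positive on matrices of positive determinant
    (κ p : ℝ) (hκ : 0 < κ) (hp₁ : 1 < p) (hp₂ : p < 2)
    (h : ℝ → ℝ) (h_smooth : ContDiffOn ℝ 3 h (Set.Ioi 0))
    (h_convex : StrictConvexOn ℝ (Set.Ioi 0) h)
    (h_zero : Filter.Tendsto h (nhdsWithin 0 (Set.Ioi 0)) Filter.atTop)
    (h_infty : Filter.Tendsto (fun t => h t / t) Filter.atTop Filter.atTop)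
    (hW : ∀ A : Matrix (Fin 2) (Fin 2) ℝ, 0 < A.det → 0 < Cavitation.storedEnergy κ p h A)
    -- the reference annulus and the boundary data
    (ε γ : ℝ) (hε : 0 < ε) (hεγ : ε < γ) (hγ : γ ≤ 1) (P₀ Q₀ : ℝ → ℝ)
    -- the cavitation solution: admissible, regular, and an energy minimizer
    (P Q : ℝ × ℝ → ℝ) (hPQ : Cavitation.MemBPlus ε γ P₀ Q₀ P Q)
    (l : ℕ) (hl : 6 < l)
    (hP : Cavitation.MemSobolev l l P) (hQ : Cavitation.MemSobolev l l Q)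
    (hmin : ∀ P' Q' : ℝ × ℝ → ℝ, Cavitation.MemBPlus ε γ P₀ Q₀ P' Q' →
      Cavitation.energy κ p ε γ h P Q ≤ Cavitation.energy κ p ε γ h P' Q')
    -- two-sided bounds on `2 r² F` and on `D`
    (c_F c_D : ℝ) (hcF : 1 < c_F) (hcD : 1 < c_D)
    (hF : ∀ z ∈ Cavitation.closedDomain,
      c_F⁻¹ ≤ 2 * Cavitation.radius ε γ z.1 ^ 2 * Cavitation.normF ε γ P Q z ∧
      2 * Cavitation.radius ε γ z.1 ^ 2 * Cavitation.normF ε γ P Q z ≤ c_F)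
    (hD : ∀ z ∈ Cavitation.closedDomain,
      c_D⁻¹ ≤ Cavitation.detD ε γ P Q z ∧ Cavitation.detD ε γ P Q z ≤ c_D) :
    0 < Cavitation.energy κ p ε γ h P Q ∧
    ∃ (C : ℝ) (M₀ N₀ : ℕ), 0 < C ∧ 1 ≤ M₀ ∧ 2 ≤ N₀ ∧
      ∀ M N : ℕ, M₀ ≤ M → N₀ ≤ N → Even N →
        -- the energy of the interpolant is well defined
        (∀ z ∈ Cavitation.closedDomain,
          0 < Cavitation.detD ε γ (Cavitation.interp M N P) (Cavitation.interp M N Q) z) ∧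
        MeasureTheory.IntegrableOn
          (Cavitation.energyIntegrand κ p ε γ h
            (Cavitation.interp M N P) (Cavitation.interp M N Q)) Cavitation.domain ∧
        -- relative and absolute error
        |Cavitation.energy κ p ε γ h (Cavitation.interp M N P) (Cavitation.interp M N Q)
            - Cavitation.energy κ p ε γ h P Q| / Cavitation.energy κ p ε γ h P Q
          ≤ C * ((M : ℝ) ^ (2 - (l : ℤ)) + (N : ℝ) ^ (1 - (l : ℤ))) ∧
        |Cavitation.energy κ p ε γ h (Cavitation.interp M N P) (Cavitation.interp M N Q)
            - Cavitation.energy κ p ε γ h P Q|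
          ≤ C * ((M : ℝ) ^ (2 - (l : ℤ)) + (N : ℝ) ^ (1 - (l : ℤ))) := by
  have hD0 : ∀ z ∈ Cavitation.closedDomain, 0 < Cavitation.detD ε γ P Q z := hPQ.det_pos
  have hF0 : ∀ z ∈ Cavitation.closedDomain, 0 < Cavitation.normF ε γ P Q z := by
    intro z hz
    have h1 : 0 < c_F⁻¹ := by positivity
    have h2 : 0 < 2 * Cavitation.radius ε γ z.1 ^ 2 :=
      mul_pos two_pos (pow_pos (Cavitation.radius_pos hε hεγ hz.1) 2)
    exact pos_of_mul_pos_right (h1.trans_le (hF z hz).1) h2.le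
  have hh : ContDiffOn ℝ 1 h (Set.Ioi 0) := h_smooth.of_le (by norm_num)
  have hp0 : 0 ≤ p := by linarith
  have hE := Cavitation.energy_pos hp0 hε hεγ hh.continuousOn hW hPQ.contDiff_P hPQ.contDiff_Q hD0
  obtain ⟨C, hC, n₀, hn₀, hrate⟩ := Cavitation.exists_interp_energy_error (κ := κ) hp0 hε hεγ hγ hh
    hPQ.contDiff_P hPQ.contDiff_Q hPQ.periodic_P hPQ.periodic_Q (by omega) hP hQ hD0 hF0
  -- The constant dominates both `C`, for the absolute error, and `C / E`, for the relative one.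
  refine ⟨hE, C + C / Cavitation.energy κ p ε γ h P Q, n₀, 2 * n₀, by positivity, by omega,
    by omega, fun M N hM hN hNE => ?_⟩
  obtain ⟨h1, h2, h3⟩ := hrate M N hM hN hNE
  have hr : 0 ≤ (M : ℝ) ^ (2 - (l : ℤ)) + (N : ℝ) ^ (1 - (l : ℤ)) := by positivity
  refine ⟨h1, h2, ?_, h3.trans (mul_le_mul_of_nonneg_right ?_ hr)⟩
  · refine (div_le_div_of_nonneg_right h3 hE.le).trans ?_
    rw [mul_div_right_comm]
    refine mul_le_mul_of_nonneg_right ?_ hr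
    linarith
  · have : 0 ≤ C / Cavitation.energy κ p ε γ h P Q := by positivity
    linarith
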